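/- **Conventions.** Subscripts $1,2$ (or $\mu,\nu$) denote partial derivatives in the two parameters. A *crease pattern* of an open set $\Omega\subset\mathbb R^2$ is a locally finite family of disjoint non-empty connected open pieces of $\Omega$ whose closures cover $\bar\Omega$ and whose boundaries inside $\Omega$ lie on a locally finite network of smooth regular simple arcs meeting at most at common endpoints. Relative to a crease pattern, a map is *piecewise smooth* if it is continuous on $\bar\Omega$ and smooth on each piece, with all derivatives extending continuously to the closed piece; it is *piecewise differentiable* if on each piece it coincides with a function differentiable on the closed piece (jumps are allowed). A *surface* is a piecewise smooth map $\bar\Omega\to\mathbb R^3$ whose first partial derivatives are linearly independent on every closed piece (as limits from within the piece). Fix a rectangular unit cell with sides $a,c>0$. A *periodic surface* is a surface over $\mathbb R^2$ of the form $u\,\mathbf p_1+v\,\mathbf p_2+\tilde{\mathbf x}(u,v)$ with $\mathbf p_1,\mathbf p_2\in\mathbb R^3$ linearly independent and $\tilde{\mathbf x}$ piecewise smooth and periodic relative to the cell; its effective metric is $I_{\mu\nu}=\langle\mathbf p_\mu,\mathbf p_\nu\rangle$. Surfaces $\mathbf x,\mathbf y$ are isometric if $\mathbf y$ is smooth wherever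 $\mathbf x$ is and $\langle\mathbf x_\mu,\mathbf x_\nu\rangle=\langle\mathbf y_\mu,\mathbf y_\nu\rangle$ there. **Hypotheses.** Let $\mathbf x$ be a periodic surface with crease pattern $P$, let $J\subset\mathbb R$ be a non-degenerate interval, and let $\mathbf b(t)$, $t\in J$, be a family of periodic surfaces isometric to $\mathbf x$, $$\mathbf b(t)(u,v)=u\,\mathbf p_1(t)+v\,\mathbf p_2(t)+\tilde{\mathbf b}(t,u,v),$$ with the same crease pattern $P$, continuously differentiable in $t$ as a map into the maps that are smooth on the closed pieces of $P$. Let $I_{\mu\nu}(t)=\langle\mathbf p_\mu(t),\mathbf p_\nu(t)\rangle$. Let $\Omega\subset\mathbb R^2$ be non-empty, open and connected, and let the surface $\mathbf Y:\bar\Omega\to\mathbb R^3$ be a *unimodal effective isometry* of $\mathbf x$ of mode $\mathbf b$. That is, relative to a crease pattern $Q$ of $\Omega$ for which $\mathbf Y$ is a surface, there are piecewise differentiable $\theta_0:\bar\Omega\to J$, $\mathbf R:\bar\Omega\to O_3(\mathbb R)$, $\mathbf T:\bar\Omega\to\mathbb R^3$ and continuous maps $\mathbf z^1,\mathbf z^2:\bar\Omega\times\mathbb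 R^2\to\mathbb R^3$, periodic in the second variable, with $\mathbf z^2$ smooth up to the boundary on the products of pieces of $Q$ and of $P$, and with $$\mathbf z^1(U,V,u,v)=\mathbf R(U,V)\,\mathbf b(\theta_0(U,V))(u,v)-\mathbf Y_U(U,V)\,u-\mathbf Y_V(U,V)\,v+\mathbf T(U,V)$$ for $(U,V)$ in the pieces of $Q$, such that, with $\mathbf x^\epsilon(q)=\epsilon\,\mathbf x(q/\epsilon)$, the maps $$\mathbf y^\epsilon(q)=\mathbf Y(q)+\epsilon\,\mathbf z^1(q,q/\epsilon)+\epsilon^2\,\mathbf z^2(q,q/\epsilon)$$ are, for all small $\epsilon>0$, surfaces over $\bar\Omega$ that are smooth wherever $\mathbf x^\epsilon$ is, satisfy $\langle\mathbf x^\epsilon_\mu,\mathbf x^\epsilon_\nu\rangle-\langle\mathbf y^\epsilon_\mu,\mathbf y^\epsilon_\nu\rangle=O(\epsilon^2)$ uniformly on the points of $\Omega$ where $\mathbf x^\epsilon$ is smooth, and converge to $\mathbf Y$ uniformly on $\bar\Omega$ as $\epsilon\to0$. **Conclusion.** The functions $I_{\mu\nu}$ are differentiable on $J$; put $\mathbf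 E=\dot{\mathbf I}/2$. There is a piecewise differentiable function $\theta:\bar\Omega\to J$ such that, at every point of $\Omega$ where $\mathbf Y$ is smooth and $\theta$ is continuous, $$\langle\mathbf Y_\mu,\mathbf Y_\nu\rangle=I_{\mu\nu}(\theta)\qquad(\mu,\nu\in\{1,2\})$$ and $$E_{22}(\theta)\,\mathbf Y_{11}+E_{11}(\theta)\,\mathbf Y_{22}-2E_{12}(\theta)\,\mathbf Y_{12}=\mathbf 0.$$ -/

import Mathlib

open Set Filter Topology
open scoped ContDiff

namespace CreasedSurface

/-- The parameter plane, with coordinates `(u, v)`. -/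
abbrev Par := ℝ × ℝ

/-- Euclidean three-space. -/
abbrev E3 := EuclideanSpace ℝ (Fin 3)

/-- The coordinate directions of the parameter plane. -/
def dir : Fin 2 → Par := ![(1, 0), (0, 1)]

/-- Partial derivative of `f` in the `μ`-th coordinate. -/
noncomputable def pd (μ : Fin 2) (f : Par → E3) (q : Par) : E3 := fderiv ℝ f q (dir μ)

/-- The metric coefficient `⟨f_μ, f_ν⟩`. -/
noncomputable def metric (f : Par → E3) (μ ν : Fin 2) (q : Par) : ℝ :=
  inner ℝ (pd μ f q) (pd ν f q)

/-- A decomposition of `Ω` into a locally finite family of disjoint non-empty connected open pieces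
whose closures cover the closure of `Ω`. Inside `Ω`, the pieces are bounded by a locally finite
network of smooth regular simple arcs, any two of which meet at most in common endpoints. -/
structure CreasePattern (Ω : Set Par) where
  /-- index of the pieces -/
  ι : Type
  /-- the pieces -/
  piece : ι → Set Par
  /-- index of the arcs -/
  κ : Type
  /-- the arcs, parametrized by `[0, 1]` -/
  arc : κ → ℝ → Par
  isOpen_piece : ∀ i, IsOpen (piece i)
  isConnected_piece : ∀ i, IsConnected (piece i)
  piece_subset : ∀ i, piece i ⊆ Ω
  disjoint_piece : ∀ i j, i ≠ j → Disjoint (piece i) (piece j)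
  locallyFinite_piece : LocallyFinite piece
  cover : closure Ω ⊆ ⋃ i, closure (piece i)
  arc_smooth : ∀ k, ContDiffOn ℝ ∞ (arc k) (Icc 0 1)
  arc_regular : ∀ k, ∀ s ∈ Icc (0 : ℝ) 1, derivWithin (arc k) (Icc 0 1) s ≠ 0
  arc_injOn : ∀ k, InjOn (arc k) (Icc 0 1)
  arc_meet : ∀ k l, k ≠ l →
    arc k '' Icc 0 1 ∩ arc l '' Icc 0 1 ⊆ arc k '' {0, 1} ∩ arc l '' {0, 1}
  locallyFinite_arc : LocallyFinite fun k => arc k '' Icc 0 1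
  frontier_subset : ∀ i, frontier (piece i) ∩ Ω ⊆ ⋃ k, arc k '' Icc 0 1

/-- `f` is smooth on the open set `S` up to its boundary: it is smooth on `S` and its derivatives
of all orders extend continuously to the closure of `S`. -/
def SmoothUpTo {V W : Type*} [NormedAddCommGroup V] [NormedSpace ℝ V]
    [NormedAddCommGroup W] [NormedSpace ℝ W] (f : V → W) (S : Set V) : Prop :=
  ContDiffOn ℝ ∞ f S ∧
    ∀ n : ℕ, ∃ g : V → ContinuousMultilinearMap ℝ (fun _ : Fin n => V) W,
      ContinuousOn g (closure S) ∧ EqOn g (iteratedFDeriv ℝ n f) S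

/-- `f` is piecewise smooth over `closure Ω`: continuous, and smooth on every closed piece. -/
def IsPiecewiseSmooth {Ω : Set Par} (Q : CreasePattern Ω) (f : Par → E3) : Prop :=
  ContinuousOn f (closure Ω) ∧ ∀ i, SmoothUpTo f (Q.piece i)

/-- `f` is piecewise differentiable: on every piece it coincides with a function that is
differentiable on the closed piece. It may be discontinuous across the boundaries of the pieces. -/
def IsPiecewiseDifferentiable {Ω : Set Par} (Q : CreasePattern Ω)
    {W : Type*} [NormedAddCommGroup W] [NormedSpace ℝ W] (f : Par → W) : Prop :=
  ∀ i, ∃ g : Par → W, DifferentiableOn ℝ g (closure (Q.piece i)) ∧ EqOn f g (Q.piece i)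

/-- `f` is a surface over `closure Ω`: piecewise smooth, with linearly independent partial
derivatives on every closed piece (on the boundary of a piece, the derivative is the limit taken
from within the piece). -/
def IsSurface {Ω : Set Par} (Q : CreasePattern Ω) (f : Par → E3) : Prop :=
  IsPiecewiseSmooth Q f ∧
    ∀ i, ∃ D : Par → Par →L[ℝ] E3, ContinuousOn D (closure (Q.piece i)) ∧
      EqOn D (fderiv ℝ f) (Q.piece i) ∧
      ∀ q ∈ closure (Q.piece i), LinearIndependent ℝ fun μ => D q (dir μ)

/-- Periodicity relative to a unit cell with sides `a` and `c`. -/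
def IsCellPeriodic (a c : ℝ) (f : Par → E3) : Prop :=
  ∀ q : Par, f (q.1 + a, q.2) = f q ∧ f (q.1, q.2 + c) = f q

/-- `x` is a periodic surface with support vectors `p 0`, `p 1`. -/
def IsPeriodicSurface (a c : ℝ) (P : CreasePattern univ) (p : Fin 2 → E3) (x : Par → E3) : Prop :=
  IsSurface P x ∧ LinearIndependent ℝ p ∧
    ∃ corr : Par → E3, IsPiecewiseSmooth P corr ∧ IsCellPeriodic a c corr ∧
      ∀ q : Par, x q = q.1 • p 0 + q.2 • p 1 + corr q

/-- Over `Ω`, `y` is smooth wherever `x` is: it has no new creases. -/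
def SmoothWherever (Ω : Set Par) (x y : Par → E3) : Prop :=
  ∀ q ∈ Ω, ContDiffAt ℝ ∞ x q → ContDiffAt ℝ ∞ y q

/-- The surfaces `x` and `y` over the whole plane are isometric. -/
def IsIsometric (x y : Par → E3) : Prop :=
  SmoothWherever univ x y ∧
    ∀ q, ContDiffAt ℝ ∞ x q → ∀ μ ν, metric x μ ν q = metric y μ ν q

/-- `t ↦ b t` is a continuously differentiable map from `J` to the maps that are smooth on the
closed pieces of `P`: on each piece, the `(u, v)`-derivatives of `b t` of all orders are
differentiable in `t`, and they and their `t`-derivatives are jointly continuous in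
`(t, (u, v))` up to the boundary of the piece. -/
def IsC1Family (P : CreasePattern univ) (J : Set ℝ) (b : ℝ → Par → E3) : Prop :=
  ∀ (i : P.ι) (n : ℕ), ∃ g h : ℝ × Par → ContinuousMultilinearMap ℝ (fun _ : Fin n => Par) E3,
    ContinuousOn g (J ×ˢ closure (P.piece i)) ∧ ContinuousOn h (J ×ˢ closure (P.piece i)) ∧
    ∀ t ∈ J, ∀ q ∈ P.piece i, g (t, q) = iteratedFDeriv ℝ n (b t) q ∧
      HasDerivWithinAt (fun s => iteratedFDeriv ℝ n (b s) q) (h (t, q)) J t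

/-- `b` is a mode of `x`: a continuously differentiable one-parameter family, indexed by `J`, of
periodic surfaces isometric to `x`; the support vectors of `b t` are `p t 0` and `p t 1`. -/
def IsMode (a c : ℝ) (P : CreasePattern univ) (x : Par → E3) (J : Set ℝ)
    (p : ℝ → Fin 2 → E3) (b : ℝ → Par → E3) : Prop :=
  IsC1Family P J b ∧ ∀ t ∈ J, IsPeriodicSurface a c P (p t) (b t) ∧ IsIsometric x (b t)

/-- The effective metric `I_{μν}(t) = ⟨p_μ(t), p_ν(t)⟩` of a mode. -/
noncomputable def effMetric (p : ℝ → Fin 2 → E3) (μ ν : Fin 2) (t : ℝ) : ℝ :=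
  inner ℝ (p t μ) (p t ν)

/-- The effective infinitesimal strain `E = İ / 2` of a mode indexed by `J`. -/
noncomputable def effStrain (J : Set ℝ) (p : ℝ → Fin 2 → E3) (μ ν : Fin 2) (t : ℝ) : ℝ :=
  derivWithin (effMetric p μ ν) J t / 2

/-- The surface with refined corrugations, `x^ε(q) = ε x(q / ε)`. -/
noncomputable def refine (x : Par → E3) (ε : ℝ) (q : Par) : E3 := ε • x (ε⁻¹ • q)

/-- `Y` is an effective isometry of `x` over `closure Ω`, as the uniform limit of the surfaces
`y ε` when `ε → 0⁺`; these are smooth wherever `x^ε` is and have the metric of `x^ε` up to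
`O(ε²)`. -/
def IsEffectiveIsometry (Ω : Set Par) (x : Par → E3) (y : ℝ → Par → E3) (Y : Par → E3) : Prop :=
  (∃ Q : CreasePattern Ω, IsSurface Q Y) ∧
  (∀ᶠ ε in 𝓝[>] (0 : ℝ), (∃ Q : CreasePattern Ω, IsSurface Q (y ε)) ∧
    SmoothWherever Ω (refine x ε) (y ε)) ∧
  (∃ C : ℝ, ∀ᶠ ε in 𝓝[>] (0 : ℝ), ∀ q ∈ Ω, ContDiffAt ℝ ∞ (refine x ε) q →
    ∀ μ ν, |metric (refine x ε) μ ν q - metric (y ε) μ ν q| ≤ C * ε ^ 2) ∧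
  TendstoUniformlyOn y Y (𝓝[>] 0) (closure Ω)

/-- The two-scale ansatz `Y(q) + ε z¹(q, q/ε) + ε² z²(q, q/ε)`. -/
noncomputable def ansatz (Y : Par → E3) (z₁ z₂ : Par → Par → E3) (ε : ℝ) (q : Par) : E3 :=
  Y q + ε • z₁ q (ε⁻¹ • q) + ε ^ 2 • z₂ q (ε⁻¹ • q)

/-- `Y` is a unimodal effective isometry of `x` of mode `b` over `closure Ω`. The fields `θ`, `R`
and `T` are piecewise differentiable only, so that the expression of `z₁` is imposed on the open
pieces; there, it determines the regularity of `z₁`. -/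
def IsUnimodalEffectiveIsometry (a c : ℝ) (P : CreasePattern univ) (Ω : Set Par)
    (x : Par → E3) (J : Set ℝ) (b : ℝ → Par → E3) (Y : Par → E3) : Prop :=
  ∃ (Q : CreasePattern Ω) (z₁ z₂ : Par → Par → E3)
    (θ : Par → ℝ) (R : Par → E3 →L[ℝ] E3) (T : Par → E3),
    IsEffectiveIsometry Ω x (ansatz Y z₁ z₂) Y ∧
    IsSurface Q Y ∧
    IsPiecewiseDifferentiable Q θ ∧ (∀ U ∈ closure Ω, θ U ∈ J) ∧
    IsPiecewiseDifferentiable Q R ∧ (∀ U ∈ closure Ω, R U ∈ unitary (E3 →L[ℝ] E3)) ∧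
    IsPiecewiseDifferentiable Q T ∧
    (∀ U ∈ closure Ω, IsCellPeriodic a c (z₁ U) ∧ IsCellPeriodic a c (z₂ U)) ∧
    ContinuousOn (Function.uncurry z₁) (closure Ω ×ˢ univ) ∧
    ContinuousOn (Function.uncurry z₂) (closure Ω ×ˢ univ) ∧
    (∀ j i, SmoothUpTo (Function.uncurry z₂) (Q.piece j ×ˢ P.piece i)) ∧
    ∀ j, ∀ U ∈ Q.piece j, ∀ q : Par,
      z₁ U q = R U (b (θ U) q) - q.1 • pd 0 Y U - q.2 • pd 1 Y U + T U

end CreasedSurface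

open CreasedSurface

/-! Consider a slow point U inside a piece of the crease pattern of Y, where θ, R and T are
differentiable. Periodicity of z¹ in its fast variable forces Y_μ = R p_μ(θ)
(`IsAnsatzOn.fderiv_eq`); since R is orthogonal, this is the equation on the metric.

The derivative of y^ε in a direction v is R b_v + ε W_v plus ε² times the slow derivative of z²,
where W_v is the slow derivative of z¹ plus the fast derivative of z². Since b(θ) has the metric of
x, agreement of the metrics up to O(ε²) makes the symmetric part of ⟨R b_u, W_v⟩ vanish as ε → 0.
For fixed U, the ansatz is only seen at the fast points U/ε; if U has irrational slope relative to
the cell, these return, modulo the lattice, arbitrarily close to any fast point q for arbitrarily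
small ε (`exists_recurrence`). The identity thus holds for every q inside a piece of P
(`IsAnsatzOn.isometry_slow`).

Apply R* to return to the frame of b, still writing W for the result, and let ω_v be the vector with
R* ∂_v R = ω_v × ·. The velocity β = ∂b/∂t is an infinitesimal isometry of b, so it has a rotation
field w with w × b_v = β_v. The form η_v = ⟨w, W_v⟩ + ⟨ω_v, β⟩ in the fast variable is closed
(`IsBendingSystem.isClosedForm`). Inside the pieces, this follows from the symmetry of w_u × b_v in
u and v. Across a crease with tangent τ, the jump of w is parallel to b_τ, while ⟨b_τ, W_τ⟩ = 0, so
that the tangential component of η does not jump. Vertices are locally finite and η is locally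
bounded, so they carry no exterior derivative: η is closed in the weak sense
(`IsClosedForm.testForm_eq_zero`).

Everything in η is periodic except β, which is the linear map p' with values p'_1, p'_2 (the
t-derivatives of the support vectors) plus a periodic map. A closed form at bounded distance from a
form with linear coefficients has a closed linear part, as tests against wider and wider bumps show
(`IsClosedForm.linear_part_symm`). This gives the reciprocity ⟨ω_1, p'_2⟩ = ⟨ω_2, p'_1⟩
(`IsBendingSystem.reciprocity`).

Finally, differentiating Y_μ = R p_μ(θ) gives R* Y_μν = ω_ν × p_μ + θ_ν p'_μ. The symmetry of Y_μν
and the reciprocity imply the bending equation by pointwise algebra (`strain_curvature_identity`).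
Points of irrational slope are dense, and continuity reaches the remaining points. -/

namespace CreasedSurface

/-! ### Vector algebra: cross products and infinitesimal rotations -/

/-- The cross product of Euclidean three-space, as a bilinear map. -/
noncomputable def crossₗ : E3 →ₗ[ℝ] E3 →ₗ[ℝ] E3 :=
  LinearMap.mk₂ ℝ
    (fun x y => !₂[x 1 * y 2 - x 2 * y 1, x 2 * y 0 - x 0 * y 2, x 0 * y 1 - x 1 * y 0])
    (by intro x y z; ext i; fin_cases i <;> simp <;> ring)
    (by intro r x y; ext i; fin_cases i <;> simp <;> ring)
    (by intro x y z; ext i; fin_cases i <;> simp <;> ring)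
    (by intro r x y; ext i; fin_cases i <;> simp <;> ring)

/-- The cross product of Euclidean three-space, as a continuous bilinear map. -/
noncomputable def cross : E3 →L[ℝ] E3 →L[ℝ] E3 :=
  (LinearMap.toContinuousLinearMap.toLinearMap ∘ₗ crossₗ).toContinuousLinearMap

theorem inner_eq_sum (x y : E3) : inner ℝ x y = x 0 * y 0 + x 1 * y 1 + x 2 * y 2 := by
  simp [PiLp.inner_apply, Fin.sum_univ_three, mul_comm]

theorem cross_apply (x y : E3) : cross x y =
    !₂[x 1 * y 2 - x 2 * y 1, x 2 * y 0 - x 0 * y 2, x 0 * y 1 - x 1 * y 0] := rfl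

@[simp] theorem cross_zero_apply (x y : E3) : cross x y 0 = x 1 * y 2 - x 2 * y 1 := by
  simp [cross_apply]
@[simp] theorem cross_one_apply (x y : E3) : cross x y 1 = x 2 * y 0 - x 0 * y 2 := by
  simp [cross_apply]
@[simp] theorem cross_two_apply (x y : E3) : cross x y 2 = x 0 * y 1 - x 1 * y 0 := by
  simp [cross_apply]

theorem inner_cross_swap (x y z : E3) :
    inner ℝ x (cross y z) = - inner ℝ y (cross x z) := by
  simp [inner_eq_sum]; ring

theorem inner_cross_left (x y : E3) : inner ℝ x (cross x y) = 0 := by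
  simp [inner_eq_sum]; ring

theorem cross_cross (x y z : E3) :
    cross x (cross y z) = (inner ℝ x z : ℝ) • y - (inner ℝ x y : ℝ) • z := by
  rw [inner_eq_sum, inner_eq_sum]
  ext i; fin_cases i <;> simp <;> ring

/-- A vector orthogonal to `a`, `b` and `a × b` vanishes, for independent `a` and `b`. -/
theorem eq_zero_of_inner_eq_zero {a b X : E3} (h : cross a b ≠ 0) (ha : inner ℝ X a = 0)
    (hb : inner ℝ X b = 0) (hn : inner ℝ X (cross a b) = 0) : X = 0 := by
  have hN : (inner ℝ (cross a b) (cross a b) : ℝ) ≠ 0 := by simpa using h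
  -- Expansion of the squared length of X in the frame a, b, a × b, multiplied by the Gram
  -- determinant of a and b, which is the squared length of a × b.
  have key : (inner ℝ (cross a b) (cross a b) : ℝ) * inner ℝ X X
      = inner ℝ X (cross a b) ^ 2 + inner ℝ b b * inner ℝ X a ^ 2 + inner ℝ a a * inner ℝ X b ^ 2
        - 2 * inner ℝ a b * inner ℝ X a * inner ℝ X b := by
    simp only [inner_eq_sum, cross_zero_apply, cross_one_apply, cross_two_apply]; ring
  rw [ha, hb, hn] at key
  have : (inner ℝ X X : ℝ) = 0 := by
    have : (inner ℝ (cross a b) (cross a b) : ℝ) * inner ℝ X X = 0 := by rw [key]; ring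
    exact (mul_eq_zero.1 this).resolve_left hN
  simpa using this

/-- If a × b = 0, expanding b × (a × b) yields a linear relation in which a has the nonzero
coefficient ⟨b, b⟩. -/
theorem cross_ne_zero {a b : E3} (h : LinearIndependent ℝ ![a, b]) : cross a b ≠ 0 := by
  intro h0
  have hb : b ≠ 0 := by simpa using h.ne_zero 1
  have hbb : (inner ℝ b b : ℝ) ≠ 0 := by simpa using hb
  have e : (inner ℝ b b : ℝ) • a + (- inner ℝ a b : ℝ) • b = 0 := by
    have h1 : (inner ℝ b b : ℝ) • a + (- inner ℝ a b : ℝ) • b = cross b (cross a b) := by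
      rw [cross_cross, real_inner_comm a b, neg_smul, sub_eq_add_neg]
    rw [h1, h0, map_zero]
  have := (LinearIndependent.pair_iff.1 h _ _ e).1
  exact hbb this

/-- Two vectors whose cross product vanishes: the first one is a multiple of the second. -/
theorem exists_smul_of_cross_eq_zero {x a : E3} (ha : a ≠ 0) (h : cross x a = 0) :
    ∃ r : ℝ, x = r • a := by
  have haa : (inner ℝ a a : ℝ) ≠ 0 := by simpa using ha
  refine ⟨inner ℝ x a / inner ℝ a a, ?_⟩
  have h1 : (inner ℝ a a : ℝ) • x - (inner ℝ x a : ℝ) • a = cross a (cross x a) := by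
    rw [cross_cross, real_inner_comm x a]
  rw [h, map_zero, sub_eq_zero] at h1
  rw [div_eq_inv_mul, mul_smul, ← h1, smul_smul, inv_mul_cancel₀ haa, one_smul]

/-- The first coordinate direction. -/
abbrev e₀ : Par := (1, 0)
/-- The second coordinate direction. -/
abbrev e₁ : Par := (0, 1)

theorem par_eq (v : Par) : v = v.1 • e₀ + v.2 • e₁ := by ext <;> simp

theorem map_par {F : Type*} [NormedAddCommGroup F] [NormedSpace ℝ F] (L : Par →L[ℝ] F) (v : Par) :
    L v = v.1 • L e₀ + v.2 • L e₁ := by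
  conv_lhs => rw [par_eq v]
  rw [map_add, map_smul, map_smul]

/-- The rotation vector `w` with `w × B v = C v`, for an immersion `B` and an infinitesimal
isometry `C`. -/
noncomputable def rot (B C : Par →L[ℝ] E3) : E3 :=
  (inner ℝ (cross (B e₀) (B e₁)) (cross (B e₀) (B e₁)) : ℝ)⁻¹ •
    ((inner ℝ (C e₀) (B e₁) : ℝ) • cross (B e₀) (B e₁)
      + (inner ℝ (C e₁) (cross (B e₀) (B e₁)) : ℝ) • B e₀
      - (inner ℝ (C e₀) (cross (B e₀) (B e₁)) : ℝ) • B e₁)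

/-- The six scalar equations for three unknowns are compatible because the strain condition amounts
to three relations among them. The formula of `rot` solves them in the frame of B e₀, B e₁ and their
cross product, and each equation is checked component by component in that frame. -/
theorem cross_rot {B C : Par →L[ℝ] E3} (hB : cross (B e₀) (B e₁) ≠ 0)
    (h : ∀ u v, inner ℝ (B u) (C v) + inner ℝ (B v) (C u) = (0 : ℝ)) (v : Par) :
    cross (rot B C) (B v) = C v := by
  have h00 : inner ℝ (B e₀) (C e₀) = (0 : ℝ) := by linarith [h e₀ e₀]
  have h11 : inner ℝ (B e₁) (C e₁) = (0 : ℝ) := by linarith [h e₁ e₁]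
  have h01 : inner ℝ (B e₀) (C e₁) = (- inner ℝ (B e₁) (C e₀) : ℝ) := by linarith [h e₀ e₁]
  have hN : (inner ℝ (cross (B e₀) (B e₁)) (cross (B e₀) (B e₁)) : ℝ) ≠ 0 := by simpa using hB
  have main : ∀ (a b c d : E3), inner ℝ a c = (0 : ℝ) → inner ℝ b d = (0 : ℝ) →
      inner ℝ a d = (- inner ℝ b c : ℝ) → (inner ℝ (cross a b) (cross a b) : ℝ) ≠ 0 →
      cross ((inner ℝ (cross a b) (cross a b) : ℝ)⁻¹ • ((inner ℝ c b : ℝ) • cross a b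
        + (inner ℝ d (cross a b) : ℝ) • a - (inner ℝ c (cross a b) : ℝ) • b)) a = c ∧
      cross ((inner ℝ (cross a b) (cross a b) : ℝ)⁻¹ • ((inner ℝ c b : ℝ) • cross a b
        + (inner ℝ d (cross a b) : ℝ) • a - (inner ℝ c (cross a b) : ℝ) • b)) b = d := by
    intro a b c d hac hbd hadc hN
    have hne : cross a b ≠ 0 := by simpa using hN
    simp only [map_smul, smul_apply]
    constructor
    · rw [inv_smul_eq_iff₀ hN, ← sub_eq_zero]
      apply eq_zero_of_inner_eq_zero hne
      · simp only [inner_eq_sum, cross_zero_apply, cross_one_apply, cross_two_apply,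
          PiLp.add_apply, PiLp.sub_apply, PiLp.smul_apply, smul_eq_mul] at hac hbd hadc ⊢
        linear_combination (-((a 1 * b 2 - a 2 * b 1) ^ 2 + (a 2 * b 0 - a 0 * b 2) ^ 2
          + (a 0 * b 1 - a 1 * b 0) ^ 2)) * hac
      · simp only [inner_eq_sum, cross_zero_apply, cross_one_apply, cross_two_apply,
          PiLp.add_apply, PiLp.sub_apply, PiLp.smul_apply, smul_eq_mul] at hac hbd hadc ⊢; ring
      · simp only [inner_eq_sum, cross_zero_apply, cross_one_apply, cross_two_apply,
          PiLp.add_apply, PiLp.sub_apply, PiLp.smul_apply, smul_eq_mul] at hac hbd hadc ⊢; ring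
    · rw [inv_smul_eq_iff₀ hN, ← sub_eq_zero]
      apply eq_zero_of_inner_eq_zero hne
      · simp only [inner_eq_sum, cross_zero_apply, cross_one_apply, cross_two_apply,
          PiLp.add_apply, PiLp.sub_apply, PiLp.smul_apply, smul_eq_mul] at hac hbd hadc ⊢
        linear_combination (-((a 1 * b 2 - a 2 * b 1) ^ 2 + (a 2 * b 0 - a 0 * b 2) ^ 2
          + (a 0 * b 1 - a 1 * b 0) ^ 2)) * hadc
      · simp only [inner_eq_sum, cross_zero_apply, cross_one_apply, cross_two_apply,
          PiLp.add_apply, PiLp.sub_apply, PiLp.smul_apply, smul_eq_mul] at hac hbd hadc ⊢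
        linear_combination (-((a 1 * b 2 - a 2 * b 1) ^ 2 + (a 2 * b 0 - a 0 * b 2) ^ 2
          + (a 0 * b 1 - a 1 * b 0) ^ 2)) * hbd
      · simp only [inner_eq_sum, cross_zero_apply, cross_one_apply, cross_two_apply,
          PiLp.add_apply, PiLp.sub_apply, PiLp.smul_apply, smul_eq_mul] at hac hbd hadc ⊢; ring
  obtain ⟨m0, m1⟩ := main _ _ _ _ h00 h11 h01 hN
  rw [map_par B v, map_par C v, map_add, map_smul, map_smul]
  unfold rot
  rw [m0, m1]

/-- A skew endomorphism of three-space is a cross product. -/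
theorem exists_cross_of_skew (S : E3 →L[ℝ] E3)
    (h : ∀ x y, inner ℝ (S x) y + inner ℝ x (S y) = (0 : ℝ)) : ∃ w, ∀ x, S x = cross w x := by
  let e : Fin 3 → E3 := fun i => EuclideanSpace.single i 1
  have hx : ∀ x : E3, x = x 0 • e 0 + x 1 • e 1 + x 2 • e 2 := by
    intro x; ext i; fin_cases i <;> simp [e]
  have hc : ∀ i j, S (e i) j + S (e j) i = 0 := by
    intro i j
    have := h (e i) (e j)
    simpa [e, EuclideanSpace.inner_single_left, EuclideanSpace.inner_single_right] using this
  -- The entries of w are read off the skew matrix of S, for instance ⟨w × e 1, e 2⟩ = w 0.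
  refine ⟨!₂[S (e 1) 2, S (e 2) 0, S (e 0) 1], fun x => ?_⟩
  have h00 := hc 0 0
  have h11 := hc 1 1
  have h22 := hc 2 2
  have h01 := hc 0 1
  have h02 := hc 0 2
  have h12 := hc 1 2
  conv_lhs => rw [hx x]
  simp only [map_add, map_smul]
  ext i
  fin_cases i
  · simp; linear_combination (x 0 / 2) * h00 + x 1 * h01
  · simp; linear_combination (x 1 / 2) * h11 + x 2 * h12
  · simp; linear_combination (x 2 / 2) * h22 + x 0 * h02

/-- The pointwise identity behind the effective equations: `p`, `p'` are the support vectors and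
their time derivatives, `w` the angular velocities and `t` the partial derivatives of the
amplitude. -/
theorem strain_curvature_identity (a b a' b' w₀ w₁ : E3) (t₀ t₁ : ℝ) (hab : cross a b ≠ 0)
    (hsymm : cross w₁ a + t₁ • a' = cross w₀ b + t₀ • b')
    (hw : inner ℝ w₀ b' = (inner ℝ w₁ a' : ℝ)) :
    (inner ℝ b b' : ℝ) • (cross w₀ a + t₀ • a') + (inner ℝ a a' : ℝ) • (cross w₁ b + t₁ • b')
      - (inner ℝ a b' + inner ℝ b a' : ℝ) • (cross w₀ b + t₀ • b') = 0 := by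
  have ha : (inner ℝ a _ : ℝ) = inner ℝ a _ := congrArg (inner ℝ a) hsymm
  have hb : (inner ℝ b _ : ℝ) = inner ℝ b _ := congrArg (inner ℝ b) hsymm
  have hn : (inner ℝ (cross a b) _ : ℝ) = inner ℝ (cross a b) _ := congrArg (inner ℝ (cross a b)) hsymm
  clear hsymm
  -- The components along a and b vanish by the symmetry `hsymm` alone; the reciprocity `hw` is what
  -- cancels the normal component.
  apply eq_zero_of_inner_eq_zero hab
  all_goals
    simp only [inner_eq_sum, cross_zero_apply, cross_one_apply, cross_two_apply,
      PiLp.add_apply, PiLp.sub_apply, PiLp.smul_apply, smul_eq_mul] at ha hb hn hw ⊢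
  · linear_combination (-(a 0 * a' 0 + a 1 * a' 1 + a 2 * a' 2)) * hb
      + (a 0 * b' 0 + a 1 * b' 1 + a 2 * b' 2 + (b 0 * a' 0 + b 1 * a' 1 + b 2 * a' 2)) * ha
  · linear_combination (b 0 * b' 0 + b 1 * b' 1 + b 2 * b' 2) * ha
  · linear_combination
      (-((a 1 * b 2 - a 2 * b 1) ^ 2 + (a 2 * b 0 - a 0 * b 2) ^ 2
          + (a 0 * b 1 - a 1 * b 0) ^ 2)) * hw
      - (a' 0 * (a 1 * b 2 - a 2 * b 1) + a' 1 * (a 2 * b 0 - a 0 * b 2)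
          + a' 2 * (a 0 * b 1 - a 1 * b 0)) * hb
      + (b' 0 * (a 1 * b 2 - a 2 * b 1) + b' 1 * (a 2 * b 0 - a 0 * b 2)
          + b' 2 * (a 0 * b 1 - a 1 * b 0)) * ha
      + (b 0 * a' 0 + b 1 * a' 1 + b 2 * a' 2) * hn


/-! ### Potentials of closed forms, on one side and on both sides of an axis -/

/-- A function of two variables that is continuous up to the axis `r = 0` from one side and whose
derivative in the first variable has a limit there has a differentiable trace on that axis. -/
theorem hasDerivAt_trace {F : Type*} [NormedAddCommGroup F] [NormedSpace ℝ F]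
    {f g : ℝ × ℝ → F} {l : F} {s₀ δ : ℝ} (hδ : 0 < δ) {ρ : Set ℝ} (hρ : (0 : ℝ) ∈ closure ρ)
    (hf : ∀ s ∈ Ioo (s₀ - δ) (s₀ + δ), Tendsto (fun r => f (s, r)) (𝓝[ρ] 0) (𝓝 (f (s, 0))))
    (hd : ∀ p ∈ Ioo (s₀ - δ) (s₀ + δ) ×ˢ ρ, HasDerivAt (fun s => f (s, p.2)) (g p) p.1)
    (hg : Tendsto g (𝓝[Ioo (s₀ - δ) (s₀ + δ) ×ˢ ρ] (s₀, 0)) (𝓝 l)) :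
    HasDerivAt (fun s => f (s, 0)) l s₀ := by
  rw [hasDerivAt_iff_isLittleO, Asymptotics.isLittleO_iff]
  intro ε hε
  rw [Metric.tendsto_nhdsWithin_nhds] at hg
  obtain ⟨δ', hδ', h⟩ := hg ε hε
  have hm : Ioo (s₀ - min δ δ') (s₀ + min δ δ') ∈ 𝓝 s₀ :=
    Ioo_mem_nhds (by have := lt_min hδ hδ'; linarith) (by have := lt_min hδ hδ'; linarith)
  have h0 : s₀ ∈ Ioo (s₀ - min δ δ') (s₀ + min δ δ') := mem_of_mem_nhds hm
  have hsub : Ioo (s₀ - min δ δ') (s₀ + min δ δ') ⊆ Ioo (s₀ - δ) (s₀ + δ) :=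
    Ioo_subset_Ioo (by linarith [min_le_left δ δ']) (by linarith [min_le_left δ δ'])
  have hne : (𝓝[ρ] (0 : ℝ)).NeBot := mem_closure_iff_nhdsWithin_neBot.1 hρ
  filter_upwards [hm] with s hs
  have hr : ∀ᶠ r in 𝓝[ρ] (0 : ℝ),
      ‖f (s, r) - f (s₀, r) - (s - s₀) • l‖ ≤ ε * ‖s - s₀‖ := by
    have hb : Metric.ball (0 : ℝ) δ' ∈ 𝓝[ρ] (0 : ℝ) :=
      mem_nhdsWithin_of_mem_nhds (Metric.ball_mem_nhds _ hδ')
    filter_upwards [hb, self_mem_nhdsWithin] with r hr hrρ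
    -- Mean value inequality for s ↦ f (s, r) - s • l at fixed r in ρ. The bound does not depend on
    -- r, so it survives the limit r → 0.
    have := (convex_Ioo (s₀ - min δ δ') (s₀ + min δ δ')).norm_image_sub_le_of_norm_hasDerivWithin_le
      (f := fun s => f (s, r) - s • l) (f' := fun s => g (s, r) - (1 : ℝ) • l) (C := ε)
      (fun x hx => ((hd (x, r) ⟨hsub hx, hrρ⟩).sub
        ((hasDerivAt_id x).smul_const l)).hasDerivWithinAt) (fun x hx => by
        have hx' : dist ((x, r) : ℝ × ℝ) (s₀, 0) < δ' := by
          rw [Prod.dist_eq, max_lt_iff]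
          refine ⟨?_, hr⟩
          rw [Real.dist_eq, abs_lt]
          exact ⟨by linarith [hx.1, min_le_right δ δ'], by linarith [hx.2, min_le_right δ δ']⟩
        have := h ⟨hsub hx, hrρ⟩ hx'
        rw [dist_eq_norm] at this
        simpa using this.le) h0 hs
    convert this using 2
    simp only [sub_smul]; abel
  have ht : Tendsto (fun r => ‖f (s, r) - f (s₀, r) - (s - s₀) • l‖) (𝓝[ρ] 0)
      (𝓝 ‖f (s, 0) - f (s₀, 0) - (s - s₀) • l‖) :=
    (((hf s (hsub hs)).sub (hf s₀ (hsub h0))).sub tendsto_const_nhds).norm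
  exact le_of_tendsto ht hr

/-- A bounded closed form on a convex open set has a Lipschitz potential, defined everywhere. -/
theorem exists_lipschitz_potential {S : Set Par} (hS : Convex ℝ S) (ho : IsOpen S)
    {σ : Par → Par →L[ℝ] ℝ} (hσ : DifferentiableOn ℝ σ S)
    (hsymm : ∀ p ∈ S, ∀ u v, fderiv ℝ σ p u v = fderiv ℝ σ p v u)
    {M : ℝ} (hM : ∀ p ∈ S, ‖σ p‖ ≤ M) :
    ∃ (F : Par → ℝ) (K : NNReal), LipschitzWith K F ∧ ∀ p ∈ S, HasFDerivAt F (σ p) p := by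
  obtain ⟨f, hf⟩ := hS.exists_forall_hasFDerivAt_of_fderiv_symmetric ho hσ hsymm
  have hL : LipschitzOnWith M.toNNReal f S :=
    hS.lipschitzOnWith_of_nnnorm_hasFDerivWithin_le (fun p hp => (hf p hp).hasFDerivWithinAt)
      (fun p hp => by
        rw [← NNReal.coe_le_coe, coe_nnnorm]
        exact (hM p hp).trans (Real.le_coe_toNNReal M))
  -- A potential that is Lipschitz on the whole plane can later be restricted to the axis and
  -- integrated by parts without boundary terms.
  obtain ⟨F, hF, hfF⟩ := hL.extend_real
  refine ⟨F, _, hF, fun p hp => (hf p hp).congr_of_eventuallyEq ?_⟩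
  filter_upwards [ho.mem_nhds hp] with q hq using (hfF hq).symm

/-- Gluing of potentials along the axis `r = 0`, when the tangential components of the form agree
there. -/
theorem exists_glued_potential {s₀ δ : ℝ} (hδ : 0 < δ) {σ : Par → Par →L[ℝ] ℝ}
    {Fp Fm : Par → ℝ} {Kp Km : NNReal} (hLp : LipschitzWith Kp Fp) (hLm : LipschitzWith Km Fm)
    (hFp : ∀ p ∈ Ioo (s₀ - δ) (s₀ + δ) ×ˢ Ioo 0 δ, HasFDerivAt Fp (σ p) p)
    (hFm : ∀ p ∈ Ioo (s₀ - δ) (s₀ + δ) ×ˢ Ioo (-δ) 0, HasFDerivAt Fm (σ p) p)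
    (htr : ∀ s ∈ Ioo (s₀ - δ) (s₀ + δ), ∃ l : ℝ,
      Tendsto (fun p => σ p e₀) (𝓝[Ioo (s₀ - δ) (s₀ + δ) ×ˢ Ioo 0 δ] (s, 0)) (𝓝 l) ∧
      Tendsto (fun p => σ p e₀) (𝓝[Ioo (s₀ - δ) (s₀ + δ) ×ˢ Ioo (-δ) 0] (s, 0)) (𝓝 l)) :
    ∃ (F : Par → ℝ) (K : NNReal), LipschitzWith K F ∧
      ∀ p ∈ Ioo (s₀ - δ) (s₀ + δ) ×ˢ Ioo (-δ) δ, p.2 ≠ 0 → HasFDerivAt F (σ p) p := by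
  have slice : ∀ {F : Par → ℝ} {p : Par}, HasFDerivAt F (σ p) p →
      HasDerivAt (fun s => F (s, p.2)) (σ p e₀) p.1 := by
    intro F p h
    have h1 : HasDerivAt (fun s : ℝ => ((s, p.2) : Par)) e₀ p.1 :=
      (hasDerivAt_id p.1).prodMk (hasDerivAt_const p.1 p.2)
    exact HasFDerivAt.comp_hasDerivAt (f := fun s : ℝ => ((s, p.2) : Par)) p.1 h h1
  -- The traces of both potentials on the axis have the same derivative, namely the common limit of
  -- the tangential component; hence they differ by a constant.
  have trace : ∀ s ∈ Ioo (s₀ - δ) (s₀ + δ),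
      HasDerivAt (fun s => Fp (s, 0) - Fm (s, 0)) 0 s := by
    intro s hs
    obtain ⟨l, hl₁, hl₂⟩ := htr s hs
    obtain ⟨δ', hδ', hsub⟩ : ∃ δ' > 0, Ioo (s - δ') (s + δ') ⊆ Ioo (s₀ - δ) (s₀ + δ) := by
      refine ⟨min (s - (s₀ - δ)) (s₀ + δ - s), lt_min (by linarith [hs.1]) (by linarith [hs.2]),
        Ioo_subset_Ioo ?_ ?_⟩
      · linarith [min_le_left (s - (s₀ - δ)) (s₀ + δ - s)]
      · linarith [min_le_right (s - (s₀ - δ)) (s₀ + δ - s)]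
    have tend : ∀ {F : Par → ℝ} {K : NNReal} (ρ : Set ℝ) (s : ℝ), LipschitzWith K F →
        Tendsto (fun r => F (s, r)) (𝓝[ρ] 0) (𝓝 (F (s, 0))) := by
      intro F K ρ s hF
      have : Continuous fun r : ℝ => F (s, r) := hF.continuous.comp (by fun_prop)
      exact (this.tendsto 0).mono_left nhdsWithin_le_nhds
    have h1 : HasDerivAt (fun s => Fp (s, 0)) l s :=
      hasDerivAt_trace hδ' (ρ := Ioo 0 δ) (by rw [closure_Ioo hδ.ne]; exact ⟨le_rfl, hδ.le⟩)
        (fun t _ => tend _ _ hLp) (fun p hp => slice (hFp p ⟨hsub hp.1, hp.2⟩))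
        (hl₁.mono_left (nhdsWithin_mono _ (prod_mono hsub subset_rfl)))
    have h2 : HasDerivAt (fun s => Fm (s, 0)) l s :=
      hasDerivAt_trace hδ' (ρ := Ioo (-δ) 0)
        (by rw [closure_Ioo (by linarith)]; exact ⟨by linarith, le_rfl⟩)
        (fun t _ => tend _ _ hLm) (fun p hp => slice (hFm p ⟨hsub hp.1, hp.2⟩))
        (hl₂.mono_left (nhdsWithin_mono _ (prod_mono hsub subset_rfl)))
    have h3 := h1.sub h2
    rw [sub_self] at h3
    exact h3
  have hconst : ∀ s ∈ Ioo (s₀ - δ) (s₀ + δ), Fp (s, 0) - Fm (s, 0) = Fp (s₀, 0) - Fm (s₀, 0) := by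
    intro s hs
    have := (convex_Ioo (s₀ - δ) (s₀ + δ)).norm_image_sub_le_of_norm_hasDerivWithin_le
      (f' := fun _ => (0 : ℝ)) (C := 0) (fun x hx => (trace x hx).hasDerivWithinAt)
      (fun x _ => by simp) (x := s₀) (y := s) ⟨by linarith, by linarith⟩ hs
    rw [zero_mul, norm_le_zero_iff, sub_eq_zero] at this
    exact this
  have l₁ : LipschitzWith 1 fun p : Par => ((p.1, max p.2 0) : Par) := by
    have := (LipschitzWith.prod_fst (α := ℝ) (β := ℝ)).prodMk
      ((LipschitzWith.prod_snd (α := ℝ) (β := ℝ)).max_const 0)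
    simpa using this
  have l₂ : LipschitzWith 1 fun p : Par => ((p.1, min p.2 0) : Par) := by
    have := (LipschitzWith.prod_fst (α := ℝ) (β := ℝ)).prodMk
      ((LipschitzWith.prod_snd (α := ℝ) (β := ℝ)).min_const 0)
    simpa using this
  have l₃ : LipschitzWith 1 fun p : Par => ((p.1, 0) : Par) := by
    have := (LipschitzWith.prod_fst (α := ℝ) (β := ℝ)).prodMk
      (LipschitzWith.const (α := ℝ × ℝ) (0 : ℝ))
    simpa using this
  -- This is Fp above the axis, and Fm plus the constant gap of the traces below it. Written with
  -- max and min, it is visibly Lipschitz everywhere.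
  refine ⟨fun p => Fp (p.1, max p.2 0) + Fm (p.1, min p.2 0) - Fm (p.1, 0), _,
    ((hLp.comp l₁).add (hLm.comp l₂)).sub (hLm.comp l₃), fun p hp hne => ?_⟩
  rcases lt_or_gt_of_ne hne with h | h
  · have hp' := hFm p ⟨hp.1, hp.2.1, h⟩
    have : HasFDerivAt (fun q => Fm q + (Fp (s₀, 0) - Fm (s₀, 0))) (σ p) p := hp'.add_const _
    refine this.congr_of_eventuallyEq ?_
    have ho : IsOpen (Ioo (s₀ - δ) (s₀ + δ) ×ˢ Iio (0 : ℝ)) := isOpen_Ioo.prod isOpen_Iio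
    filter_upwards [ho.mem_nhds (show p ∈ _ from ⟨hp.1, h⟩)] with q hq
    have h1 : max q.2 0 = 0 := max_eq_right (le_of_lt hq.2)
    have h2 : min q.2 0 = q.2 := min_eq_left (le_of_lt hq.2)
    simp only [h1, h2]
    linarith [hconst q.1 hq.1]
  · refine (hFp p ⟨hp.1, h, hp.2.2⟩).congr_of_eventuallyEq ?_
    have ho : IsOpen {q : Par | 0 < q.2} := isOpen_lt continuous_const continuous_snd
    filter_upwards [ho.mem_nhds h] with q hq
    have h1 : max q.2 0 = q.2 := max_eq_left (le_of_lt hq)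
    have h2 : min q.2 0 = 0 := min_eq_right (le_of_lt hq)
    simp only [h1, h2]
    ring

/-- Transport of a potential by a local diffeomorphism `Φ` with local inverse `Ψ`. -/
theorem exists_potential_of_chart {Φ Ψ : Par → Par} {q₀ : Par} {η : Par → Par →L[ℝ] ℝ}
    (hΨ : ContDiffAt ℝ 1 Ψ q₀) (hΦΨ : ∀ᶠ q in 𝓝 q₀, Φ (Ψ q) = q)
    (hΦ : ∀ᶠ p in 𝓝 (Ψ q₀), DifferentiableAt ℝ Φ p)
    {F : Par → ℝ} {K : NNReal} (hF : LipschitzWith K F)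
    (hd : ∀ᶠ p in 𝓝 (Ψ q₀), p.2 ≠ 0 → HasFDerivAt F ((η (Φ p)).comp (fderiv ℝ Φ p)) p) :
    ∃ (f : Par → ℝ) (K' : NNReal), LipschitzWith K' f ∧
      ∀ᶠ q in 𝓝 q₀, (Ψ q).2 ≠ 0 → HasFDerivAt f (η q) q := by
  obtain ⟨K₁, t, ht, hL⟩ := hΨ.exists_lipschitzOnWith
  obtain ⟨f, hf, hFf⟩ := (hF.comp_lipschitzOnWith hL).extend_real
  refine ⟨f, _, hf, ?_⟩
  have hΨd : ∀ᶠ q in 𝓝 q₀, DifferentiableAt ℝ Ψ q := by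
    filter_upwards [hΨ.eventually (by simp)] with q hq using hq.differentiableAt (by simp)
  have hc := hΨ.continuousAt
  filter_upwards [hΨd, hc.eventually hΦ, hc.eventually hd, hΦΨ, hΦΨ.eventually_nhds,
    eventually_mem_nhds_iff.2 ht] with q h1 h2 h3 h4 h5 h6 hne
  -- The derivative of Ψ is a right inverse of that of Φ, so composing the potential with Ψ undoes
  -- the pull-back of η by Φ.
  have h7 : (fderiv ℝ Φ (Ψ q)).comp (fderiv ℝ Ψ q) = ContinuousLinearMap.id ℝ Par := by
    have hcomp : HasFDerivAt (Φ ∘ Ψ) ((fderiv ℝ Φ (Ψ q)).comp (fderiv ℝ Ψ q)) q :=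
      h2.hasFDerivAt.comp q h1.hasFDerivAt
    exact hcomp.unique ((hasFDerivAt_id q).congr_of_eventuallyEq h5)
  have h8 : HasFDerivAt (F ∘ Ψ) (η q) q := by
    have := (h3 hne).comp q h1.hasFDerivAt
    rw [ContinuousLinearMap.comp_assoc, h7, h4] at this
    simpa using this
  refine h8.congr_of_eventuallyEq ?_
  filter_upwards [h6] with x hx using (hFf hx).symm

/-- The pull-back of a closed form is closed. -/
theorem pullback_closed {η : Par → Par →L[ℝ] ℝ} {Φ : Par → Par} {p : Par}
    (hη : DifferentiableAt ℝ η (Φ p))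
    (hsymm : ∀ u v, fderiv ℝ η (Φ p) u v = fderiv ℝ η (Φ p) v u) (hΦ : ContDiffAt ℝ 2 Φ p) :
    DifferentiableAt ℝ (fun p => (η (Φ p)).comp (fderiv ℝ Φ p)) p ∧
    ∀ u v, fderiv ℝ (fun p => (η (Φ p)).comp (fderiv ℝ Φ p)) p u v
      = fderiv ℝ (fun p => (η (Φ p)).comp (fderiv ℝ Φ p)) p v u := by
  have h1 : HasFDerivAt Φ (fderiv ℝ Φ p) p := (hΦ.differentiableAt (by simp)).hasFDerivAt
  have h2 : DifferentiableAt ℝ (fderiv ℝ Φ) p :=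
    (hΦ.fderiv_right (m := 1) (by norm_num)).differentiableAt (by simp)
  have h3 : HasFDerivAt (fun p => η (Φ p)) ((fderiv ℝ η (Φ p)).comp (fderiv ℝ Φ p)) p :=
    hη.hasFDerivAt.comp p h1
  have h4 := h3.clm_comp h2.hasFDerivAt
  refine ⟨h4.differentiableAt, fun u v => ?_⟩
  rw [h4.fderiv]
  have hs : fderiv ℝ (fderiv ℝ Φ) p u v = fderiv ℝ (fderiv ℝ Φ) p v u :=
    (hΦ.isSymmSndFDerivAt (by simp)) u v
  simp [hs, hsymm (fderiv ℝ Φ p u)]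


/-! ### Measure and topology of crease patterns -/

namespace CreasePattern

variable (P : CreasePattern univ)

/-- The union of the arcs. -/
def creases : Set Par := ⋃ k, P.arc k '' Icc 0 1

/-- The end points of the arcs. -/
def vertices : Set Par := ⋃ k, P.arc k '' {0, 1}

theorem isCompact_arc (k : P.κ) : IsCompact (P.arc k '' Icc 0 1) :=
  isCompact_Icc.image_of_continuousOn (P.arc_smooth k).continuousOn

theorem countable_arcs : Countable P.κ := by
  have := P.locallyFinite_arc.countable_univ fun k => (nonempty_Icc.2 zero_le_one).image (P.arc k)
  exact countable_univ_iff.1 this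

/-- Each arc is a smooth image of an interval, of Hausdorff dimension at most 1 < 2, and a locally
finite family of arcs is countable. -/
theorem volume_creases : MeasureTheory.volume P.creases = 0 := by
  have := P.countable_arcs
  refine MeasureTheory.measure_iUnion_null fun k => ?_
  have h1 : dimH (P.arc k '' Icc 0 1) ≤ 1 := by
    refine (((P.arc_smooth k).of_le (by exact_mod_cast le_top)).dimH_image_le (convex_Icc 0 1)
      subset_rfl).trans ?_
    exact (dimH_mono (subset_univ _)).trans Real.dimH_univ.le
  rw [← MeasureTheory.hausdorffMeasure_prod_real]
  have h2 : dimH (P.arc k '' Icc 0 1) < ((2 : NNReal) : ENNReal) := h1.trans_lt (by norm_num)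
  simpa using hausdorffMeasure_of_dimH_lt h2

theorem mem_closure_piece (q : Par) : ∃ i, q ∈ closure (P.piece i) := by
  simpa using P.cover (show q ∈ closure univ by simp)

theorem exists_mem_piece {q : Par} (hq : q ∉ P.creases) : ∃ i, q ∈ P.piece i := by
  obtain ⟨i, hi⟩ := P.mem_closure_piece q
  refine ⟨i, by_contra fun h => hq (P.frontier_subset i ⟨?_, mem_univ _⟩)⟩
  rw [(P.isOpen_piece i).frontier_eq]
  exact ⟨hi, h⟩

/-- Away from the creases, S never meets the frontier of a piece; a piece and the exterior of its
closure would then disconnect S if it met both. -/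
theorem exists_subset_piece {S : Set Par} (hS : IsPreconnected S) (hne : S.Nonempty)
    (hd : ∀ q ∈ S, q ∉ P.creases) : ∃ i, S ⊆ P.piece i := by
  obtain ⟨q, hq⟩ := hne
  obtain ⟨i, hi⟩ := P.exists_mem_piece (hd q hq)
  refine ⟨i, fun q' hq' => by_contra fun h => ?_⟩
  have hf : ∀ x ∈ S, x ∈ closure (P.piece i) → x ∈ P.piece i := fun x hx hxc =>
    by_contra fun hxi => hd x hx (P.frontier_subset i
      ⟨by rw [(P.isOpen_piece i).frontier_eq]; exact ⟨hxc, hxi⟩, mem_univ _⟩)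
  obtain ⟨x, -, hx, hx'⟩ := hS (P.piece i) (closure (P.piece i))ᶜ (P.isOpen_piece i)
    isClosed_closure.isOpen_compl (fun x hx => or_iff_not_imp_right.2 fun hxc =>
      hf x hx (not_not.1 hxc)) ⟨q, hq, hi⟩ ⟨q', hq', fun hc => h (hf q' hq' hc)⟩
  exact hx' (subset_closure hx)

theorem ae_mem_piece : ∀ᵐ q : Par, ∃ i, q ∈ P.piece i := by
  have : ∀ᵐ q : Par, q ∉ P.creases := MeasureTheory.measure_eq_zero_iff_ae_notMem.1 P.volume_creases
  filter_upwards [this] with q hq using P.exists_mem_piece hq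

theorem finite_vertices_inter {K : Set Par} (hK : IsCompact K) : (P.vertices ∩ K).Finite := by
  have h := P.locallyFinite_arc.finite_nonempty_inter_compact hK
  refine (h.biUnion (t := fun k => P.arc k '' {0, 1}) fun k _ => (toFinite _)).subset ?_
  rintro q ⟨hq, hqK⟩
  obtain ⟨k, hk⟩ := mem_iUnion.1 hq
  refine mem_biUnion (x := k) ⟨q, image_mono ?_ hk, hqK⟩ hk
  rintro s (rfl | rfl) <;> simp

/-- A locally finite family of functions that are continuous on the closed pieces is locally
bounded on the pieces. -/
theorem eventually_norm_le {F : Type*} [NormedAddCommGroup F] {E : P.ι → Par → F}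
    (hE : ∀ i, ContinuousOn (E i) (closure (P.piece i))) (q₀ : Par) :
    ∃ M : ℝ, ∀ᶠ q in 𝓝 q₀, ∀ i, q ∈ P.piece i → ‖E i q‖ ≤ M := by
  obtain ⟨t, ht, hfin⟩ := P.locallyFinite_piece q₀
  have h : ∀ i, ∃ M : ℝ, ∀ᶠ q in 𝓝 q₀, q ∈ P.piece i → ‖E i q‖ ≤ M := by
    intro i
    by_cases hi : q₀ ∈ closure (P.piece i)
    · refine ⟨‖E i q₀‖ + 1, ?_⟩
      have h1 : ∀ᶠ q in 𝓝[closure (P.piece i)] q₀, ‖E i q‖ < ‖E i q₀‖ + 1 :=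
        (hE i q₀ hi).norm.eventually (gt_mem_nhds (lt_add_one _))
      filter_upwards [eventually_nhdsWithin_iff.1 h1] with q hq hqi
      exact (hq (subset_closure hqi)).le
    · refine ⟨0, ?_⟩
      filter_upwards [isClosed_closure.isOpen_compl.mem_nhds hi] with q hq hqi
      exact absurd (subset_closure hqi) hq
  choose M hM using h
  refine ⟨∑ i ∈ hfin.toFinset, |M i|, ?_⟩
  have h2 : ∀ᶠ q in 𝓝 q₀, ∀ i ∈ hfin.toFinset, q ∈ P.piece i → ‖E i q‖ ≤ M i :=
    (Finset.eventually_all _).2 fun i _ => hM i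
  filter_upwards [h2, ht] with q hq hqt i hqi
  have hmem : i ∈ hfin.toFinset := by
    rw [Finite.mem_toFinset]; exact ⟨q, hqi, hqt⟩
  exact (hq i hmem hqi).trans ((le_abs_self _).trans
    (Finset.single_le_sum (f := fun i => |M i|) (fun _ _ => abs_nonneg _) hmem))

end CreasePattern

/-! ### Charts that straighten a crease -/

/-- A chart `Φ` that straightens a crease between the pieces `i` and `j`: the crease is the axis
`r = 0` of the coordinates `(s, r)`. -/
structure IsCreaseChart (P : CreasePattern univ) (i j : P.ι) (s₀ δ : ℝ) (Φ : Par → Par) :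
    Prop where
  pos : 0 < δ
  contDiffAt : ∀ p ∈ Ioo (s₀ - δ) (s₀ + δ) ×ˢ Ioo (-δ) δ, ContDiffAt ℝ ∞ Φ p
  upper : ∀ p ∈ Ioo (s₀ - δ) (s₀ + δ) ×ˢ Ioo 0 δ, Φ p ∈ P.piece i
  lower : ∀ p ∈ Ioo (s₀ - δ) (s₀ + δ) ×ˢ Ioo (-δ) 0, Φ p ∈ P.piece j
  tangent_ne_zero : ∀ s ∈ Ioo (s₀ - δ) (s₀ + δ), fderiv ℝ Φ (s, 0) e₀ ≠ 0

/-- Thicken the arc along a constant vector ν, the tangent at s₀ turned by a right angle. The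
derivative at (s₀, 0) has columns τ and ν, with determinant |τ|² ≠ 0, and the inverse function
theorem applies. -/
theorem exists_chart_of_arc {γ : ℝ → Par} {s₀ : ℝ} (hs₀ : s₀ ∈ Ioo (0 : ℝ) 1)
    (hγ : ContDiffOn ℝ ∞ γ (Icc 0 1)) (hγ' : derivWithin γ (Icc 0 1) s₀ ≠ 0) :
    ∃ ν : Par, ∃ Φ : OpenPartialHomeomorph Par Par, (∀ p, Φ p = γ p.1 + p.2 • ν) ∧
      (s₀, (0 : ℝ)) ∈ Φ.source ∧ ContDiffAt ℝ ∞ Φ.symm (γ s₀) := by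
  have hca : ContDiffAt ℝ ∞ γ s₀ := hγ.contDiffAt (Icc_mem_nhds hs₀.1 hs₀.2)
  have hd : derivWithin γ (Icc 0 1) s₀ = deriv γ s₀ :=
    derivWithin_of_mem_nhds (Icc_mem_nhds hs₀.1 hs₀.2)
  rw [hd] at hγ'
  set τ := deriv γ s₀ with hτ
  have hγd : HasDerivAt γ τ s₀ := (hca.differentiableAt (by simp)).hasDerivAt
  let ν : Par := (-τ.2, τ.1)
  let L : Par →L[ℝ] Par := (ContinuousLinearMap.fst ℝ ℝ ℝ).smulRight τ
    + (ContinuousLinearMap.snd ℝ ℝ ℝ).smulRight ν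
  have hpos : 0 < τ.1 ^ 2 + τ.2 ^ 2 := by
    rcases eq_or_ne τ.1 0 with h1 | h1
    · have h2 : τ.2 ≠ 0 := fun h2 => hγ' (Prod.ext h1 h2)
      positivity
    · positivity
  have hinj : Function.Injective L := by
    rw [injective_iff_map_eq_zero]
    intro v hv
    have h1 : v.1 * τ.1 + v.2 * -τ.2 = 0 := congrArg Prod.fst hv
    have h2 : v.1 * τ.2 + v.2 * τ.1 = 0 := congrArg Prod.snd hv
    have h3 : v.1 * (τ.1 ^ 2 + τ.2 ^ 2) = 0 := by linear_combination τ.1 * h1 + τ.2 * h2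
    have h4 : v.2 * (τ.1 ^ 2 + τ.2 ^ 2) = 0 := by linear_combination τ.1 * h2 - τ.2 * h1
    exact Prod.ext ((mul_eq_zero.1 h3).resolve_right hpos.ne')
      ((mul_eq_zero.1 h4).resolve_right hpos.ne')
  let Le : Par ≃L[ℝ] Par :=
    (LinearEquiv.ofInjectiveEndo (L : Par →ₗ[ℝ] Par) hinj).toContinuousLinearEquiv
  have hLe : (Le : Par →L[ℝ] Par) = L := by ext <;> rfl
  have hΦ : ContDiffAt ℝ ∞ (fun p : Par => γ p.1 + p.2 • ν) (s₀, 0) := by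
    have h1 : ContDiffAt ℝ ∞ (fun p : Par => γ p.1) (s₀, 0) :=
      ContDiffAt.comp (s₀, (0 : ℝ)) (g := γ) (f := Prod.fst) hca contDiffAt_fst
    exact h1.add (contDiffAt_snd.smul contDiffAt_const)
  have hΦ' : HasFDerivAt (fun p : Par => γ p.1 + p.2 • ν) (Le : Par →L[ℝ] Par) (s₀, 0) := by
    rw [hLe]
    have h1 : HasFDerivAt (fun p : Par => γ p.1) ((ContinuousLinearMap.fst ℝ ℝ ℝ).smulRight τ)
        (s₀, 0) := by
      have := HasFDerivAt.comp (s₀, (0 : ℝ)) (g := γ) (f := Prod.fst) hγd.hasFDerivAt hasFDerivAt_fst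
      exact this.congr_fderiv (by ext <;> simp)
    have h2 : HasFDerivAt (fun p : Par => p.2 • ν) ((ContinuousLinearMap.snd ℝ ℝ ℝ).smulRight ν)
        (s₀, 0) := hasFDerivAt_snd.smul_const ν
    exact h1.add h2
  refine ⟨ν, hΦ.toOpenPartialHomeomorph _ hΦ' (by simp), fun p => rfl,
    hΦ.mem_toOpenPartialHomeomorph_source hΦ' (by simp), ?_⟩
  have := hΦ.to_localInverse hΦ' (by simp)
  simp only [zero_smul, add_zero] at this
  exact this

/-- Near a crease point that is not a vertex, the only crease is a short portion of a single arc: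
the other arcs form a closed set that misses the point, and so does the remote part of the same arc,
by compactness and injectivity. Each open half of a small box therefore avoids the creases and,
being connected, is sent into one piece. Both halves may be sent into the same piece. -/
theorem exists_isCreaseChart (P : CreasePattern univ) {q₀ : Par} (hq₀ : q₀ ∈ P.creases)
    (hv : q₀ ∉ P.vertices) {N : Set Par} (hN : N ∈ 𝓝 q₀) :
    ∃ (i j : P.ι) (s₀ δ : ℝ) (Φ Ψ : Par → Par), IsCreaseChart P i j s₀ δ Φ ∧ Ψ q₀ = (s₀, 0) ∧
      ContDiffAt ℝ ∞ Ψ q₀ ∧ (∀ᶠ q in 𝓝 q₀, Φ (Ψ q) = q) ∧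
      (∀ p ∈ Ioo (s₀ - δ) (s₀ + δ) ×ˢ Ioo (-δ) δ, Φ p ∈ N) ∧
      ∀ s ∈ Ioo (s₀ - δ) (s₀ + δ), Φ (s, 0) ∈ P.creases := by
  obtain ⟨k, s₀, hs₀', rfl⟩ := mem_iUnion.1 hq₀
  have hs₀ : s₀ ∈ Ioo (0 : ℝ) 1 := by
    refine ⟨lt_of_le_of_ne hs₀'.1 ?_, lt_of_le_of_ne hs₀'.2 ?_⟩
    · rintro rfl; exact hv (mem_iUnion.2 ⟨k, 0, by simp, rfl⟩)
    · rintro rfl; exact hv (mem_iUnion.2 ⟨k, 1, by simp, rfl⟩)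
  obtain ⟨ν, Φ, hΦ, hsrc, hsymm⟩ := exists_chart_of_arc hs₀ (P.arc_smooth k) (P.arc_regular k s₀ hs₀')
  have hq : Φ (s₀, 0) = P.arc k s₀ := by simp [hΦ]
  -- the other arcs
  have h1 : ∀ᶠ q in 𝓝 (P.arc k s₀), ∀ l, l ≠ k → q ∉ P.arc l '' Icc 0 1 := by
    have hcl : IsClosed (⋃ l : {l // l ≠ k}, P.arc l '' Icc 0 1) :=
      (P.locallyFinite_arc.comp_injective Subtype.val_injective).isClosed_iUnion
        fun l => (P.isCompact_arc l).isClosed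
    have hn : P.arc k s₀ ∉ ⋃ l : {l // l ≠ k}, P.arc l '' Icc 0 1 := by
      intro h
      obtain ⟨⟨l, hl⟩, hl'⟩ := mem_iUnion.1 h
      exact hv (mem_iUnion.2 ⟨k, (P.arc_meet k l hl.symm ⟨⟨s₀, hs₀', rfl⟩, hl'⟩).1⟩)
    filter_upwards [hcl.isOpen_compl.mem_nhds hn] with q hq l hl hql
    exact hq (mem_iUnion.2 ⟨⟨l, hl⟩, hql⟩)
  -- a box inside the source
  have hsrcn : Φ.source ∈ 𝓝 (s₀, (0 : ℝ)) := Φ.open_source.mem_nhds hsrc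
  obtain ⟨δ₁, hδ₁, hball⟩ := Metric.mem_nhds_iff.1 hsrcn
  have hbox : ∀ {d : ℝ} {p : Par}, p ∈ Ioo (s₀ - d) (s₀ + d) ×ˢ Ioo (-d) d ↔
      p ∈ Metric.ball (s₀, (0 : ℝ)) d := by
    intro d p
    rw [Metric.mem_ball, Prod.dist_eq, max_lt_iff, Real.dist_eq, Real.dist_eq, abs_lt, abs_lt]
    simp only [mem_prod, mem_Ioo]
    constructor
    · rintro ⟨⟨_, _⟩, _, _⟩; refine ⟨⟨?_, ?_⟩, ?_, ?_⟩ <;> linarith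
    · rintro ⟨⟨_, _⟩, _, _⟩; refine ⟨⟨?_, ?_⟩, ?_, ?_⟩ <;> linarith
  -- the rest of the same arc
  have h2 : ∀ᶠ q in 𝓝 (P.arc k s₀), q ∉ P.arc k '' (Icc 0 1 \ Ioo (s₀ - δ₁) (s₀ + δ₁)) := by
    have hc : IsCompact (P.arc k '' (Icc 0 1 \ Ioo (s₀ - δ₁) (s₀ + δ₁))) :=
      (isCompact_Icc.diff isOpen_Ioo).image_of_continuousOn
        ((P.arc_smooth k).continuousOn.mono sdiff_subset)
    refine hc.isClosed.isOpen_compl.mem_nhds ?_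
    rintro ⟨s, hs, hss⟩
    have := P.arc_injOn k hs.1 hs₀' hss
    subst this
    exact hs.2 ⟨by linarith, by linarith⟩
  have hcont : ContinuousAt Φ (s₀, 0) := Φ.continuousAt hsrc
  have h3 : ∀ᶠ p in 𝓝 (s₀, (0 : ℝ)), Φ p ∈ N ∧ (∀ l, l ≠ k → Φ p ∉ P.arc l '' Icc 0 1) ∧
      Φ p ∉ P.arc k '' (Icc 0 1 \ Ioo (s₀ - δ₁) (s₀ + δ₁)) ∧ p.1 ∈ Ioo (0 : ℝ) 1 := by
    have hc' : Tendsto Φ (𝓝 (s₀, (0 : ℝ))) (𝓝 (P.arc k s₀)) := by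
      have := hcont.tendsto; rwa [hq] at this
    have h4 : ∀ᶠ p : Par in 𝓝 (s₀, (0 : ℝ)), p.1 ∈ Ioo (0 : ℝ) 1 :=
      continuousAt_fst.eventually (isOpen_Ioo.mem_nhds hs₀)
    filter_upwards [hc'.eventually hN, hc'.eventually h1, hc'.eventually h2, h4] with p a b c d
      using ⟨a, b, c, d⟩
  obtain ⟨δ₂, hδ₂, hball₂⟩ := Metric.eventually_nhds_iff_ball.1 h3
  set δ := min δ₁ δ₂ with hδdef
  have hδ : 0 < δ := lt_min hδ₁ hδ₂
  have hb1 : ∀ p ∈ Ioo (s₀ - δ) (s₀ + δ) ×ˢ Ioo (-δ) δ, p ∈ Metric.ball (s₀, (0 : ℝ)) δ₁ :=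
    fun p hp => Metric.ball_subset_ball (min_le_left _ _) (hbox.1 hp)
  have hb2 : ∀ p ∈ Ioo (s₀ - δ) (s₀ + δ) ×ˢ Ioo (-δ) δ, p ∈ Metric.ball (s₀, (0 : ℝ)) δ₂ :=
    fun p hp => Metric.ball_subset_ball (min_le_right _ _) (hbox.1 hp)
  have hzero : ∀ s ∈ Ioo (s₀ - δ) (s₀ + δ), ((s, 0) : Par) ∈ Ioo (s₀ - δ) (s₀ + δ) ×ˢ Ioo (-δ) δ :=
    fun s hs => ⟨hs, by simpa using hδ, hδ⟩
  -- A point off the axis whose image is on the arc would share this image with a point (s, 0) of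
  -- the source, against the injectivity of the chart.
  have hoff : ∀ p ∈ Ioo (s₀ - δ) (s₀ + δ) ×ˢ Ioo (-δ) δ, p.2 ≠ 0 → Φ p ∉ P.creases := by
    intro p hp hp2 hmem
    obtain ⟨l, hl⟩ := mem_iUnion.1 hmem
    obtain ⟨_, hother, hsame, _⟩ := hball₂ p (hb2 p hp)
    rcases eq_or_ne l k with rfl | hlk
    · obtain ⟨s, hs, hsΦ⟩ := hl
      have hsI : s ∈ Ioo (s₀ - δ₁) (s₀ + δ₁) := by
        by_contra h
        exact hsame ⟨s, ⟨hs, h⟩, hsΦ⟩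
      have h5 : ((s, 0) : Par) ∈ Φ.source := by
        apply hball
        rw [← hbox]
        exact ⟨hsI, by simpa using hδ₁, hδ₁⟩
      have h6 : Φ (s, 0) = Φ p := by simp [hΦ (s, 0), hsΦ]
      have := Φ.injOn h5 (hball (hb1 p hp)) h6
      exact hp2 (by rw [← this])
    · exact hother l hlk hl
  have hcd : ∀ p ∈ Ioo (s₀ - δ) (s₀ + δ) ×ˢ Ioo (-δ) δ, ContDiffAt ℝ ∞ Φ p := by
    intro p hp
    have hp1 := (hball₂ p (hb2 p hp)).2.2.2
    have hca : ContDiffAt ℝ ∞ (P.arc k) p.1 :=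
      (P.arc_smooth k).contDiffAt (Icc_mem_nhds hp1.1 hp1.2)
    have h1 : ContDiffAt ℝ ∞ (fun p : Par => P.arc k p.1) p :=
      ContDiffAt.comp p (g := P.arc k) (f := Prod.fst) hca contDiffAt_fst
    have h2 : ContDiffAt ℝ ∞ (fun p : Par => P.arc k p.1 + p.2 • ν) p :=
      h1.add (contDiffAt_snd.smul contDiffAt_const)
    exact h2.congr_of_eventuallyEq (Eventually.of_forall hΦ)
  have hup : Ioo (s₀ - δ) (s₀ + δ) ×ˢ Ioo 0 δ ⊆ Ioo (s₀ - δ) (s₀ + δ) ×ˢ Ioo (-δ) δ :=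
    prod_mono subset_rfl (Ioo_subset_Ioo (by linarith) le_rfl)
  have hlow : Ioo (s₀ - δ) (s₀ + δ) ×ˢ Ioo (-δ) 0 ⊆ Ioo (s₀ - δ) (s₀ + δ) ×ˢ Ioo (-δ) δ :=
    prod_mono subset_rfl (Ioo_subset_Ioo le_rfl hδ.le)
  have hside : ∀ S ⊆ Ioo (s₀ - δ) (s₀ + δ) ×ˢ Ioo (-δ) δ, Convex ℝ S → S.Nonempty →
      (∀ p ∈ S, p.2 ≠ 0) → ∃ i, ∀ p ∈ S, Φ p ∈ P.piece i := by
    intro S hS hconv hne h0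
    obtain ⟨i, hi⟩ := P.exists_subset_piece (S := Φ '' S)
      (hconv.isPreconnected.image _ fun p hp => (hcd p (hS hp)).continuousAt.continuousWithinAt)
      (hne.image _) (by rintro _ ⟨p, hp, rfl⟩; exact hoff p (hS hp) (h0 p hp))
    exact ⟨i, fun p hp => hi ⟨p, hp, rfl⟩⟩
  have hs₀I : s₀ ∈ Ioo (s₀ - δ) (s₀ + δ) := ⟨by linarith, by linarith⟩
  obtain ⟨i, hi⟩ := hside _ hup ((convex_Ioo _ _).prod (convex_Ioo _ _))
    ⟨(s₀, δ / 2), hs₀I, by simp only; linarith, by simp only; linarith⟩ (fun p hp => hp.2.1.ne')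
  obtain ⟨j, hj⟩ := hside _ hlow ((convex_Ioo _ _).prod (convex_Ioo _ _))
    ⟨(s₀, -(δ / 2)), hs₀I, by simp only; linarith, by simp only; linarith⟩ (fun p hp => hp.2.2.ne)
  refine ⟨i, j, s₀, δ, Φ, Φ.symm, ⟨hδ, hcd, hi, hj, fun s hs => ?_⟩, ?_, hsymm, ?_,
    fun p hp => (hball₂ p (hb2 p hp)).1, fun s hs => ?_⟩
  · have hp1 := (hball₂ _ (hb2 _ (hzero s hs))).2.2.2
    have hs1 : s ∈ Icc (0 : ℝ) 1 := Ioo_subset_Icc_self hp1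
    have hdΦ : HasFDerivAt Φ (fderiv ℝ Φ (s, 0)) (s, 0) :=
      ((hcd _ (hzero s hs)).differentiableAt (by simp)).hasFDerivAt
    have h7 : HasDerivAt (fun t : ℝ => Φ (t, 0)) (fderiv ℝ Φ (s, 0) e₀) s := by
      have h8 : HasDerivAt (fun t : ℝ => ((t, 0) : Par)) e₀ s :=
        (hasDerivAt_id s).prodMk (hasDerivAt_const s 0)
      exact HasFDerivAt.comp_hasDerivAt (f := fun t : ℝ => ((t, 0) : Par)) s hdΦ h8
    have h9 : (fun t : ℝ => Φ (t, 0)) = P.arc k := by ext1 t; simp [hΦ]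
    rw [h9] at h7
    have h10 := P.arc_regular k s hs1
    rw [derivWithin_of_mem_nhds (Icc_mem_nhds hp1.1 hp1.2), h7.deriv] at h10
    exact h10
  · rw [← hq, Φ.left_inv hsrc]
  · have : P.arc k s₀ ∈ Φ.target := by rw [← hq]; exact Φ.map_source hsrc
    filter_upwards [Φ.open_target.mem_nhds this] with q hq using Φ.right_inv hq
  · have hp1 := (hball₂ _ (hb2 _ (hzero s hs))).2.2.2
    exact mem_iUnion.2 ⟨k, s, Ioo_subset_Icc_self hp1, by simp [hΦ]⟩

/-! ### Tangential derivatives along a crease, from either side -/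

section Trace

variable {P : CreasePattern univ} {i j : P.ι} {s₀ δ : ℝ} {Φ : Par → Par}

theorem IsCreaseChart.zero_mem (h : IsCreaseChart P i j s₀ δ Φ) {s : ℝ}
    (hs : s ∈ Ioo (s₀ - δ) (s₀ + δ)) : ((s, 0) : Par) ∈ Ioo (s₀ - δ) (s₀ + δ) ×ˢ Ioo (-δ) δ :=
  ⟨hs, by simpa using h.pos, h.pos⟩

theorem tendsto_chart_side {ρ : Set ℝ} (h : IsCreaseChart P i j s₀ δ Φ) {l : P.ι}
    (hρ : (0 : ℝ) ∈ closure ρ) (hl : ∀ p ∈ Ioo (s₀ - δ) (s₀ + δ) ×ˢ ρ, Φ p ∈ P.piece l)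
    {s : ℝ} (hs : s ∈ Ioo (s₀ - δ) (s₀ + δ)) :
    Φ (s, 0) ∈ closure (P.piece l) ∧ Tendsto Φ (𝓝[Ioo (s₀ - δ) (s₀ + δ) ×ˢ ρ] (s, 0))
      (𝓝[closure (P.piece l)] (Φ (s, 0))) := by
  have hc : Tendsto Φ (𝓝[Ioo (s₀ - δ) (s₀ + δ) ×ˢ ρ] (s, 0)) (𝓝 (Φ (s, 0))) :=
    (h.contDiffAt _ (h.zero_mem hs)).continuousAt.tendsto.mono_left nhdsWithin_le_nhds
  have hne : (𝓝[Ioo (s₀ - δ) (s₀ + δ) ×ˢ ρ] ((s, 0) : Par)).NeBot := by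
    rw [← mem_closure_iff_nhdsWithin_neBot, closure_prod_eq]
    exact ⟨subset_closure hs, hρ⟩
  have hev : ∀ᶠ p in 𝓝[Ioo (s₀ - δ) (s₀ + δ) ×ˢ ρ] ((s, 0) : Par), Φ p ∈ P.piece l := by
    filter_upwards [self_mem_nhdsWithin] with p hp using hl p hp
  refine ⟨mem_closure_of_tendsto hc hev, tendsto_nhdsWithin_iff.2 ⟨hc, ?_⟩⟩
  filter_upwards [hev] with p hp using subset_closure hp

theorem zero_mem_closure_upper (hδ : 0 < δ) : (0 : ℝ) ∈ closure (Ioo 0 δ) := by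
  rw [closure_Ioo hδ.ne]; exact ⟨le_rfl, hδ.le⟩

theorem zero_mem_closure_lower (hδ : 0 < δ) : (0 : ℝ) ∈ closure (Ioo (-δ) 0) := by
  rw [closure_Ioo (by linarith)]; exact ⟨by linarith, le_rfl⟩

/-- A continuous function that is continuously differentiable on the closed pieces. -/
structure PwC1 (P : CreasePattern univ) {F : Type*} [NormedAddCommGroup F] [NormedSpace ℝ F]
    (f : Par → F) (D : P.ι → Par → Par →L[ℝ] F) : Prop where
  continuous : Continuous f
  hasFDerivAt : ∀ i, ∀ q ∈ P.piece i, HasFDerivAt f (D i q) q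
  continuousOn : ∀ i, ContinuousOn (D i) (closure (P.piece i))

variable {F : Type*} [NormedAddCommGroup F] [NormedSpace ℝ F]
  {f : Par → F} {D : P.ι → Par → Par →L[ℝ] F}

/-- Apply `hasDerivAt_trace` to f ∘ Φ from one side of the axis. The function differentiated on the
axis is the same from both sides because f is continuous, so the two one-sided derivatives must
agree along the crease. -/
theorem PwC1.hasDerivAt_side (hf : PwC1 P f D) {ρ : Set ℝ} (h : IsCreaseChart P i j s₀ δ Φ)
    {l : P.ι} (hρ : (0 : ℝ) ∈ closure ρ) (hρ' : ρ ⊆ Ioo (-δ) δ)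
    (hl : ∀ p ∈ Ioo (s₀ - δ) (s₀ + δ) ×ˢ ρ, Φ p ∈ P.piece l)
    {s : ℝ} (hs : s ∈ Ioo (s₀ - δ) (s₀ + δ)) :
    HasDerivAt (fun t => f (Φ (t, 0))) (D l (Φ (s, 0)) (fderiv ℝ Φ (s, 0) e₀)) s := by
  obtain ⟨δ', hδ', hsub⟩ : ∃ δ' > 0, Ioo (s - δ') (s + δ') ⊆ Ioo (s₀ - δ) (s₀ + δ) := by
    refine ⟨min (s - (s₀ - δ)) (s₀ + δ - s), lt_min (by linarith [hs.1]) (by linarith [hs.2]),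
      Ioo_subset_Ioo ?_ ?_⟩
    · linarith [min_le_left (s - (s₀ - δ)) (s₀ + δ - s)]
    · linarith [min_le_right (s - (s₀ - δ)) (s₀ + δ - s)]
  obtain ⟨hmem, htend⟩ := tendsto_chart_side h hρ hl hs
  refine hasDerivAt_trace (f := fun p => f (Φ p)) (g := fun p => D l (Φ p) (fderiv ℝ Φ p e₀))
    hδ' hρ (fun t ht => ?_) (fun p hp => ?_) ?_
  · have h1 : ContinuousAt (fun r : ℝ => f (Φ (t, r))) 0 := by
      refine hf.continuous.continuousAt.comp ?_
      exact ContinuousAt.comp (g := Φ) (f := fun r : ℝ => ((t, r) : Par))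
        (h.contDiffAt _ (h.zero_mem (hsub ht))).continuousAt (by fun_prop)
    exact h1.tendsto.mono_left nhdsWithin_le_nhds
  · have h1 : HasFDerivAt Φ (fderiv ℝ Φ p) p :=
      ((h.contDiffAt p ⟨hsub hp.1, hρ' hp.2⟩).differentiableAt (by simp)).hasFDerivAt
    have h2 := (hf.hasFDerivAt l _ (hl p ⟨hsub hp.1, hp.2⟩)).comp p h1
    have h3 : HasDerivAt (fun t : ℝ => ((t, p.2) : Par)) e₀ p.1 :=
      (hasDerivAt_id p.1).prodMk (hasDerivAt_const p.1 p.2)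
    exact HasFDerivAt.comp_hasDerivAt (f := fun t : ℝ => ((t, p.2) : Par)) p.1 h2 h3
  · have h1 : Tendsto (fun p => D l (Φ p)) (𝓝[Ioo (s - δ') (s + δ') ×ˢ ρ] (s, 0))
        (𝓝 (D l (Φ (s, 0)))) :=
      ((hf.continuousOn l _ hmem).tendsto.comp htend).mono_left
        (nhdsWithin_mono _ (prod_mono hsub subset_rfl))
    have h2 : ContinuousAt (fun p => fderiv ℝ Φ p e₀) ((s, 0) : Par) :=
      (((h.contDiffAt _ (h.zero_mem hs)).fderiv_right (m := 0) (by simp)).continuousAt).clm_apply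
        continuousAt_const
    exact (isBoundedBilinearMap_apply.continuous.tendsto (D l (Φ (s, 0)), fderiv ℝ Φ (s, 0) e₀)).comp
      (h1.prodMk_nhds (h2.tendsto.mono_left nhdsWithin_le_nhds))

/-- The tangential derivative is the same from both sides of a crease. -/
theorem PwC1.tangential_eq (hf : PwC1 P f D) (h : IsCreaseChart P i j s₀ δ Φ)
    {s : ℝ} (hs : s ∈ Ioo (s₀ - δ) (s₀ + δ)) :
    D i (Φ (s, 0)) (fderiv ℝ Φ (s, 0) e₀) = D j (Φ (s, 0)) (fderiv ℝ Φ (s, 0) e₀) :=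
  (hf.hasDerivAt_side h (zero_mem_closure_upper h.pos)
    (Ioo_subset_Ioo (by linarith [h.pos]) le_rfl) h.upper hs).unique
  (hf.hasDerivAt_side h (zero_mem_closure_lower h.pos)
    (Ioo_subset_Ioo le_rfl h.pos.le) h.lower hs)

end Trace

/-! ### Closed forms on a crease pattern and their local potentials -/

open MeasureTheory

theorem two_le_infty : (2 : WithTop ℕ∞) ≤ ∞ := ENat.LEInfty.out

/-- A closed form on the pieces of `P`, continuous on the closed pieces, with tangential components
that are continuous across the creases. -/
structure IsClosedForm (P : CreasePattern univ) (η : Par → Par →L[ℝ] ℝ)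
    (E : P.ι → Par → Par →L[ℝ] ℝ) : Prop where
  eqOn : ∀ i, EqOn (E i) η (P.piece i)
  continuousOn : ∀ i, ContinuousOn (E i) (closure (P.piece i))
  differentiableAt : ∀ i, ∀ q ∈ P.piece i, DifferentiableAt ℝ η q
  symm : ∀ i, ∀ q ∈ P.piece i, ∀ u v, fderiv ℝ η q u v = fderiv ℝ η q v u
  tangential : ∀ i j s₀ δ Φ, IsCreaseChart P i j s₀ δ Φ → ∀ s ∈ Ioo (s₀ - δ) (s₀ + δ),
    E i (Φ (s, 0)) (fderiv ℝ Φ (s, 0) e₀) = E j (Φ (s, 0)) (fderiv ℝ Φ (s, 0) e₀)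

theorem IsCreaseChart.mono {P : CreasePattern univ} {i j : P.ι} {s₀ δ δ' : ℝ} {Φ : Par → Par}
    (h : IsCreaseChart P i j s₀ δ Φ) (h0 : 0 < δ') (hle : δ' ≤ δ) :
    IsCreaseChart P i j s₀ δ' Φ := by
  have hI : Ioo (s₀ - δ') (s₀ + δ') ⊆ Ioo (s₀ - δ) (s₀ + δ) :=
    Ioo_subset_Ioo (by linarith) (by linarith)
  exact ⟨h0, fun p hp => h.contDiffAt p ⟨hI hp.1, Ioo_subset_Ioo (by linarith) hle hp.2⟩,
    fun p hp => h.upper p ⟨hI hp.1, Ioo_subset_Ioo le_rfl hle hp.2⟩,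
    fun p hp => h.lower p ⟨hI hp.1, Ioo_subset_Ioo (by linarith) le_rfl hp.2⟩,
    fun s hs => h.tangent_ne_zero s (hI hs)⟩

namespace IsClosedForm

variable {P : CreasePattern univ} {η : Par → Par →L[ℝ] ℝ} {E : P.ι → Par → Par →L[ℝ] ℝ}

theorem eventually_norm_le (h : IsClosedForm P η E) (q₀ : Par) :
    ∃ M : ℝ, ∀ᶠ q in 𝓝 q₀, ∀ i, q ∈ P.piece i → ‖η q‖ ≤ M := by
  obtain ⟨M, hM⟩ := P.eventually_norm_le h.continuousOn q₀
  refine ⟨M, ?_⟩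
  filter_upwards [hM] with q hq i hi
  rw [← h.eqOn i hi]; exact hq i hi

theorem exists_potential_of_mem_piece (h : IsClosedForm P η E) {i : P.ι} {q₀ : Par}
    (hi : q₀ ∈ P.piece i) : ∃ (f : Par → ℝ) (K : NNReal), LipschitzWith K f ∧
      ∀ᶠ q in 𝓝 q₀, q ∉ P.creases → HasFDerivAt f (η q) q := by
  obtain ⟨M, hM⟩ := h.eventually_norm_le q₀
  obtain ⟨r, hr, hb⟩ := Metric.eventually_nhds_iff_ball.1
    (hM.and ((P.isOpen_piece i).mem_nhds hi))
  obtain ⟨F, K, hF, hd⟩ := exists_lipschitz_potential (convex_ball q₀ r) Metric.isOpen_ball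
    (fun q hq => (h.differentiableAt i q (hb q hq).2).differentiableWithinAt)
    (fun q hq => h.symm i q (hb q hq).2) (fun q hq => (hb q hq).1 i (hb q hq).2)
  refine ⟨F, K, hF, ?_⟩
  filter_upwards [Metric.ball_mem_nhds q₀ hr] with q hq _ using hd q hq

/-- Straighten the crease, integrate the pulled-back form on each half of a box, glue along the axis
thanks to the tangential condition, and transport the result back to the plane. -/
theorem exists_potential_of_mem_creases (h : IsClosedForm P η E) {q₀ : Par}
    (hq₀ : q₀ ∈ P.creases) (hv : q₀ ∉ P.vertices) :
    ∃ (f : Par → ℝ) (K : NNReal), LipschitzWith K f ∧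
      ∀ᶠ q in 𝓝 q₀, q ∉ P.creases → HasFDerivAt f (η q) q := by
  obtain ⟨M, hM⟩ := h.eventually_norm_le q₀
  obtain ⟨i, j, s₀, δ₀, Φ, Ψ, hc₀, hΨ, hΨc, hΦΨ, hN₀, hcr₀⟩ := exists_isCreaseChart P hq₀ hv hM
  have hcont : ContinuousAt (fderiv ℝ Φ) (s₀, 0) :=
    ((hc₀.contDiffAt _ (hc₀.zero_mem ⟨by linarith [hc₀.pos], by linarith [hc₀.pos]⟩)).fderiv_right
      (m := 0) (by simp)).continuousAt
  -- The box is shrunk until the derivative of the chart is bounded; together with the bound on η,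
  -- this makes the potentials of the pull-back Lipschitz.
  obtain ⟨r, hr, hball⟩ := Metric.eventually_nhds_iff_ball.1
    (hcont.norm.eventually (gt_mem_nhds (lt_add_one ‖fderiv ℝ Φ (s₀, 0)‖)))
  set δ := min δ₀ r
  have hδ : 0 < δ := lt_min hc₀.pos hr
  have hc := hc₀.mono hδ (min_le_left _ _)
  set B := ‖fderiv ℝ Φ (s₀, 0)‖ + 1
  have hbox : Ioo (s₀ - δ) (s₀ + δ) ×ˢ Ioo (-δ) δ ⊆
      Ioo (s₀ - δ₀) (s₀ + δ₀) ×ˢ Ioo (-δ₀) δ₀ := by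
    have := min_le_left δ₀ r
    exact prod_mono (Ioo_subset_Ioo (by linarith) (by linarith))
      (Ioo_subset_Ioo (by linarith) (by linarith))
  have hN : ∀ p ∈ Ioo (s₀ - δ) (s₀ + δ) ×ˢ Ioo (-δ) δ, ∀ l, Φ p ∈ P.piece l → ‖η (Φ p)‖ ≤ M :=
    fun p hp => hN₀ p (hbox hp)
  have hB : ∀ p ∈ Ioo (s₀ - δ) (s₀ + δ) ×ˢ Ioo (-δ) δ, ‖fderiv ℝ Φ p‖ ≤ B := by
    intro p hp
    refine (hball p ?_).le
    rw [Metric.mem_ball, Prod.dist_eq, max_lt_iff, Real.dist_eq, Real.dist_eq, abs_lt, abs_lt]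
    have := min_le_right δ₀ r
    obtain ⟨⟨_, _⟩, _, _⟩ := hp
    refine ⟨⟨?_, ?_⟩, ?_, ?_⟩ <;> simp only <;> linarith
  set σ : Par → Par →L[ℝ] ℝ := fun p => (η (Φ p)).comp (fderiv ℝ Φ p) with hσ
  have side : ∀ ρ : Set ℝ, Convex ℝ ρ → IsOpen ρ → ρ ⊆ Ioo (-δ) δ → ∀ l : P.ι,
      (∀ p ∈ Ioo (s₀ - δ) (s₀ + δ) ×ˢ ρ, Φ p ∈ P.piece l) →
      ∃ (F : Par → ℝ) (K : NNReal), LipschitzWith K F ∧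
        ∀ p ∈ Ioo (s₀ - δ) (s₀ + δ) ×ˢ ρ, HasFDerivAt F (σ p) p := by
    intro ρ hρc hρo hρ l hl
    have hsub : Ioo (s₀ - δ) (s₀ + δ) ×ˢ ρ ⊆ Ioo (s₀ - δ) (s₀ + δ) ×ˢ Ioo (-δ) δ :=
      prod_mono subset_rfl hρ
    have hp : ∀ p ∈ Ioo (s₀ - δ) (s₀ + δ) ×ˢ ρ, _ := fun p hp =>
      pullback_closed (h.differentiableAt l _ (hl p hp)) (h.symm l _ (hl p hp))
        ((hc.contDiffAt p (hsub hp)).of_le two_le_infty)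
    refine exists_lipschitz_potential ((convex_Ioo _ _).prod hρc) (isOpen_Ioo.prod hρo)
      (fun p h => (hp p h).1.differentiableWithinAt) (fun p h => (hp p h).2) (M := M * B)
      fun p h => ?_
    refine (ContinuousLinearMap.opNorm_comp_le _ _).trans ?_
    have h1 := hN p (hsub h) l (hl p h)
    exact mul_le_mul h1 (hB p (hsub h)) (norm_nonneg _) ((norm_nonneg _).trans h1)
  obtain ⟨Fp, Kp, hLp, hFp⟩ := side (Ioo 0 δ) (convex_Ioo _ _) isOpen_Ioo
    (Ioo_subset_Ioo (by linarith) le_rfl) i hc.upper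
  obtain ⟨Fm, Km, hLm, hFm⟩ := side (Ioo (-δ) 0) (convex_Ioo _ _) isOpen_Ioo
    (Ioo_subset_Ioo le_rfl hδ.le) j hc.lower
  have lim : ∀ (ρ : Set ℝ) (l : P.ι), (0 : ℝ) ∈ closure ρ →
      (∀ p ∈ Ioo (s₀ - δ) (s₀ + δ) ×ˢ ρ, Φ p ∈ P.piece l) → ∀ s ∈ Ioo (s₀ - δ) (s₀ + δ),
      Tendsto (fun p => σ p e₀) (𝓝[Ioo (s₀ - δ) (s₀ + δ) ×ˢ ρ] (s, 0))
        (𝓝 (E l (Φ (s, 0)) (fderiv ℝ Φ (s, 0) e₀))) := by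
    intro ρ l hρ hl s hs
    obtain ⟨hmem, htend⟩ := tendsto_chart_side hc hρ hl hs
    have h1 : Tendsto (fun p => E l (Φ p)) (𝓝[Ioo (s₀ - δ) (s₀ + δ) ×ˢ ρ] (s, 0))
        (𝓝 (E l (Φ (s, 0)))) := (h.continuousOn l _ hmem).tendsto.comp htend
    have h2 : ContinuousAt (fun p => fderiv ℝ Φ p e₀) ((s, 0) : Par) :=
      (((hc.contDiffAt _ (hc.zero_mem hs)).fderiv_right (m := 0) (by simp)).continuousAt).clm_apply
        continuousAt_const
    have h3 := (isBoundedBilinearMap_apply.continuous.tendsto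
      (E l (Φ (s, 0)), fderiv ℝ Φ (s, 0) e₀)).comp
      (h1.prodMk_nhds (h2.tendsto.mono_left nhdsWithin_le_nhds))
    refine h3.congr' ?_
    filter_upwards [self_mem_nhdsWithin] with p hp
    simp [hσ, h.eqOn l (hl p hp)]
  obtain ⟨F, K, hF, hFd⟩ := exists_glued_potential hδ hLp hLm hFp hFm fun s hs =>
    ⟨_, lim _ i (zero_mem_closure_upper hδ) hc.upper s hs, by
      rw [h.tangential i j s₀ δ Φ hc s hs]
      exact lim _ j (zero_mem_closure_lower hδ) hc.lower s hs⟩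
  have hnhds : Ioo (s₀ - δ) (s₀ + δ) ×ˢ Ioo (-δ) δ ∈ 𝓝 (Ψ q₀) := by
    rw [hΨ]
    exact (isOpen_Ioo.prod isOpen_Ioo).mem_nhds (hc.zero_mem ⟨by linarith, by linarith⟩)
  obtain ⟨f, K', hf, hfd⟩ := exists_potential_of_chart (η := η)
    (hΨc.of_le (by exact_mod_cast le_top)) hΦΨ (by
      filter_upwards [hnhds] with p hp using (hc.contDiffAt p hp).differentiableAt (by simp)) hF (by
      filter_upwards [hnhds] with p hp hp2 using hFd p hp hp2)
  refine ⟨f, K', hf, ?_⟩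
  filter_upwards [hfd, hΦΨ, hΨc.continuousAt.eventually hnhds] with q h1 h2 h3 hq
  refine h1 fun h0 => hq ?_
  have : Ψ q = ((Ψ q).1, 0) := Prod.ext rfl h0
  rw [← h2, this]
  exact hcr₀ _ (hbox h3).1

theorem exists_potential (h : IsClosedForm P η E) {q₀ : Par} (hv : q₀ ∉ P.vertices) :
    ∃ (f : Par → ℝ) (K : NNReal), LipschitzWith K f ∧
      ∀ᶠ q in 𝓝 q₀, q ∉ P.creases → HasFDerivAt f (η q) q := by
  by_cases hq : q₀ ∈ P.creases
  · exact h.exists_potential_of_mem_creases hq hv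
  · obtain ⟨i, hi⟩ := P.exists_mem_piece hq
    exact h.exists_potential_of_mem_piece hi

theorem locallyIntegrable (h : IsClosedForm P η E) : LocallyIntegrable η := by
  have hm : AEStronglyMeasurable η volume := by
    have ho : IsOpen (⋃ i, P.piece i) := isOpen_iUnion P.isOpen_piece
    have hc : ContinuousOn η (⋃ i, P.piece i) := by
      intro q hq
      obtain ⟨i, hi⟩ := mem_iUnion.1 hq
      exact (h.differentiableAt i q hi).continuousAt.continuousWithinAt
    have := hc.aestronglyMeasurable (μ := volume) ho.measurableSet
    rwa [Measure.restrict_eq_self_of_ae_mem] at this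
    filter_upwards [P.ae_mem_piece] with q hq using mem_iUnion.2 hq
  intro q₀
  obtain ⟨M, hM⟩ := h.eventually_norm_le q₀
  obtain ⟨r, hr, hb⟩ := Metric.eventually_nhds_iff_ball.1 hM
  refine ⟨Metric.ball q₀ r, Metric.ball_mem_nhds q₀ hr, ?_⟩
  refine Measure.integrableOn_of_bounded (M := M) (measure_ball_lt_top).ne hm ?_
  rw [ae_restrict_iff' measurableSet_ball]
  filter_upwards [P.ae_mem_piece] with q ⟨i, hi⟩ hq using hb q hq i hi

end IsClosedForm

/-! ### The weak exterior derivative, away from the vertices -/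

/-- The exterior derivative of `η`, tested against `χ`. -/
noncomputable def testForm (η : Par → Par →L[ℝ] ℝ) (χ : Par → ℝ) : ℝ :=
  ∫ q, (fderiv ℝ χ q e₀ * η q e₁ - fderiv ℝ χ q e₁ * η q e₀)

section Test

variable {η : Par → Par →L[ℝ] ℝ} {χ χ' : Par → ℝ}

theorem contDiff_partial (hχ : ContDiff ℝ ∞ χ) (v : Par) :
    ContDiff ℝ ∞ fun q => fderiv ℝ χ q v :=
  (hχ.fderiv_right (m := ∞) (by simp)).clm_apply contDiff_const

theorem hasCompactSupport_partial (hχ : HasCompactSupport χ) (v : Par) :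
    HasCompactSupport fun q => fderiv ℝ χ q v :=
  hχ.fderiv_apply ℝ v

theorem integrable_partial_mul (hη : LocallyIntegrable η) (hχ : ContDiff ℝ ∞ χ)
    (hχc : HasCompactSupport χ) (u v : Par) :
    Integrable fun q => fderiv ℝ χ q u * η q v := by
  have h1 : LocallyIntegrable fun q => η q v := by
    intro q
    obtain ⟨s, hs, hi⟩ := hη q
    exact ⟨s, hs, (ContinuousLinearMap.apply ℝ ℝ v).integrable_comp hi⟩
  have := h1.integrable_smul_left_of_hasCompactSupport (contDiff_partial hχ u).continuous
    (hasCompactSupport_partial hχc u)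
  simpa using this

theorem integrable_testForm (hη : LocallyIntegrable η) (hχ : ContDiff ℝ ∞ χ)
    (hχc : HasCompactSupport χ) :
    Integrable fun q => fderiv ℝ χ q e₀ * η q e₁ - fderiv ℝ χ q e₁ * η q e₀ :=
  (integrable_partial_mul hη hχ hχc _ _).sub (integrable_partial_mul hη hχ hχc _ _)

theorem testForm_add (hη : LocallyIntegrable η) (hχ : ContDiff ℝ ∞ χ) (hχc : HasCompactSupport χ)
    (hχ' : ContDiff ℝ ∞ χ') (hχc' : HasCompactSupport χ') :
    testForm η (χ + χ') = testForm η χ + testForm η χ' := by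
  unfold testForm
  rw [← integral_add (integrable_testForm hη hχ hχc) (integrable_testForm hη hχ' hχc')]
  congr 1 with q
  rw [fderiv_add (hχ.differentiable (by simp) q) (hχ'.differentiable (by simp) q)]
  simp; ring

theorem testForm_sum (hη : LocallyIntegrable η) {ι : Type*} (t : Finset ι) (χ : ι → Par → ℝ)
    (hχ : ∀ i, ContDiff ℝ ∞ (χ i)) (hχc : ∀ i, HasCompactSupport (χ i)) :
    testForm η (fun q => ∑ i ∈ t, χ i q) = ∑ i ∈ t, testForm η (χ i) := by
  unfold testForm
  rw [← integral_finsetSum _ fun i _ => integrable_testForm hη (hχ i) (hχc i)]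
  congr 1 with q
  rw [fderiv_fun_sum fun i _ => (hχ i).differentiable (by simp) q]
  simp [Finset.sum_mul, Finset.sum_sub_distrib]

/-- Integration by parts, legitimate for a Lipschitz f because χ is smooth with compact support. -/
theorem integral_partial_mul_lineDeriv {f : Par → ℝ} {K : NNReal} (hf : LipschitzWith K f)
    (hχ : ContDiff ℝ ∞ χ) (hχc : HasCompactSupport χ) (u v : Par) :
    ∫ q, fderiv ℝ χ q u * lineDeriv ℝ f q v = - ∫ q, fderiv ℝ (fderiv ℝ χ) q v u * f q := by
  have h1 := contDiff_partial hχ u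
  have h2 := hasCompactSupport_partial hχc u
  obtain ⟨D, hD⟩ := h1.lipschitzWith_of_hasCompactSupport h2 (by simp)
  have h3 := hf.integral_lineDeriv_mul_eq (μ := volume) hD h2 v
  simp_rw [mul_comm (fderiv ℝ χ _ u)]
  rw [h3, ← integral_neg]
  congr 1 with q
  have h4 : DifferentiableAt ℝ (fderiv ℝ χ) q :=
    (hχ.fderiv_right (m := ∞) (by simp)).differentiable (by simp) q
  rw [(h1.differentiable (by simp) q).lineDeriv_eq_fderiv,
    fderiv_clm_apply h4 (differentiableAt_const u)]
  simp

/-- With η = df almost everywhere on the support, two integrations by parts leave f against the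
difference of the mixed second derivatives of χ, which vanishes. -/
theorem testForm_eq_zero_of_potential (hη : LocallyIntegrable η) {f : Par → ℝ} {K : NNReal}
    (hf : LipschitzWith K f) (hχ : ContDiff ℝ ∞ χ) (hχc : HasCompactSupport χ)
    (hd : ∀ᵐ q, q ∈ tsupport χ → HasFDerivAt f (η q) q) : testForm η χ = 0 := by
  unfold testForm
  rw [integral_sub (integrable_partial_mul hη hχ hχc _ _) (integrable_partial_mul hη hχ hχc _ _)]
  have h1 : ∀ u v : Par, ∫ q, fderiv ℝ χ q u * η q v
      = ∫ q, fderiv ℝ χ q u * lineDeriv ℝ f q v := by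
    intro u v
    refine integral_congr_ae ?_
    filter_upwards [hd] with q hq
    by_cases hqs : q ∈ tsupport χ
    · have h := hq hqs
      rw [h.differentiableAt.lineDeriv_eq_fderiv, h.fderiv]
    · have : fderiv ℝ χ q = 0 := by
        by_contra h0
        exact hqs (support_fderiv_subset ℝ h0)
      simp [this]
  rw [h1, h1, integral_partial_mul_lineDeriv hf hχ hχc, integral_partial_mul_lineDeriv hf hχ hχc,
    sub_eq_zero]
  congr 2 with q
  have : IsSymmSndFDerivAt ℝ χ q := 
    (hχ.contDiffAt.of_le two_le_infty).isSymmSndFDerivAt (by simp)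
  rw [this]

end Test

open scoped Manifold

namespace IsClosedForm

variable {P : CreasePattern univ} {η : Par → Par →L[ℝ] ℝ} {E : P.ι → Par → Par →L[ℝ] ℝ}
  {χ : Par → ℝ}

/-- Potentials are only local: a partition of unity splits χ into finitely many functions, each
supported where one potential is available. -/
theorem testForm_eq_zero_of_disjoint (h : IsClosedForm P η E) (hχ : ContDiff ℝ ∞ χ)
    (hχc : HasCompactSupport χ) (hv : ∀ q ∈ tsupport χ, q ∉ P.vertices) : testForm η χ = 0 := by
  have hloc : ∀ q ∈ tsupport χ, ∃ N : Set Par, IsOpen N ∧ q ∈ N ∧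
      ∃ (f : Par → ℝ) (K : NNReal), LipschitzWith K f ∧
        ∀ q ∈ N, q ∉ P.creases → HasFDerivAt f (η q) q := by
    intro q hq
    obtain ⟨f, K, hf, hd⟩ := h.exists_potential (hv q hq)
    obtain ⟨N, hN, hNo, hqN⟩ := eventually_nhds_iff.1 hd
    exact ⟨N, hNo, hqN, f, K, hf, hN⟩
  choose! N hNo hqN f K hf hd using hloc
  obtain ⟨t, ht, hcov⟩ := hχc.isCompact.elim_nhds_subcover N fun q hq => (hNo q hq).mem_nhds (hqN q hq)
  obtain ⟨ρ, hρ⟩ := SmoothPartitionOfUnity.exists_isSubordinate 𝓘(ℝ, Par) (isClosed_tsupport χ)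
    (fun i : t => N i) (fun i => hNo i (ht i i.2)) (by
      intro q hq
      obtain ⟨i, hi, hqi⟩ := mem_iUnion₂.1 (hcov hq)
      exact mem_iUnion.2 ⟨⟨i, hi⟩, hqi⟩)
  have hsum : χ = fun q => ∑ i : t, ρ i q * χ q := by
    ext1 q
    rw [← Finset.sum_mul]
    by_cases hq : q ∈ tsupport χ
    · have := ρ.sum_eq_one hq
      rw [finsum_eq_sum_of_fintype] at this
      rw [this, one_mul]
    · rw [image_eq_zero_of_notMem_tsupport hq, mul_zero]
  have hsm : ∀ i : t, ContDiff ℝ ∞ fun q => ρ i q * χ q := fun i =>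
    (contMDiff_iff_contDiff.1 (ρ i).contMDiff).mul hχ
  have hcs : ∀ i : t, HasCompactSupport fun q => ρ i q * χ q := fun i => hχc.mul_left
  rw [hsum, testForm_sum h.locallyIntegrable Finset.univ _ hsm hcs]
  refine Finset.sum_eq_zero fun i _ => ?_
  refine testForm_eq_zero_of_potential h.locallyIntegrable (hf i (ht i i.2)) (hsm i) (hcs i) ?_
  have hnull : ∀ᵐ q : Par, q ∉ P.creases := measure_eq_zero_iff_ae_notMem.1 P.volume_creases
  filter_upwards [hnull] with q hq hqs
  exact hd i (ht i i.2) q (hρ i (tsupport_mul_subset_left hqs)) hq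

end IsClosedForm

/-! ### Cutoffs: the vertices do not contribute -/

/-- A smooth plateau function around `0`. -/
theorem exists_plateau : ∃ ψ : Par → ℝ, ContDiff ℝ ∞ ψ ∧ HasCompactSupport ψ ∧
    (∀ᶠ q in 𝓝 0, ψ q = 1) ∧ (∀ q, 0 ≤ ψ q) ∧ (∀ q, ψ q ≤ 1) ∧ ∀ q, 2 ≤ ‖q‖ → ψ q = 0 := by
  let B : ContDiffBump (0 : Par) := ⟨1, 2, by norm_num, by norm_num⟩
  refine ⟨B, B.contDiff, B.hasCompactSupport, B.eventuallyEq_one, fun q => B.nonneg,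
    fun q => B.le_one, fun q hq => B.zero_of_le_dist (by simpa using hq)⟩

theorem hasCompactSupport_comp_affine {ψ : Par → ℝ} (hψ : HasCompactSupport ψ) {r : ℝ} (hr : r ≠ 0)
    (e : Par) : HasCompactSupport fun q => ψ (r • (q - e)) := by
  have : HasCompactSupport (ψ ∘ ((Homeomorph.subRight e).trans (Homeomorph.smulOfNeZero r hr))) :=
    hψ.comp_homeomorph _
  exact this

theorem contDiff_comp_affine {ψ : Par → ℝ} (hψ : ContDiff ℝ ∞ ψ) (r : ℝ) (e : Par) :
    ContDiff ℝ ∞ fun q => ψ (r • (q - e)) := by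
  have : ContDiff ℝ ∞ fun q : Par => r • (q - e) := by fun_prop
  exact hψ.comp this

theorem fderiv_comp_affine {ψ : Par → ℝ} (hψ : Differentiable ℝ ψ) (r : ℝ) (e q : Par) :
    fderiv ℝ (fun q => ψ (r • (q - e))) q = r • fderiv ℝ ψ (r • (q - e)) := by
  have h1 : HasFDerivAt (fun q : Par => r • (q - e)) (r • ContinuousLinearMap.id ℝ Par) q :=
    ((hasFDerivAt_id q).sub_const e).const_smul r
  have h2 := (hψ (r • (q - e))).hasFDerivAt.comp q h1
  have h3 : fderiv ℝ (fun q => ψ (r • (q - e))) q = _ := h2.fderiv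
  rw [h3]
  ext <;> simp

theorem abs_testForm_integrand_le (a : Par →L[ℝ] ℝ) (b : Par →L[ℝ] ℝ) :
    ‖a e₀ * b e₁ - a e₁ * b e₀‖ ≤ 2 * (‖a‖ * ‖b‖) := by
  have h : ∀ (L : Par →L[ℝ] ℝ) (v : Par), ‖v‖ = 1 → ‖L v‖ ≤ ‖L‖ := fun L v hv => by
    simpa [hv] using L.le_opNorm v
  have h0 : ‖e₀‖ = 1 := by simp [Prod.norm_def]
  have h1 : ‖e₁‖ = 1 := by simp [Prod.norm_def]
  have h2 : ‖a e₀ * b e₁‖ ≤ ‖a‖ * ‖b‖ := by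
    rw [norm_mul]
    exact mul_le_mul (h a _ h0) (h b _ h1) (norm_nonneg _) (norm_nonneg _)
  have h3 : ‖a e₁ * b e₀‖ ≤ ‖a‖ * ‖b‖ := by
    rw [norm_mul]
    exact mul_le_mul (h a _ h1) (h b _ h0) (norm_nonneg _) (norm_nonneg _)
  exact (norm_sub_le _ _).trans (by linarith)

theorem exists_norm_fderiv_le {χ : Par → ℝ} (hχ : ContDiff ℝ ∞ χ) (hχc : HasCompactSupport χ) :
    ∃ C, 0 ≤ C ∧ ∀ q, ‖fderiv ℝ χ q‖ ≤ C := by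
  obtain ⟨C, hC⟩ := (hχc.fderiv ℝ).exists_bound_of_continuous (hχ.continuous_fderiv (by simp))
  exact ⟨C, (norm_nonneg _).trans (hC 0), hC⟩

namespace IsClosedForm

variable {P : CreasePattern univ} {η : Par → Par →L[ℝ] ℝ} {E : P.ι → Par → Par →L[ℝ] ℝ}
  {χ : Par → ℝ}

/-- Points have zero capacity: a test function supported near a point may be neglected. -/
theorem tendsto_testForm_cutoff (h : IsClosedForm P η E) (hχ : ContDiff ℝ ∞ χ)
    (hχc : HasCompactSupport χ) {ψ : Par → ℝ} (hψ : ContDiff ℝ ∞ ψ) (hψc : HasCompactSupport ψ)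
    (hψ0 : ∀ q, 0 ≤ ψ q) (hψ1 : ∀ q, ψ q ≤ 1) (hψ2 : ∀ q, 2 ≤ ‖q‖ → ψ q = 0) (e : Par) :
    Tendsto (fun δ : ℝ => testForm η fun q => ψ (δ⁻¹ • (q - e)) * χ q) (𝓝[>] 0) (𝓝 0) := by
  obtain ⟨M, hM⟩ := h.eventually_norm_le e
  obtain ⟨r, hr, hb⟩ := Metric.eventually_nhds_iff_ball.1 hM
  obtain ⟨C₁, hC₁0, hC₁⟩ := exists_norm_fderiv_le hψ hψc
  obtain ⟨C₂, hC₂0, hC₂⟩ := exists_norm_fderiv_le hχ hχc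
  obtain ⟨C₃, hC₃⟩ := hχc.exists_bound_of_continuous hχ.continuous
  have hC₃0 : 0 ≤ C₃ := (norm_nonneg _).trans (hC₃ 0)
  have hM' : ∀ᵐ q : Par, q ∈ Metric.ball e r → ‖η q‖ ≤ |M| := by
    filter_upwards [P.ae_mem_piece] with q ⟨i, hi⟩ hq using (hb q hq i hi).trans (le_abs_self M)
  set V := (volume (Metric.ball (0 : Par) 1)).toReal
  -- For δ < 1, the gradient of the cut-off function is at most (C₁ C₃ + C₂) / δ; it is supported in
  -- a ball of radius 2δ, of area 4 V δ². The product is of order δ.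
  set C := 2 * ((C₁ * C₃ + C₂) * |M|) * (4 * V) with hCdef
  have hbound : ∀ᶠ δ in 𝓝[>] (0 : ℝ),
      ‖testForm η fun q => ψ (δ⁻¹ • (q - e)) * χ q‖ ≤ C * δ := by
    have hsmall : ∀ᶠ δ in 𝓝[>] (0 : ℝ), δ < min 1 (r / 2) :=
      mem_nhdsWithin_of_mem_nhds (Iio_mem_nhds (lt_min one_pos (by linarith)))
    filter_upwards [hsmall, self_mem_nhdsWithin] with δ hδ (hδ0 : 0 < δ)
    have hδ1 : δ < 1 := hδ.trans_le (min_le_left _ _)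
    have hδr : 2 * δ < r := by have := hδ.trans_le (min_le_right 1 (r / 2)); linarith
    have hout : ∀ q ∉ Metric.closedBall e (2 * δ), ψ (δ⁻¹ • (q - e)) = 0 ∧
        fderiv ℝ (fun q => ψ (δ⁻¹ • (q - e))) q = 0 := by
      intro q hq
      have hz : ∀ q ∉ Metric.closedBall e (2 * δ), ψ (δ⁻¹ • (q - e)) = 0 := by
        intro q hq
        apply hψ2
        rw [Metric.mem_closedBall, not_le, dist_eq_norm] at hq
        rw [norm_smul, norm_inv, Real.norm_of_nonneg hδ0.le, inv_mul_eq_div, le_div_iff₀ hδ0]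
        exact hq.le
      refine ⟨hz q hq, ?_⟩
      have : (fun q => ψ (δ⁻¹ • (q - e))) =ᶠ[𝓝 q] fun _ => 0 := by
        filter_upwards [Metric.isClosed_closedBall.isOpen_compl.mem_nhds hq] with x hx using hz x hx
      rw [this.fderiv_eq]; simp
    have hψd : Differentiable ℝ fun q => ψ (δ⁻¹ • (q - e)) :=
      (contDiff_comp_affine hψ _ _).differentiable (by simp)
    have hχd := hχ.differentiable (by simp)
    have hfd : ∀ q, fderiv ℝ (fun q => ψ (δ⁻¹ • (q - e)) * χ q) q
        = ψ (δ⁻¹ • (q - e)) • fderiv ℝ χ q + χ q • fderiv ℝ (fun q => ψ (δ⁻¹ • (q - e))) q :=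
      fun q => fderiv_fun_mul (hψd q) (hχd q)
    have hnorm : ∀ q, ‖fderiv ℝ (fun q => ψ (δ⁻¹ • (q - e)) * χ q) q‖ ≤ (C₁ * C₃ + C₂) / δ := by
      intro q
      rw [hfd, fderiv_comp_affine (hψ.differentiable (by simp))]
      refine (norm_add_le _ _).trans ?_
      rw [norm_smul, norm_smul, norm_smul, norm_inv, Real.norm_of_nonneg hδ0.le,
        Real.norm_of_nonneg (hψ0 _)]
      have h1 : ψ (δ⁻¹ • (q - e)) * ‖fderiv ℝ χ q‖ ≤ C₂ / δ := by
        rw [le_div_iff₀ hδ0]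
        have := mul_le_mul (hψ1 (δ⁻¹ • (q - e))) (hC₂ q) (norm_nonneg _) zero_le_one
        nlinarith [mul_nonneg (hψ0 (δ⁻¹ • (q - e))) (norm_nonneg (fderiv ℝ χ q))]
      have h2 : ‖χ q‖ * (δ⁻¹ * ‖fderiv ℝ ψ (δ⁻¹ • (q - e))‖) ≤ C₁ * C₃ / δ := by
        have := mul_le_mul (hC₃ q) (hC₁ (δ⁻¹ • (q - e))) (norm_nonneg _) hC₃0
        rw [div_eq_mul_inv]
        nlinarith [inv_pos.2 hδ0]
      rw [add_div]; linarith
    unfold testForm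
    rw [← setIntegral_eq_integral_of_forall_compl_eq_zero (s := Metric.closedBall e (2 * δ))]
    · have hvol : (volume (Metric.closedBall e (2 * δ))).toReal = (2 * δ) ^ 2 * V := by
        rw [Measure.addHaar_closedBall _ _ (by linarith), ENNReal.toReal_mul,
          ENNReal.toReal_ofReal (by positivity)]
        simp [V]
      have h1 := norm_setIntegral_le_of_norm_le_const_ae' (μ := volume)
        (s := Metric.closedBall e (2 * δ)) (C := 2 * ((C₁ * C₃ + C₂) / δ * |M|))
        (f := fun q => fderiv ℝ (fun q => ψ (δ⁻¹ • (q - e)) * χ q) q e₀ * η q e₁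
          - fderiv ℝ (fun q => ψ (δ⁻¹ • (q - e)) * χ q) q e₁ * η q e₀)
        (measure_closedBall_lt_top) (by
          filter_upwards [hM'] with q hq hqb
          refine (abs_testForm_integrand_le _ _).trans ?_
          have := hq (Metric.closedBall_subset_ball hδr hqb)
          have h2 := mul_le_mul (hnorm q) this (norm_nonneg _) ((norm_nonneg _).trans (hnorm q))
          linarith)
      refine h1.trans (le_of_eq ?_)
      rw [Measure.real, hvol, hCdef]
      field_simp
      ring
    · intro q hq
      rw [hfd, (hout q hq).1, (hout q hq).2]
      simp
  refine squeeze_zero_norm' hbound ?_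
  have : Tendsto (fun δ : ℝ => C * δ) (𝓝 0) (𝓝 (C * 0)) := tendsto_id.const_mul C
  rw [mul_zero] at this
  exact this.mono_left nhdsWithin_le_nhds

/-- Induction on the finitely many vertices in the support. Split χ by a plateau of size δ around a
vertex e: the outer part no longer has e in its support and tests to zero by induction, while the
inner part tends to zero with δ. Their sum is independent of δ. -/
theorem testForm_eq_zero (h : IsClosedForm P η E) (hχ : ContDiff ℝ ∞ χ)
    (hχc : HasCompactSupport χ) : testForm η χ = 0 := by
  have main : ∀ (S : Finset Par) (χ : Par → ℝ), ContDiff ℝ ∞ χ → HasCompactSupport χ →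
      P.vertices ∩ tsupport χ ⊆ S → testForm η χ = 0 := by
    intro S
    induction S using Finset.induction_on with
    | empty =>
      intro χ hχ hχc hS
      exact h.testForm_eq_zero_of_disjoint hχ hχc fun q hq hv => by simpa using hS ⟨hv, hq⟩
    | insert e S _ ih =>
      intro χ hχ hχc hS
      obtain ⟨ψ, hψ, hψc, hψe, hψ0, hψ1, hψ2⟩ := exists_plateau
      have hlim := h.tendsto_testForm_cutoff hχ hχc hψ hψc hψ0 hψ1 hψ2 e
      refine tendsto_nhds_unique (tendsto_const_nhds.congr' ?_) hlim
      filter_upwards [self_mem_nhdsWithin] with δ (hδ : 0 < δ)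
      have hψδ : ContDiff ℝ ∞ fun q => ψ (δ⁻¹ • (q - e)) :=
        contDiff_comp_affine hψ _ _
      have hs : χ = (fun q => ψ (δ⁻¹ • (q - e)) * χ q)
          + fun q => (1 - ψ (δ⁻¹ • (q - e))) * χ q := by
        ext q; simp; ring
      have h0 : testForm η (fun q => (1 - ψ (δ⁻¹ • (q - e))) * χ q) = 0 := by
        refine ih _ ((contDiff_const.sub hψδ).mul hχ) hχc.mul_left ?_
        rintro v ⟨hv, hvs⟩
        have hvχ : v ∈ tsupport χ := tsupport_mul_subset_right hvs
        rcases Finset.mem_insert.1 (hS ⟨hv, hvχ⟩) with rfl | hvS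
        · exfalso
          have hc : Tendsto (fun q : Par => δ⁻¹ • (q - v)) (𝓝 v) (𝓝 0) := by
            have : ContinuousAt (fun q : Par => δ⁻¹ • (q - v)) v := by fun_prop
            simpa [ContinuousAt] using this
          have : (fun q => (1 - ψ (δ⁻¹ • (q - v))) * χ q) =ᶠ[𝓝 v] 0 := by
            filter_upwards [hc.eventually hψe] with q hq
            simp [hq]
          exact (notMem_tsupport_iff_eventuallyEq.2 this) hvs
        · exact hvS
      conv_lhs => rw [hs]
      rw [testForm_add h.locallyIntegrable (hψδ.mul hχ) hχc.mul_left
        ((contDiff_const.sub hψδ).mul hχ) hχc.mul_left, h0, add_zero]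
  exact main (P.finite_vertices_inter hχc.isCompact).toFinset χ hχ hχc (by simp)

/-! ### The linear part of a closed form -/

/-- A closed form that stays at bounded distance of a form with linear coefficients: the latter is
closed as well. -/
theorem linear_part_symm (h : IsClosedForm P η E) (B : Par →L[ℝ] Par →L[ℝ] ℝ) {M : ℝ}
    (hM : ∀ᵐ q, ‖η q - B q‖ ≤ M) : B e₀ e₁ = B e₁ e₀ := by
  obtain ⟨ψ, hψ, hψc, hψe, hψ0, -, -⟩ := exists_plateau
  have hBl : LocallyIntegrable fun q => B q := B.continuous.locallyIntegrable
  -- Integration by parts against the linear function q ↦ B q v, whose derivative along u is the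
  -- constant B u v. Testing the linear form thus measures its antisymmetric part times ∫ ψ, and ∫ ψ
  -- > 0.
  have hpart : ∀ u v : Par, ∫ q, fderiv ℝ ψ q u * B q v = - (B u v * ∫ q, ψ q) := by
    intro u v
    obtain ⟨D, hD⟩ := hψ.lipschitzWith_of_hasCompactSupport hψc (by simp)
    let f : Par →L[ℝ] ℝ := B.flip v
    have h3 := f.lipschitz.integral_lineDeriv_mul_eq (μ := volume) hD hψc u
    have h4 : ∀ q, lineDeriv ℝ f q u = B u v := fun q => by
      rw [f.differentiableAt.lineDeriv_eq_fderiv]; simp [f]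
    have h5 : ∀ q, lineDeriv ℝ ψ q (-u) = - fderiv ℝ ψ q u := fun q => by
      rw [(hψ.differentiable (by simp) q).lineDeriv_eq_fderiv]; simp
    simp_rw [h4, h5] at h3
    rw [integral_const_mul] at h3
    rw [h3, ← integral_neg]
    congr 1 with q
    simp [f]
  have hval : testForm (fun q => B q) ψ = -((B e₀ e₁ - B e₁ e₀) * ∫ q, ψ q) := by
    unfold testForm
    rw [integral_sub (integrable_partial_mul hBl hψ hψc _ _)
      (integrable_partial_mul hBl hψ hψc _ _), hpart, hpart]
    ring
  have hpos : 0 < ∫ q, ψ q := by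
    refine (hψ.continuous.integral_pos_of_hasCompactSupport_nonneg_nonzero hψc hψ0 (x := 0) ?_)
    rw [hψe.self_of_nhds]; exact one_ne_zero
  suffices h0 : testForm (fun q => B q) ψ = 0 by
    rw [hval, neg_eq_zero] at h0
    exact sub_eq_zero.1 ((mul_eq_zero.1 h0).resolve_right hpos.ne')
  set I := ∫ q, ‖fderiv ℝ ψ q‖
  have hIint : Integrable fun q => ‖fderiv ℝ ψ q‖ :=
    ((hψ.continuous_fderiv (by simp)).norm).integrable_of_hasCompactSupport (hψc.fderiv ℝ).norm
  -- Test against the wide bump ψ(r q). The contribution of the linear form scales like r⁻², that of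
  -- the bounded remainder only like r⁻¹, and they cancel since η is closed. Letting r → 0 kills the
  -- linear contribution.
  have hest : ∀ r : ℝ, 0 < r → ‖testForm (fun q => B q) ψ‖ ≤ (2 * |M| * I) * r := by
    intro r hr
    set ψr : Par → ℝ := fun q => ψ (r • (q - 0)) with hψr
    have hs : ContDiff ℝ ∞ ψr := contDiff_comp_affine hψ _ _
    have hc : HasCompactSupport ψr := hasCompactSupport_comp_affine hψc hr.ne' 0
    have hfd : ∀ q, fderiv ℝ ψr q = r • fderiv ℝ ψ (r • q) := fun q => by
      rw [hψr, fderiv_comp_affine (hψ.differentiable (by simp)), sub_zero]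
    have hz : testForm η ψr = 0 := h.testForm_eq_zero hs hc
    have hscale : testForm (fun q => B q) ψr = (r ^ 2)⁻¹ * testForm (fun q => B q) ψ := by
      unfold testForm
      have h1 := Measure.integral_comp_smul (volume : Measure Par)
        (fun q => fderiv ℝ ψ q e₀ * B q e₁ - fderiv ℝ ψ q e₁ * B q e₀) r
      have h2 : Module.finrank ℝ Par = 2 := by simp
      rw [h2, abs_of_pos (by positivity), smul_eq_mul] at h1
      rw [← h1]
      congr 1 with q
      rw [hfd]
      simp; ring
    have hdiff : testForm (fun q => B q) ψr = - testForm (fun q => η q - B q) ψr := by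
      have e1 : testForm (fun q => η q - B q) ψr = testForm η ψr - testForm (fun q => B q) ψr := by
        unfold testForm
        rw [← integral_sub (integrable_testForm h.locallyIntegrable hs hc)
          (integrable_testForm hBl hs hc)]
        congr 1 with q
        simp; ring
      rw [e1, hz]; ring
    have hIr : ∫ q, ‖fderiv ℝ ψr q‖ = r * ((r ^ 2)⁻¹ * I) := by
      have h1 := Measure.integral_comp_smul (volume : Measure Par) (fun q => ‖fderiv ℝ ψ q‖) r
      have h2 : Module.finrank ℝ Par = 2 := by simp
      rw [h2, abs_of_pos (by positivity), smul_eq_mul] at h1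
      rw [← h1, ← integral_const_mul]
      congr 1 with q
      rw [hfd, norm_smul, Real.norm_of_nonneg hr.le]
    have hIr' : Integrable fun q => ‖fderiv ℝ ψr q‖ :=
      ((hs.continuous_fderiv (by simp)).norm).integrable_of_hasCompactSupport (hc.fderiv ℝ).norm
    have hb : ‖testForm (fun q => η q - B q) ψr‖ ≤ 2 * |M| * (r * ((r ^ 2)⁻¹ * I)) := by
      unfold testForm
      rw [← hIr, ← integral_const_mul]
      refine norm_integral_le_of_norm_le (hIr'.const_mul _) ?_
      filter_upwards [hM] with q hq
      refine (abs_testForm_integrand_le _ _).trans ?_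
      have h2 := mul_le_mul_of_nonneg_left (hq.trans (le_abs_self M)) (norm_nonneg (fderiv ℝ ψr q))
      linarith
    have h3 : ‖(r ^ 2)⁻¹ * testForm (fun q => B q) ψ‖ ≤ 2 * |M| * (r * ((r ^ 2)⁻¹ * I)) := by
      rw [← hscale, hdiff, norm_neg]; exact hb
    rw [norm_mul, norm_inv, Real.norm_of_nonneg (by positivity : 0 ≤ r ^ 2),
      inv_mul_le_iff₀ (by positivity)] at h3
    refine h3.trans (le_of_eq ?_)
    field_simp
  have ht : Tendsto (fun r : ℝ => (2 * |M| * I) * r) (𝓝[>] 0) (𝓝 0) := by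
    have : Tendsto (fun δ : ℝ => (2 * |M| * I) * δ) (𝓝 0) (𝓝 ((2 * |M| * I) * 0)) :=
      tendsto_id.const_mul _
    rw [mul_zero] at this
    exact this.mono_left nhdsWithin_le_nhds
  have := ge_of_tendsto ht (by
    filter_upwards [self_mem_nhdsWithin] with r (hr : 0 < r) using hest r hr)
  simpa using this

end IsClosedForm

/-! ### Rotation fields, bending systems and their closed form -/

theorem cross_self (x : E3) : cross x x = 0 := by
  ext i; fin_cases i <;> simp <;> ring

section Rot

variable {X : Type*}

theorem continuousOn_rot [TopologicalSpace X] {s : Set X} {B C : X → Par →L[ℝ] E3}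
    (hB : ContinuousOn B s) (hC : ContinuousOn C s)
    (h0 : ∀ x ∈ s, cross (B x e₀) (B x e₁) ≠ 0) : ContinuousOn (fun x => rot (B x) (C x)) s := by
  have hB' : ∀ v, ContinuousOn (fun x => B x v) s := fun v => hB.clm_apply continuousOn_const
  have hC' : ∀ v, ContinuousOn (fun x => C x v) s := fun v => hC.clm_apply continuousOn_const
  have hn : ContinuousOn (fun x => cross (B x e₀) (B x e₁)) s :=
    (cross.continuous.comp_continuousOn (hB' e₀)).clm_apply (hB' e₁)
  have hN : ∀ x ∈ s, (inner ℝ (cross (B x e₀) (B x e₁)) (cross (B x e₀) (B x e₁)) : ℝ) ≠ 0 :=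
    fun x hx => inner_self_ne_zero.2 (h0 x hx)
  have i0 : ContinuousOn (fun x =>
      (inner ℝ (cross (B x e₀) (B x e₁)) (cross (B x e₀) (B x e₁)) : ℝ)⁻¹) s :=
    (hn.inner hn).inv₀ hN
  have i1 : ContinuousOn (fun x => (inner ℝ (C x e₀) (B x e₁) : ℝ)) s := (hC' e₀).inner (hB' e₁)
  have i2 : ContinuousOn (fun x => (inner ℝ (C x e₁) (cross (B x e₀) (B x e₁)) : ℝ)) s :=
    (hC' e₁).inner hn
  have i3 : ContinuousOn (fun x => (inner ℝ (C x e₀) (cross (B x e₀) (B x e₁)) : ℝ)) s :=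
    (hC' e₀).inner hn
  exact i0.smul (((i1.smul hn).add (i2.smul (hB' e₀))).sub (i3.smul (hB' e₁)))

theorem differentiableAt_rot [NormedAddCommGroup X] [NormedSpace ℝ X] {x : X}
    {B C : X → Par →L[ℝ] E3} (hB : DifferentiableAt ℝ B x) (hC : DifferentiableAt ℝ C x)
    (h0 : cross (B x e₀) (B x e₁) ≠ 0) : DifferentiableAt ℝ (fun x => rot (B x) (C x)) x := by
  have hB' : ∀ v, DifferentiableAt ℝ (fun x => B x v) x :=
    fun v => hB.clm_apply (differentiableAt_const v)
  have hC' : ∀ v, DifferentiableAt ℝ (fun x => C x v) x :=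
    fun v => hC.clm_apply (differentiableAt_const v)
  have hn : DifferentiableAt ℝ (fun x => cross (B x e₀) (B x e₁)) x :=
    (cross.differentiableAt.comp x (hB' e₀)).clm_apply (hB' e₁)
  have hN : (inner ℝ (cross (B x e₀) (B x e₁)) (cross (B x e₀) (B x e₁)) : ℝ) ≠ 0 :=
    inner_self_ne_zero.2 h0
  unfold rot
  exact ((hn.inner ℝ hn).fun_inv hN).fun_smul (((((hC' e₀).inner ℝ (hB' e₁)).fun_smul hn).fun_add
    (((hC' e₁).inner ℝ hn).fun_smul (hB' e₀))).fun_sub (((hC' e₀).inner ℝ hn).fun_smul (hB' e₁)))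

end Rot

/-- The form `v ↦ Ω v × b + τ v β + k v - m q v`. -/
noncomputable def slowForm (b β : Par → E3) (Ω : Par →L[ℝ] E3) (τ : Par →L[ℝ] ℝ)
    (k : Par →L[ℝ] E3) (m : Par →L[ℝ] Par →L[ℝ] E3) (q : Par) : Par →L[ℝ] E3 :=
  (cross.flip (b q)).comp Ω + τ.smulRight (β q) + k - m q

@[simp] theorem slowForm_apply (b β : Par → E3) (Ω : Par →L[ℝ] E3) (τ : Par →L[ℝ] ℝ)
    (k : Par →L[ℝ] E3) (m : Par →L[ℝ] Par →L[ℝ] E3) (q v : Par) :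
    slowForm b β Ω τ k m q v = cross (Ω v) (b q) + τ v • β q + k v - m q v := by
  simp [slowForm]

/-- A periodic surface `b`, an infinitesimal isometry `β` of `b` and a second-order correction `ζ`,
such that `β` and the form `slowForm + dζ` are both infinitesimal isometries of `b`. -/
structure IsBendingSystem (P : CreasePattern univ) (b β ζ : Par → E3)
    (B B' Z : P.ι → Par → Par →L[ℝ] E3) (Ω : Par →L[ℝ] E3) (τ : Par →L[ℝ] ℝ)
    (k : Par →L[ℝ] E3) (m : Par →L[ℝ] Par →L[ℝ] E3) : Prop where
  pw_b : PwC1 P b B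
  pw_β : PwC1 P β B'
  pw_ζ : PwC1 P ζ Z
  cd_b : ∀ i, ∀ q ∈ P.piece i, ContDiffAt ℝ 2 b q
  cd_β : ∀ i, ∀ q ∈ P.piece i, ContDiffAt ℝ 2 β q
  cd_ζ : ∀ i, ∀ q ∈ P.piece i, ContDiffAt ℝ 2 ζ q
  cross_ne_zero : ∀ i, ∀ q ∈ closure (P.piece i), cross (B i q e₀) (B i q e₁) ≠ 0
  m_symm : ∀ u v, m u v = m v u
  isometry_β : ∀ i, ∀ q ∈ P.piece i, ∀ u v,
    inner ℝ (B i q u) (B' i q v) + inner ℝ (B i q v) (B' i q u) = (0 : ℝ)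
  isometry_slow : ∀ i, ∀ q ∈ P.piece i, ∀ u v,
    inner ℝ (B i q u) (slowForm b β Ω τ k m q v + Z i q v)
      + inner ℝ (B i q v) (slowForm b β Ω τ k m q u + Z i q u) = (0 : ℝ)

/-- The form `v ↦ ⟨w, A v⟩ + ⟨Ω v, β⟩`. -/
noncomputable def dualForm (w : E3) (A : Par →L[ℝ] E3) (β : E3) (Ω : Par →L[ℝ] E3) :
    Par →L[ℝ] ℝ := (innerSL ℝ w).comp A + (innerSL ℝ β).comp Ω

@[simp] theorem dualForm_apply (w : E3) (A : Par →L[ℝ] E3) (β : E3) (Ω : Par →L[ℝ] E3) (v : Par) :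
    dualForm w A β Ω v = inner ℝ w (A v) + inner ℝ β (Ω v) := by
  simp [dualForm]

namespace IsBendingSystem

variable {P : CreasePattern univ} {b β ζ : Par → E3} {B B' Z : P.ι → Par → Par →L[ℝ] E3}
  {Ω : Par →L[ℝ] E3} {τ : Par →L[ℝ] ℝ} {k : Par →L[ℝ] E3} {m : Par →L[ℝ] Par →L[ℝ] E3}

theorem continuous_slowForm (h : IsBendingSystem P b β ζ B B' Z Ω τ k m) :
    Continuous (slowForm b β Ω τ k m) := by
  have h1 := h.pw_b.continuous
  have h2 := h.pw_β.continuous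
  unfold slowForm
  have h3 : Continuous fun q => (cross.flip (b q)).comp Ω :=
    (cross.flip.continuous.comp h1).clm_comp continuous_const
  have h4 : Continuous fun q => τ.smulRight (β q) :=
    ((ContinuousLinearMap.smulRightL ℝ Par E3 τ).continuous).comp h2
  exact ((h3.add h4).add continuous_const).sub m.continuous

/-- The strain identities pass to the frontier of a piece by continuity; they are needed there, from
each side, for the tangential condition on the creases. -/
theorem isometry_β_closure (h : IsBendingSystem P b β ζ B B' Z Ω τ k m) (i : P.ι) {q : Par}
    (hq : q ∈ closure (P.piece i)) (u v : Par) :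
    inner ℝ (B i q u) (B' i q v) + inner ℝ (B i q v) (B' i q u) = (0 : ℝ) := by
  have hB : ∀ v, ContinuousOn (fun x => B i x v) (closure (P.piece i)) :=
    fun v => (h.pw_b.continuousOn i).clm_apply continuousOn_const
  have hB' : ∀ v, ContinuousOn (fun x => B' i x v) (closure (P.piece i)) :=
    fun v => (h.pw_β.continuousOn i).clm_apply continuousOn_const
  have : EqOn (fun q => (inner ℝ (B i q u) (B' i q v) + inner ℝ (B i q v) (B' i q u) : ℝ))
      (fun _ => 0) (P.piece i) := fun q hq => h.isometry_β i q hq u v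
  exact this.of_subset_closure (((hB u).inner (hB' v)).add ((hB v).inner (hB' u)))
    continuousOn_const subset_closure subset_rfl hq

theorem isometry_slow_closure (h : IsBendingSystem P b β ζ B B' Z Ω τ k m) (i : P.ι) {q : Par}
    (hq : q ∈ closure (P.piece i)) (u v : Par) :
    inner ℝ (B i q u) (slowForm b β Ω τ k m q v + Z i q v)
      + inner ℝ (B i q v) (slowForm b β Ω τ k m q u + Z i q u) = (0 : ℝ) := by
  have hB : ∀ v, ContinuousOn (fun x => B i x v) (closure (P.piece i)) :=
    fun v => (h.pw_b.continuousOn i).clm_apply continuousOn_const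
  have hW : ∀ v, ContinuousOn (fun x => slowForm b β Ω τ k m x v + Z i x v)
      (closure (P.piece i)) := fun v =>
    (h.continuous_slowForm.continuousOn.clm_apply continuousOn_const).add
      ((h.pw_ζ.continuousOn i).clm_apply continuousOn_const)
  have : EqOn (fun q => (inner ℝ (B i q u) (slowForm b β Ω τ k m q v + Z i q v)
      + inner ℝ (B i q v) (slowForm b β Ω τ k m q u + Z i q u) : ℝ))
      (fun _ => 0) (P.piece i) := fun q hq => h.isometry_slow i q hq u v
  exact this.of_subset_closure (((hB u).inner (hW v)).add ((hB v).inner (hW u)))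
    continuousOn_const subset_closure subset_rfl hq

theorem fderiv_eq (h : IsBendingSystem P b β ζ B B' Z Ω τ k m) {i : P.ι} {q : Par}
    (hq : q ∈ P.piece i) : fderiv ℝ b q = B i q ∧ fderiv ℝ β q = B' i q ∧ fderiv ℝ ζ q = Z i q :=
  ⟨(h.pw_b.hasFDerivAt i q hq).fderiv, (h.pw_β.hasFDerivAt i q hq).fderiv,
    (h.pw_ζ.hasFDerivAt i q hq).fderiv⟩

theorem differentiableAt_fderiv {f : Par → E3} {q : Par} (h : ContDiffAt ℝ 2 f q) :
    DifferentiableAt ℝ (fderiv ℝ f) q :=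
  (h.fderiv_right (m := 1) (by norm_num)).differentiableAt (by simp)

theorem differentiableAt_rot (h : IsBendingSystem P b β ζ B B' Z Ω τ k m) {i : P.ι} {q : Par}
    (hq : q ∈ P.piece i) : DifferentiableAt ℝ (fun q => rot (fderiv ℝ b q) (fderiv ℝ β q)) q := by
  refine CreasedSurface.differentiableAt_rot (differentiableAt_fderiv (h.cd_b i q hq))
    (differentiableAt_fderiv (h.cd_β i q hq)) ?_
  rw [(h.fderiv_eq hq).1]
  exact h.cross_ne_zero i q (subset_closure hq)

theorem cross_rot_eq (h : IsBendingSystem P b β ζ B B' Z Ω τ k m) {i : P.ι} {q : Par}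
    (hq : q ∈ P.piece i) (v : Par) :
    cross (rot (fderiv ℝ b q) (fderiv ℝ β q)) (fderiv ℝ b q v) = fderiv ℝ β q v := by
  obtain ⟨h1, h2, -⟩ := h.fderiv_eq hq
  rw [h1, h2]
  exact cross_rot (h.cross_ne_zero i q (subset_closure hq)) (h.isometry_β i q hq) v

theorem hasFDerivAt_slowForm (h : IsBendingSystem P b β ζ B B' Z Ω τ k m) {i : P.ι} {q : Par}
    (hq : q ∈ P.piece i) (v : Par) : HasFDerivAt (fun q => slowForm b β Ω τ k m q v)
      ((cross (Ω v)).comp (fderiv ℝ b q) + τ v • fderiv ℝ β q - m.flip v) q := by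
  have hb : HasFDerivAt b (fderiv ℝ b q) q := (h.pw_b.hasFDerivAt i q hq).differentiableAt.hasFDerivAt
  have hβ : HasFDerivAt β (fderiv ℝ β q) q := (h.pw_β.hasFDerivAt i q hq).differentiableAt.hasFDerivAt
  simp only [slowForm_apply]
  exact ((((cross (Ω v)).hasFDerivAt.comp q hb).add (hβ.const_smul (τ v))).add_const (k v)).sub
    (m.flip v).hasFDerivAt

/-- Differentiation of the identity `w × b_v = β_v`. -/
theorem cross_fderiv_rot_symm (h : IsBendingSystem P b β ζ B B' Z Ω τ k m) {i : P.ι} {q : Par}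
    (hq : q ∈ P.piece i) (u v : Par) :
    cross (fderiv ℝ (fun q => rot (fderiv ℝ b q) (fderiv ℝ β q)) q u) (fderiv ℝ b q v)
      = cross (fderiv ℝ (fun q => rot (fderiv ℝ b q) (fderiv ℝ β q)) q v) (fderiv ℝ b q u) := by
  set w := fun q => rot (fderiv ℝ b q) (fderiv ℝ β q)
  have hw : HasFDerivAt w (fderiv ℝ w q) q := (h.differentiableAt_rot hq).hasFDerivAt
  have hb := (differentiableAt_fderiv (h.cd_b i q hq)).hasFDerivAt
  have hβ := (differentiableAt_fderiv (h.cd_β i q hq)).hasFDerivAt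
  have key : ∀ u v, cross (fderiv ℝ w q u) (fderiv ℝ b q v)
      = fderiv ℝ (fderiv ℝ β) q u v - cross (w q) (fderiv ℝ (fderiv ℝ b) q u v) := by
    intro u v
    have h1 := (cross.hasFDerivAt.comp q hw).clm_apply (hb.clm_apply (hasFDerivAt_const v q))
    have h2 : HasFDerivAt (fun x => fderiv ℝ β x v) _ q := hβ.clm_apply (hasFDerivAt_const v q)
    have h3 := h1.unique (h2.congr_of_eventuallyEq (by
      filter_upwards [(P.isOpen_piece i).mem_nhds hq] with x hx using h.cross_rot_eq hx v))
    have h4 := congrArg (fun L => L u) h3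
    simp at h4
    rw [← h4]; abel
  have s1 : fderiv ℝ (fderiv ℝ b) q u v = fderiv ℝ (fderiv ℝ b) q v u :=
    ((h.cd_b i q hq).isSymmSndFDerivAt (by simp)) u v
  have s2 : fderiv ℝ (fderiv ℝ β) q u v = fderiv ℝ (fderiv ℝ β) q v u :=
    ((h.cd_β i q hq).isSymmSndFDerivAt (by simp)) u v
  rw [key, key, s1, s2]

/-- The closed form of a bending system: `η v = ⟨w, slowForm v + ζ_v⟩ + ⟨Ω v, β⟩` where `w` is the
rotation field of `β`. -/
theorem isClosedForm (h : IsBendingSystem P b β ζ B B' Z Ω τ k m) :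
    IsClosedForm P
      (fun q => dualForm (rot (fderiv ℝ b q) (fderiv ℝ β q))
        (slowForm b β Ω τ k m q + fderiv ℝ ζ q) (β q) Ω)
      (fun i q => dualForm (rot (B i q) (B' i q)) (slowForm b β Ω τ k m q + Z i q) (β q) Ω) := by
  have hdiff : ∀ i, ∀ q ∈ P.piece i, DifferentiableAt ℝ (fun q =>
      dualForm (rot (fderiv ℝ b q) (fderiv ℝ β q))
        (slowForm b β Ω τ k m q + fderiv ℝ ζ q) (β q) Ω) q := by
    intro i q hq
    unfold dualForm
    have h1 : DifferentiableAt ℝ (slowForm b β Ω τ k m) q := by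
      unfold slowForm
      have hb := (h.pw_b.hasFDerivAt i q hq).differentiableAt
      have hβ := (h.pw_β.hasFDerivAt i q hq).differentiableAt
      have h3 : DifferentiableAt ℝ (fun q => (cross.flip (b q)).comp Ω) q :=
        (cross.flip.differentiableAt.comp q hb).clm_comp (differentiableAt_const _)
      have h4 : DifferentiableAt ℝ (fun q => τ.smulRight (β q)) q :=
        (ContinuousLinearMap.smulRightL ℝ Par E3 τ).differentiableAt.comp q hβ
      exact ((h3.add h4).add (differentiableAt_const _)).sub m.differentiableAt
    have h2 := differentiableAt_fderiv (h.cd_ζ i q hq)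
    have h5 : DifferentiableAt ℝ (fun q => innerSL ℝ (rot (fderiv ℝ b q) (fderiv ℝ β q))) q :=
      (innerSL ℝ : E3 →L[ℝ] E3 →L[ℝ] ℝ).differentiableAt.comp q (h.differentiableAt_rot hq)
    have h6 : DifferentiableAt ℝ (fun q => innerSL ℝ (β q)) q :=
      (innerSL ℝ : E3 →L[ℝ] E3 →L[ℝ] ℝ).differentiableAt.comp q
        (h.pw_β.hasFDerivAt i q hq).differentiableAt
    exact (h5.clm_comp (h1.add h2)).add (h6.clm_comp (differentiableAt_const Ω))
  refine ⟨fun i q hq => ?_, fun i => ?_, hdiff, fun i q hq => ?_, fun i j s₀ δ Φ hc s hs => ?_⟩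
  · obtain ⟨h1, h2, h3⟩ := h.fderiv_eq hq
    simp only [h1, h2, h3]
  · unfold dualForm
    have h1 := continuousOn_rot (h.pw_b.continuousOn i) (h.pw_β.continuousOn i) (h.cross_ne_zero i)
    have h2 : ContinuousOn (fun q => innerSL ℝ (rot (B i q) (B' i q))) (closure (P.piece i)) :=
      (innerSL ℝ : E3 →L[ℝ] E3 →L[ℝ] ℝ).continuous.comp_continuousOn h1
    have h3 : Continuous (fun q => innerSL ℝ (β q)) :=
      (innerSL ℝ : E3 →L[ℝ] E3 →L[ℝ] ℝ).continuous.comp h.pw_β.continuous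
    exact (h2.clm_comp (h.continuous_slowForm.continuousOn.add (h.pw_ζ.continuousOn i))).add
      (h3.continuousOn.clm_comp continuousOn_const)
  · set w := fun q => rot (fderiv ℝ b q) (fderiv ℝ β q) with hwdef
    set W := slowForm b β Ω τ k m q + fderiv ℝ ζ q with hW
    have hw : HasFDerivAt w (fderiv ℝ w q) q := (h.differentiableAt_rot hq).hasFDerivAt
    have hζ := (differentiableAt_fderiv (h.cd_ζ i q hq)).hasFDerivAt
    have hβ : HasFDerivAt β (fderiv ℝ β q) q :=
      (h.pw_β.hasFDerivAt i q hq).differentiableAt.hasFDerivAt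
    -- Two cancellations occur. The term ⟨w, Ω v × b_u⟩ = -⟨Ω v, w × b_u⟩ = -⟨Ω v, β_u⟩ is
    -- compensated by the derivative of ⟨Ω v, β⟩, which is why that term belongs to the form; and
    -- ⟨w, β_u⟩ = 0 because β_u = w × b_u removes the term in τ.
    have key : ∀ u v, fderiv ℝ (fun q => dualForm (w q) (slowForm b β Ω τ k m q + fderiv ℝ ζ q)
        (β q) Ω) q u v = inner ℝ (fderiv ℝ w q u) (W v) - inner ℝ (w q) (m u v)
          + inner ℝ (w q) (fderiv ℝ (fderiv ℝ ζ) q u v) := by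
      intro u v
      have h1 := (hw.inner ℝ ((h.hasFDerivAt_slowForm hq v).add
        (hζ.clm_apply (hasFDerivAt_const v q)))).add (hβ.inner ℝ (hasFDerivAt_const (Ω v) q))
      have h2 : HasFDerivAt (fun x => dualForm (w x) (slowForm b β Ω τ k m x + fderiv ℝ ζ x)
        (β x) Ω v) _ q := (hdiff i q hq).hasFDerivAt.clm_apply (hasFDerivAt_const v q)
      have h3 := h2.unique (h1.congr_of_eventuallyEq (Eventually.of_forall fun x => by simp))
      have h4 := congrArg (fun L => L u) h3
      simp at h4
      rw [hwdef] at h4 ⊢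
      simp only at h4 ⊢
      rw [h4]
      have e1 := h.cross_rot_eq hq u
      have e2 : inner ℝ (w q) (cross (Ω v) (fderiv ℝ b q u))
          = (- inner ℝ (fderiv ℝ β q u) (Ω v) : ℝ) := by
        rw [inner_cross_swap, hwdef]; simp only; rw [e1, real_inner_comm]
      have e3 : inner ℝ (w q) (fderiv ℝ β q u) = (0 : ℝ) := by
        rw [← e1]; exact inner_cross_left _ _
      simp only [hwdef] at e2 e3
      simp only [inner_add_right, inner_sub_right, inner_smul_right, e2, e3, hW, add_apply,
        slowForm_apply]
      ring
    have hζs : ∀ u v, fderiv ℝ (fderiv ℝ ζ) q u v = fderiv ℝ (fderiv ℝ ζ) q v u :=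
      (h.cd_ζ i q hq).isSymmSndFDerivAt (by simp)
    intro u v
    -- W is an infinitesimal isometry too, hence W v = ρ × b_v for some ρ, and ⟨w_u, W v⟩ = -⟨ρ, w_u
    -- × b_v⟩ is symmetric in u and v.
    have hWc : ∀ v, W v = cross (rot (fderiv ℝ b q) W) (fderiv ℝ b q v) := by
      intro v
      obtain ⟨h1, h2, h3⟩ := h.fderiv_eq hq
      rw [h1, cross_rot (h.cross_ne_zero i q (subset_closure hq))]
      intro u v
      have := h.isometry_slow i q hq u v
      rw [hW, h3]
      exact this
    rw [key, key, h.m_symm u v, hζs u v, hWc u, hWc v, inner_cross_swap,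
      inner_cross_swap _ _ (fderiv ℝ b q u),
      h.cross_fderiv_rot_symm hq u v]
  · have hcu := (tendsto_chart_side hc (zero_mem_closure_upper hc.pos) hc.upper hs).1
    have hcl := (tendsto_chart_side hc (zero_mem_closure_lower hc.pos) hc.lower hs).1
    have t1 := h.pw_b.tangential_eq hc hs
    have t2 := h.pw_β.tangential_eq hc hs
    have t3 := h.pw_ζ.tangential_eq hc hs
    have hT := hc.tangent_ne_zero s hs
    set q := Φ (s, 0)
    set T := fderiv ℝ Φ (s, 0) e₀
    have r1 := cross_rot (h.cross_ne_zero i q hcu) (h.isometry_β_closure i hcu) T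
    have r2 := cross_rot (h.cross_ne_zero j q hcl) (h.isometry_β_closure j hcl) T
    have hne : B i q T ≠ 0 := by
      intro h0
      have hc0 := h.cross_ne_zero i q hcu
      rw [map_par (B i q) T] at h0
      apply hT
      have h1 : T.1 • cross (B i q e₀) (B i q e₁) = 0 := by
        have := congrArg (fun X => cross X (B i q e₁)) h0
        simpa [cross_self] using this
      have h2 : T.2 • cross (B i q e₀) (B i q e₁) = 0 := by
        have := congrArg (fun X => cross (B i q e₀) X) h0
        simpa [cross_self] using this
      exact Prod.ext ((smul_eq_zero.1 h1).resolve_right hc0) ((smul_eq_zero.1 h2).resolve_right hc0)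
    -- Both rotation fields turn b_T into β_T, and neither b_T nor β_T jumps across the crease. The
    -- jump of the rotation is thus a multiple of b_T, which is orthogonal to the tangential value
    -- of slowForm + dζ.
    have hcr : cross (rot (B i q) (B' i q) - rot (B j q) (B' j q)) (B i q T) = 0 := by
      rw [map_sub, sub_apply, r1, t2, ← r2, t1, sub_self]
    obtain ⟨r, hr⟩ := exists_smul_of_cross_eq_zero hne hcr
    have hz : inner ℝ (B i q T) (slowForm b β Ω τ k m q T + Z i q T) = (0 : ℝ) := by
      linarith [h.isometry_slow_closure i hcu T T]
    have hd : inner ℝ (rot (B i q) (B' i q)) (slowForm b β Ω τ k m q T + Z i q T)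
        = (inner ℝ (rot (B j q) (B' j q)) (slowForm b β Ω τ k m q T + Z i q T) : ℝ) := by
      rw [← sub_eq_zero, ← inner_sub_left, hr, inner_smul_left, hz, mul_zero]
    simp only [dualForm_apply, add_apply]
    rw [hd, t3]

end IsBendingSystem

/-! ### Periodicity and reciprocity -/

/-- The vectors of the period lattice. -/
noncomputable def lattice (a c : ℝ) (n : ℤ × ℤ) : Par := (n.1 * a, n.2 * c)

/-- The local bounds are made uniform on the compact cell and carried to the plane by periodicity.
The pieces are not assumed to be invariant under the lattice, and the bounds hold on the pieces
only. -/
theorem ae_bound_of_periodic {P : CreasePattern univ} {a c : ℝ} (ha : 0 < a) (hc : 0 < c)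
    {F : Type*} [NormedAddCommGroup F] {G : Par → F}
    (hper : ∀ n q, G (q + lattice a c n) = G q)
    (hloc : ∀ q₀, ∃ M : ℝ, ∀ᶠ q in 𝓝 q₀, ∀ i, q ∈ P.piece i → ‖G q‖ ≤ M) :
    ∃ M : ℝ, ∀ᵐ q, ‖G q‖ ≤ M := by
  choose M hM using hloc
  have hK : IsCompact (Icc (0 : ℝ) a ×ˢ Icc (0 : ℝ) c) := isCompact_Icc.prod isCompact_Icc
  obtain ⟨t, -, ht⟩ := hK.elim_nhds_subcover _ fun q _ => hM q
  refine ⟨∑ q ∈ t, |M q|, ?_⟩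
  -- Almost every point has all of its lattice translates inside pieces, the lattice being
  -- countable.
  have hae : ∀ᵐ q : Par, ∀ n : ℤ × ℤ, ∃ i, q + lattice a c n ∈ P.piece i :=
    ae_all_iff.2 fun n =>
      (measurePreserving_add_right volume (lattice a c n)).quasiMeasurePreserving.ae P.ae_mem_piece
  filter_upwards [hae] with q hq
  let n : ℤ × ℤ := (-⌊q.1 / a⌋, -⌊q.2 / c⌋)
  obtain ⟨i, hi⟩ := hq n
  have hmem : q + lattice a c n ∈ Icc (0 : ℝ) a ×ˢ Icc (0 : ℝ) c := by
    have h1 := Int.floor_le (q.1 / a)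
    have h2 := (Int.lt_floor_add_one (q.1 / a)).le
    have h3 := Int.floor_le (q.2 / c)
    have h4 := (Int.lt_floor_add_one (q.2 / c)).le
    rw [le_div_iff₀ ha] at h1
    rw [le_div_iff₀ hc] at h3
    rw [div_le_iff₀ ha] at h2
    rw [div_le_iff₀ hc] at h4
    refine ⟨⟨?_, ?_⟩, ?_, ?_⟩ <;> simp [lattice, n] <;> linarith
  obtain ⟨x, hx, hxq⟩ := mem_iUnion₂.1 (ht hmem)
  rw [← hper n q]
  exact (hxq i hi).trans ((le_abs_self _).trans
    (Finset.single_le_sum (f := fun q => |M q|) (fun _ _ => abs_nonneg _) hx))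

/-- Reciprocity between the curvature of the rotations of a bending system and the strain of its
infinitesimal isometry. -/
theorem IsBendingSystem.reciprocity {P : CreasePattern univ} {b β ζ : Par → E3}
    {B B' Z : P.ι → Par → Par →L[ℝ] E3}
    {Ω : Par →L[ℝ] E3} {τ : Par →L[ℝ] ℝ} {k : Par →L[ℝ] E3} {m : Par →L[ℝ] Par →L[ℝ] E3}
    (h : IsBendingSystem P b β ζ B B' Z Ω τ k m) {a c : ℝ} (ha : 0 < a) (hc : 0 < c)
    (hb : ∀ n q, fderiv ℝ b (q + lattice a c n) = fderiv ℝ b q)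
    (hβ : ∀ n q, fderiv ℝ β (q + lattice a c n) = fderiv ℝ β q)
    (hζ : ∀ n q, fderiv ℝ ζ (q + lattice a c n) = fderiv ℝ ζ q)
    (hs : ∀ n q, slowForm b β Ω τ k m (q + lattice a c n) = slowForm b β Ω τ k m q)
    (p' : Par →L[ℝ] E3)
    (hp : ∀ n q, β (q + lattice a c n) - p' (q + lattice a c n) = β q - p' q) :
    inner ℝ (Ω e₀) (p' e₁) = (inner ℝ (Ω e₁) (p' e₀) : ℝ) := by
  have hη := h.isClosedForm
  set η := fun q => dualForm (rot (fderiv ℝ b q) (fderiv ℝ β q))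
    (slowForm b β Ω τ k m q + fderiv ℝ ζ q) (β q) Ω with hηdef
  -- The rotation field, `slowForm` and dζ are periodic, and β is p' plus a periodic map; so the
  -- non-periodic part of η is ⟨p' q, Ω v⟩.
  let L : Par →L[ℝ] Par →L[ℝ] ℝ :=
    ((ContinuousLinearMap.compL ℝ Par E3 ℝ).flip Ω).comp ((innerSL ℝ).comp p')
  have hL : ∀ q v, L q v = inner ℝ (p' q) (Ω v) := fun q v => by simp [L]
  have hG : ∀ q, η q - L q = dualForm (rot (fderiv ℝ b q) (fderiv ℝ β q))
      (slowForm b β Ω τ k m q + fderiv ℝ ζ q) (β q - p' q) Ω := by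
    intro q
    apply ContinuousLinearMap.ext
    intro v
    rw [sub_apply, hL, hηdef]
    simp only [dualForm_apply, inner_sub_left]
    ring
  obtain ⟨M, hM⟩ := ae_bound_of_periodic (P := P) (G := fun q => η q - L q) ha hc
    (fun n q => by rw [hG, hG, hb, hβ, hζ, hs, hp]) (fun q₀ => by
      obtain ⟨M, hM⟩ := hη.eventually_norm_le q₀
      refine ⟨M + (‖L q₀‖ + 1), ?_⟩
      filter_upwards [hM, L.continuous.norm.continuousAt.eventually
        (gt_mem_nhds (lt_add_one ‖L q₀‖))] with q hq hq' i hi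
      exact (norm_sub_le _ _).trans (add_le_add (hq i hi) hq'.le))
  have := hη.linear_part_symm L hM
  rw [hL, hL] at this
  rw [real_inner_comm, ← this, real_inner_comm]


/-! ### Differentiation of families with respect to the parameter -/

theorem uniqueDiffOn_of_ordConnected {J : Set ℝ} (hJ : J.OrdConnected) (hJ' : J.Nontrivial) :
    UniqueDiffOn ℝ J := by
  obtain ⟨x, hx, y, hy, hxy⟩ := hJ'.exists_lt
  refine uniqueDiffOn_convex hJ.convex ⟨(x + y) / 2, ?_⟩
  exact mem_interior.2 ⟨Ioo x y, (Ioo_subset_Icc_self).trans (hJ.out hx hy), isOpen_Ioo,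
    by constructor <;> linarith⟩

section Family

variable {F : Type*} [NormedAddCommGroup F] [NormedSpace ℝ F] {J : Set ℝ} {S : Set Par}
  {f : ℝ → Par → F} {h : ℝ × Par → F}

/-- Uniform differentiability in the parameter `t` of a `C¹` family, up to the boundary of `S`. -/
theorem eventually_norm_sub_le (hJ : J.OrdConnected)
    (hc : ContinuousOn h (J ×ˢ closure S))
    (hd : ∀ t ∈ J, ∀ q ∈ S, HasDerivWithinAt (fun s => f s q) (h (t, q)) J t)
    {t : ℝ} (ht : t ∈ J) {q₀ : Par} (hq₀ : q₀ ∈ closure S) {ε : ℝ} (hε : 0 < ε) :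
    ∃ δ > 0, ∀ q ∈ S, dist q q₀ < δ → ∀ s ∈ J, dist s t < δ →
      ‖f s q - f t q - (s - t) • h (t, q₀)‖ ≤ ε * ‖s - t‖ := by
  obtain ⟨δ, hδ, hδh⟩ := Metric.continuousOn_iff.1 hc (t, q₀) ⟨ht, hq₀⟩ ε hε
  refine ⟨δ, hδ, fun q hq hqd s hs hsd => ?_⟩
  have hconv : Convex ℝ (J ∩ Metric.ball t δ) := hJ.convex.inter (convex_ball t δ)
  have := hconv.norm_image_sub_le_of_norm_hasDerivWithin_le
    (f := fun s => f s q - s • h (t, q₀)) (f' := fun s => h (s, q) - (1 : ℝ) • h (t, q₀)) (C := ε)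
    (fun x hx => ((hd x hx.1 q hq).mono inter_subset_left).sub
      ((hasDerivWithinAt_id x _).smul_const _)) (fun x hx => by
      have h1 : dist ((x, q) : ℝ × Par) (t, q₀) < δ := by
        rw [Prod.dist_eq]; exact max_lt hx.2 hqd
      have h2 := hδh (x, q) ⟨hx.1, subset_closure hq⟩ h1
      rw [dist_eq_norm] at h2
      simpa using h2.le) ⟨ht, Metric.mem_ball_self hδ⟩ ⟨hs, hsd⟩
  convert this using 2
  simp only [sub_smul]; abel

/-- Differentiability in the parameter holds on the boundary of `S`, for continuous maps. -/
theorem hasDerivWithinAt_closure (hJ : J.OrdConnected)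
    (hc : ContinuousOn h (J ×ˢ closure S))
    (hd : ∀ t ∈ J, ∀ q ∈ S, HasDerivWithinAt (fun s => f s q) (h (t, q)) J t)
    (hf : ∀ t ∈ J, Continuous (f t)) {t : ℝ} (ht : t ∈ J) {q₀ : Par} (hq₀ : q₀ ∈ closure S) :
    HasDerivWithinAt (fun s => f s q₀) (h (t, q₀)) J t := by
  rw [hasDerivWithinAt_iff_isLittleO, Asymptotics.isLittleO_iff]
  intro ε hε
  obtain ⟨δ, hδ, hb⟩ := eventually_norm_sub_le hJ hc hd ht hq₀ hε
  have hne : (𝓝[S] q₀).NeBot := mem_closure_iff_nhdsWithin_neBot.1 hq₀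
  filter_upwards [self_mem_nhdsWithin, mem_nhdsWithin_of_mem_nhds (Metric.ball_mem_nhds t hδ)]
    with s hs hsd
  have hlim : Tendsto (fun q => ‖f s q - f t q - (s - t) • h (t, q₀)‖) (𝓝[S] q₀)
      (𝓝 ‖f s q₀ - f t q₀ - (s - t) • h (t, q₀)‖) :=
    ((((hf s hs).tendsto q₀).sub ((hf t ht).tendsto q₀)).sub_const _).norm.mono_left
      nhdsWithin_le_nhds
  refine le_of_tendsto hlim ?_
  filter_upwards [self_mem_nhdsWithin,
    mem_nhdsWithin_of_mem_nhds (Metric.ball_mem_nhds q₀ hδ)] with q hq hqd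
  exact hb q hq hqd s hs hsd

/-- Exchange of the derivative in the parameter `t` with the derivative in `q`. -/
theorem hasFDerivAt_param {f' : ℝ → Par → Par →L[ℝ] F} {h' : ℝ × Par → Par →L[ℝ] F}
    (hJ : J.OrdConnected) (hJ' : J.Nontrivial) (hS : IsOpen S)
    (hd : ∀ t ∈ J, ∀ q ∈ S, HasDerivWithinAt (fun s => f s q) (h (t, q)) J t)
    (hf : ∀ t ∈ J, ∀ q ∈ S, HasFDerivAt (f t) (f' t q) q)
    (hc' : ContinuousOn h' (J ×ˢ closure S))
    (hd' : ∀ t ∈ J, ∀ q ∈ S, HasDerivWithinAt (fun s => f' s q) (h' (t, q)) J t)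
    {t : ℝ} (ht : t ∈ J) {q₀ : Par} (hq₀ : q₀ ∈ S) :
    HasFDerivAt (fun q => h (t, q)) (h' (t, q₀)) q₀ := by
  -- Difference quotients are taken inside J, of which t may be an end point.
  have hne : (𝓝[J \ {t}] t).NeBot := by
    have := (uniqueDiffOn_of_ordConnected hJ hJ') t ht
    rw [uniqueDiffWithinAt_iff_accPt] at this
    rwa [accPt_principal_iff_nhdsWithin] at this
  -- The difference quotients in t converge to the velocity, and their q-derivatives converge
  -- uniformly near q₀: the limit may be differentiated.
  refine hasFDerivAt_of_tendstoUniformlyOnFilter (𝕜 := ℝ) (l := 𝓝[J \ {t}] t)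
    (f := fun s q => (s - t)⁻¹ • (f s q - f t q))
    (f' := fun s q => (s - t)⁻¹ • (f' s q - f' t q)) (g' := fun q => h' (t, q)) ?_ ?_ ?_
  · rw [Metric.tendstoUniformlyOnFilter_iff]
    intro ε hε
    obtain ⟨δ, hδ, hb⟩ := eventually_norm_sub_le hJ hc' hd' ht (subset_closure hq₀)
      (show 0 < ε / 3 by linarith)
    have hcont : ContinuousAt (fun q => h' (t, q)) q₀ := by
      have h1 : ContinuousOn (fun q => h' (t, q)) (closure S) :=
        hc'.comp (by fun_prop) fun q hq => ⟨ht, hq⟩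
      exact (h1.mono subset_closure).continuousAt (hS.mem_nhds hq₀)
    have e1 : ∀ᶠ q in 𝓝 q₀, q ∈ S ∧ dist q q₀ < δ ∧ dist (h' (t, q)) (h' (t, q₀)) < ε / 3 := by
      filter_upwards [hS.mem_nhds hq₀, Metric.ball_mem_nhds q₀ hδ,
        Metric.continuousAt_iff'.1 hcont (ε / 3) (by linarith)] with q a b c using ⟨a, b, c⟩
    have e2 : ∀ᶠ s in 𝓝[J \ {t}] t, s ∈ J ∧ s ≠ t ∧ dist s t < δ := by
      filter_upwards [self_mem_nhdsWithin,
        mem_nhdsWithin_of_mem_nhds (Metric.ball_mem_nhds t hδ)] with s a b using ⟨a.1, a.2, b⟩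
    filter_upwards [e2.prod_mk e1] with ⟨s, q⟩ ⟨⟨hs, hst, hsd⟩, hq, hqd, hqc⟩
    have h1 := hb q hq hqd s hs hsd
    have hst' : 0 < ‖s - t‖ := norm_pos_iff.2 (sub_ne_zero.2 hst)
    have h2 : ‖(s - t)⁻¹ • (f' s q - f' t q) - h' (t, q₀)‖ ≤ ε / 3 := by
      have h3 : (s - t)⁻¹ • (f' s q - f' t q) - h' (t, q₀)
          = (s - t)⁻¹ • (f' s q - f' t q - (s - t) • h' (t, q₀)) := by
        rw [smul_sub _ _ ((s - t) • _), smul_smul, inv_mul_cancel₀ (sub_ne_zero.2 hst), one_smul]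
      rw [h3, norm_smul, norm_inv, inv_mul_le_iff₀ hst']
      linarith
    have h4 := dist_triangle (h' (t, q)) (h' (t, q₀)) ((s - t)⁻¹ • (f' s q - f' t q))
    rw [dist_comm (h' (t, q₀)), dist_eq_norm ((s - t)⁻¹ • _)] at h4
    simp only
    linarith
  · have e1 : ∀ᶠ q in 𝓝 q₀, q ∈ S := hS.mem_nhds hq₀
    have e2 : ∀ᶠ s in 𝓝[J \ {t}] t, s ∈ J := by
      filter_upwards [self_mem_nhdsWithin] with s a using a.1
    filter_upwards [e2.prod_mk e1] with ⟨s, q⟩ ⟨hs, hq⟩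
    exact ((hf s hs q hq).sub (hf t ht q hq)).const_smul _
  · filter_upwards [hS.mem_nhds hq₀] with q hq
    have := hasDerivWithinAt_iff_tendsto_slope.1 (hd t ht q hq)
    exact this

end Family

section Extract

variable {P : CreasePattern univ} {J : Set ℝ} {b : ℝ → Par → E3}

theorem iteratedFDeriv_zero_toVector (f : Par → E3) (q : Par) :
    continuousMultilinearCurryFin0 ℝ Par E3 (iteratedFDeriv ℝ 0 f q) = f q := by
  simp

theorem iteratedFDeriv_one_toLinear (f : Par → E3) (q : Par) :
    continuousMultilinearCurryFin1 ℝ Par E3 (iteratedFDeriv ℝ 1 f q) = fderiv ℝ f q := by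
  apply ContinuousLinearMap.ext
  intro v
  simp [iteratedFDeriv_one_apply]

/-- Bilinear maps as two-step linear maps. -/
noncomputable def curryTwo :=
  (ContinuousLinearMap.compL ℝ Par _ _
    (continuousMultilinearCurryFin1 ℝ Par E3).toContinuousLinearEquiv.toContinuousLinearMap).comp
    (continuousMultilinearCurryLeftEquiv ℝ (fun _ : Fin 2 => Par)
      E3).toContinuousLinearEquiv.toContinuousLinearMap

theorem iteratedFDeriv_two_toBilinear (f : Par → E3) (q : Par) :
    curryTwo (iteratedFDeriv ℝ 2 f q) = fderiv ℝ (fderiv ℝ f) q := by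
  apply ContinuousLinearMap.ext
  intro u
  apply ContinuousLinearMap.ext
  intro v
  simp [curryTwo, iteratedFDeriv_two_apply]

/-- Orders 0, 1 and 2 suffice: they make the velocity C² inside the pieces, as required for its
rotation field to be differentiable. -/
theorem IsC1Family.exists_velocities (hb : IsC1Family P J b) (i : P.ι) :
    ∃ (h₀ : ℝ × Par → E3) (h₁ : ℝ × Par → Par →L[ℝ] E3) (h₂ : ℝ × Par → Par →L[ℝ] Par →L[ℝ] E3),
      ContinuousOn h₀ (J ×ˢ closure (P.piece i)) ∧ ContinuousOn h₁ (J ×ˢ closure (P.piece i)) ∧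
      ContinuousOn h₂ (J ×ˢ closure (P.piece i)) ∧
      ∀ t ∈ J, ∀ q ∈ P.piece i, HasDerivWithinAt (fun s => b s q) (h₀ (t, q)) J t ∧
        HasDerivWithinAt (fun s => fderiv ℝ (b s) q) (h₁ (t, q)) J t ∧
        HasDerivWithinAt (fun s => fderiv ℝ (fderiv ℝ (b s)) q) (h₂ (t, q)) J t := by
  obtain ⟨g0, h0, _, hc0, hd0⟩ := hb i 0
  obtain ⟨g1, h1, _, hc1, hd1⟩ := hb i 1
  obtain ⟨g2, h2, _, hc2, hd2⟩ := hb i 2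
  let L0 := (continuousMultilinearCurryFin0 ℝ Par E3).toContinuousLinearEquiv.toContinuousLinearMap
  let L1 := (continuousMultilinearCurryFin1 ℝ Par E3).toContinuousLinearEquiv.toContinuousLinearMap
  refine ⟨fun p => L0 (h0 p), fun p => L1 (h1 p), fun p => curryTwo (h2 p),
    L0.continuous.comp_continuousOn hc0, L1.continuous.comp_continuousOn hc1,
    curryTwo.continuous.comp_continuousOn hc2, fun t ht q hq => ⟨?_, ?_, ?_⟩⟩
  · have := L0.hasFDerivAt.comp_hasDerivWithinAt t (hd0 t ht q hq).2
    refine this.congr_of_mem (fun s _ => ?_) ht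
    exact (iteratedFDeriv_zero_toVector (b s) q).symm
  · have := L1.hasFDerivAt.comp_hasDerivWithinAt t (hd1 t ht q hq).2
    refine this.congr_of_mem (fun s _ => ?_) ht
    exact (iteratedFDeriv_one_toLinear (b s) q).symm
  · refine (hasDerivWithinAt_iff_tendsto_slope (𝕜 := ℝ) (F := Par →L[ℝ] Par →L[ℝ] E3)).2 ?_
    have h3 := (hasDerivWithinAt_iff_tendsto_slope (𝕜 := ℝ)
      (F := ContinuousMultilinearMap ℝ (fun _ : Fin 2 => Par) E3)).1 (hd2 t ht q hq).2
    have := (curryTwo.continuous.tendsto (h2 (t, q))).comp h3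
    refine this.congr fun s => ?_
    simp only [Function.comp_apply, slope_def_module, map_smul, map_sub,
      iteratedFDeriv_two_toBilinear]

end Extract

/-! ### Velocities, support vectors and effective strain of a mode -/

/-- The velocity of a family. -/
noncomputable def velocity (J : Set ℝ) (b : ℝ → Par → E3) (t : ℝ) (q : Par) : E3 :=
  derivWithin (fun s => b s q) J t

theorem IsCellPeriodic.add_lattice {a c : ℝ} {f : Par → E3} (h : IsCellPeriodic a c f)
    (n : ℤ × ℤ) (q : Par) : f (q + lattice a c n) = f q := by
  have h1 : ∀ v, Function.Periodic (fun u => f (u, v)) a := fun v u => (h (u, v)).1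
  have h2 : ∀ u, Function.Periodic (fun v => f (u, v)) c := fun u v => (h (u, v)).2
  have e1 := (h1 (q.2 + n.2 * c)).int_mul n.1 q.1
  have e2 := (h2 q.1).int_mul n.2 q.2
  exact e1.trans e2

/-- The linear map with prescribed values on the coordinate directions. -/
noncomputable def ofPair (p : Fin 2 → E3) : Par →L[ℝ] E3 :=
  (ContinuousLinearMap.fst ℝ ℝ ℝ).smulRight (p 0) + (ContinuousLinearMap.snd ℝ ℝ ℝ).smulRight (p 1)

@[simp] theorem ofPair_apply (p : Fin 2 → E3) (q : Par) : ofPair p q = q.1 • p 0 + q.2 • p 1 := by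
  simp [ofPair]

theorem IsPeriodicSurface.add_lattice {a c : ℝ} {P : CreasePattern univ} {p : Fin 2 → E3}
    {x : Par → E3} (h : IsPeriodicSurface a c P p x) (n : ℤ × ℤ) (q : Par) :
    x (q + lattice a c n) = x q + ofPair p (lattice a c n) := by
  obtain ⟨-, -, corr, -, hper, hx⟩ := h
  rw [hx, hx, hper.add_lattice]
  simp only [ofPair_apply, Prod.fst_add, Prod.snd_add, add_smul]
  abel

theorem fderiv_add_lattice {f : Par → E3} {l : Par} {v : E3} (h : ∀ q, f (q + l) = f q + v)
    (q : Par) : fderiv ℝ f (q + l) = fderiv ℝ f q := by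
  have h1 : fderiv ℝ (fun q => f (q + l)) q = fderiv ℝ f (q + l) := fderiv_comp_add_right l
  rw [← h1]
  simp_rw [h]
  exact fderiv_add_const v

theorem IsSurface.exists_pwC1 {P : CreasePattern univ} {f : Par → E3} (h : IsSurface P f) :
    ∃ B, PwC1 P f B ∧ ∀ i, ∀ q ∈ closure (P.piece i), cross (B i q e₀) (B i q e₁) ≠ 0 := by
  obtain ⟨⟨hc, hs⟩, hD⟩ := h
  choose B hBc hBe hBi using hD
  refine ⟨B, ⟨?_, fun i q hq => ?_, hBc⟩, fun i q hq => ?_⟩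
  · rwa [closure_univ, continuousOn_univ] at hc
  · rw [hBe i hq]
    exact (((hs i).1.contDiffAt ((P.isOpen_piece i).mem_nhds hq)).differentiableAt
      (by simp)).hasFDerivAt
  · have := hBi i q hq
    apply cross_ne_zero
    convert this using 1
    ext μ
    fin_cases μ <;> rfl

section Mode

variable {a c : ℝ} {P : CreasePattern univ} {x : Par → E3} {J : Set ℝ} {p : ℝ → Fin 2 → E3}
  {b : ℝ → Par → E3}

theorem IsMode.continuous (hb : IsMode a c P x J p b) {t : ℝ} (ht : t ∈ J) : Continuous (b t) := by
  have := (hb.2 t ht).1.1.1.1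
  rwa [closure_univ, continuousOn_univ] at this

theorem IsMode.contDiffAt (hb : IsMode a c P x J p b) {t : ℝ} (ht : t ∈ J) {i : P.ι} {q : Par}
    (hq : q ∈ P.piece i) : ContDiffAt ℝ ∞ (b t) q :=
  ((hb.2 t ht).1.1.1.2 i).1.contDiffAt ((P.isOpen_piece i).mem_nhds hq)

theorem IsMode.hasDerivWithinAt (hb : IsMode a c P x J p b) (hJ : J.OrdConnected)
    {t : ℝ} (ht : t ∈ J) (q : Par) :
    HasDerivWithinAt (fun s => b s q) (velocity J b t q) J t := by
  obtain ⟨i, hi⟩ := P.mem_closure_piece q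
  obtain ⟨h₀, _, _, hc, _, _, hd⟩ := hb.1.exists_velocities i
  have := hasDerivWithinAt_closure hJ hc (fun t ht q hq => (hd t ht q hq).1)
    (fun _ ht => hb.continuous ht) ht hi
  exact this.differentiableWithinAt.hasDerivWithinAt

theorem IsMode.velocity_eq (hb : IsMode a c P x J p b) (hJ : J.OrdConnected)
    (hJ' : J.Nontrivial) {i : P.ι} {h₀ : ℝ × Par → E3}
    (hc : ContinuousOn h₀ (J ×ˢ closure (P.piece i)))
    (hd : ∀ t ∈ J, ∀ q ∈ P.piece i, HasDerivWithinAt (fun s => b s q) (h₀ (t, q)) J t)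
    {t : ℝ} (ht : t ∈ J) {q : Par} (hq : q ∈ closure (P.piece i)) :
    velocity J b t q = h₀ (t, q) :=
  (hasDerivWithinAt_closure hJ hc hd (fun _ ht => hb.continuous ht) ht hq).derivWithin
    (uniqueDiffOn_of_ordConnected hJ hJ' t ht)

theorem IsMode.continuousOn_velocity (hb : IsMode a c P x J p b) (hJ : J.OrdConnected)
    (hJ' : J.Nontrivial) (q : Par) : ContinuousOn (fun t => velocity J b t q) J := by
  obtain ⟨i, hi⟩ := P.mem_closure_piece q
  obtain ⟨h₀, _, _, hc, _, _, hd⟩ := hb.1.exists_velocities i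
  have h1 : ContinuousOn (fun t => h₀ (t, q)) J := hc.comp (by fun_prop) fun t ht => ⟨ht, hi⟩
  exact h1.congr fun t ht => hb.velocity_eq hJ hJ' hc (fun t ht q hq => (hd t ht q hq).1) ht hi

/-- Exchange the derivative in t with the derivatives in q, twice inside each piece. Continuity
across the creases holds because the velocity is defined at every point and is continuous on each
set of a locally finite closed cover. -/
theorem IsMode.exists_pwC1_velocity (hb : IsMode a c P x J p b) (hJ : J.OrdConnected)
    (hJ' : J.Nontrivial) {t : ℝ} (ht : t ∈ J) :
    ∃ B', PwC1 P (velocity J b t) B' ∧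
      (∀ i, ∀ q ∈ P.piece i, ContDiffAt ℝ 2 (velocity J b t) q) ∧
      ∀ i, ∀ q ∈ P.piece i, HasDerivWithinAt (fun s => fderiv ℝ (b s) q) (B' i q) J t := by
  choose h₀ h₁ h₂ hc₀ hc₁ hc₂ hd using hb.1.exists_velocities
  have hv : ∀ i, ∀ q ∈ closure (P.piece i), velocity J b t q = h₀ i (t, q) := fun i q hq =>
    hb.velocity_eq hJ hJ' (hc₀ i) (fun t ht q hq => (hd i t ht q hq).1) ht hq
  have hcont : ∀ {F : Type} [TopologicalSpace F] {i : P.ι} {h : ℝ × Par → F},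
      ContinuousOn h (J ×ˢ closure (P.piece i)) →
      ContinuousOn (fun q => h (t, q)) (closure (P.piece i)) :=
    fun hc => hc.comp (by fun_prop) fun q hq => ⟨ht, hq⟩
  have f1 : ∀ i, ∀ q ∈ P.piece i, HasFDerivAt (velocity J b t) (h₁ i (t, q)) q := by
    intro i q hq
    have := hasFDerivAt_param hJ hJ' (P.isOpen_piece i) (fun t ht q hq => (hd i t ht q hq).1)
      (fun t ht q hq => ((hb.contDiffAt ht hq).differentiableAt (by simp)).hasFDerivAt)
      (hc₁ i) (fun t ht q hq => (hd i t ht q hq).2.1) ht hq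
    refine this.congr_of_eventuallyEq ?_
    filter_upwards [(P.isOpen_piece i).mem_nhds hq] with y hy using hv i y (subset_closure hy)
  have f2 : ∀ i, ∀ q ∈ P.piece i, HasFDerivAt (fun q => h₁ i (t, q)) (h₂ i (t, q)) q := by
    intro i q hq
    exact hasFDerivAt_param hJ hJ' (P.isOpen_piece i) (fun t ht q hq => (hd i t ht q hq).2.1)
      (fun t ht q hq => (((hb.contDiffAt ht hq).fderiv_right (m := 1)
        (by rw [one_add_one_eq_two]; exact two_le_infty)).differentiableAt (by simp)).hasFDerivAt)
      (hc₂ i) (fun t ht q hq => (hd i t ht q hq).2.2) ht hq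
  refine ⟨fun i q => h₁ i (t, q), ⟨?_, f1, fun i => hcont (hc₁ i)⟩, fun i q hq => ?_,
    fun i q hq => (hd i t ht q hq).2.1⟩
  · refine P.locallyFinite_piece.closure.continuous ?_ (fun i => isClosed_closure) fun i =>
      (hcont (hc₀ i)).congr (hv i)
    exact eq_univ_of_forall fun q => mem_iUnion.2 (P.mem_closure_piece q)
  · have ho := P.isOpen_piece i
    have c1 : ContDiffOn ℝ 1 (fun q => h₁ i (t, q)) (P.piece i) := by
      rw [show (1 : WithTop ℕ∞) = 0 + 1 by norm_num, contDiffOn_succ_iff_fderiv_of_isOpen ho]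
      refine ⟨fun q hq => (f2 i q hq).differentiableAt.differentiableWithinAt, by simp, ?_⟩
      rw [contDiffOn_zero]
      exact ((hcont (hc₂ i)).mono subset_closure).congr fun q hq => (f2 i q hq).fderiv
    have c2 : ContDiffOn ℝ 2 (velocity J b t) (P.piece i) := by
      rw [show (2 : WithTop ℕ∞) = 1 + 1 by norm_num, contDiffOn_succ_iff_fderiv_of_isOpen ho]
      exact ⟨fun q hq => (f1 i q hq).differentiableAt.differentiableWithinAt, by simp,
        c1.congr fun q hq => (f1 i q hq).fderiv⟩
    exact c2.contDiffAt (ho.mem_nhds hq)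

theorem IsMode.inner_fderiv_eq (hb : IsMode a c P x J p b) {q : Par} (hx : ContDiffAt ℝ ∞ x q)
    {t : ℝ} (ht : t ∈ J) (u v : Par) :
    (inner ℝ (fderiv ℝ (b t) q u) (fderiv ℝ (b t) q v) : ℝ)
      = inner ℝ (fderiv ℝ x q u) (fderiv ℝ x q v) := by
  have h : ∀ μ ν, _ := (hb.2 t ht).2.2 q hx
  have h00 := h 0 0
  have h01 := h 0 1
  have h10 := h 1 0
  have h11 := h 1 1
  simp only [metric, pd, dir, Matrix.cons_val_zero, Matrix.cons_val_one] at h00 h01 h10 h11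
  rw [map_par (fderiv ℝ (b t) q) u, map_par (fderiv ℝ (b t) q) v, map_par (fderiv ℝ x q) u,
    map_par (fderiv ℝ x q) v]
  simp only [inner_add_left, inner_add_right, inner_smul_left, inner_smul_right, h00, h01, h10, h11]

/-- All b s have the metric of x, so the t-derivative of the metric vanishes. -/
theorem IsMode.isometry_velocity (hb : IsMode a c P x J p b) (hJ : J.OrdConnected)
    (hJ' : J.Nontrivial) {t : ℝ} (ht : t ∈ J) {q : Par} (hx : ContDiffAt ℝ ∞ x q)
    {B' : Par →L[ℝ] E3} (hB' : HasDerivWithinAt (fun s => fderiv ℝ (b s) q) B' J t) (u v : Par) :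
    inner ℝ (fderiv ℝ (b t) q u) (B' v) + inner ℝ (fderiv ℝ (b t) q v) (B' u) = (0 : ℝ) := by
  have h1 : ∀ v, HasDerivWithinAt (fun s => fderiv ℝ (b s) q v) (B' v) J t := fun v => by
    have := hB'.clm_apply (hasDerivWithinAt_const t J v)
    simpa using this
  have h2 := (h1 u).inner ℝ (h1 v)
  have h3 : HasDerivWithinAt (fun s => (inner ℝ (fderiv ℝ (b s) q u) (fderiv ℝ (b s) q v) : ℝ))
      0 J t :=
    (hasDerivWithinAt_const t J (inner ℝ (fderiv ℝ x q u) (fderiv ℝ x q v) : ℝ)).congr_of_mem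
      (fun s hs => hb.inner_fderiv_eq hx hs u v) ht
  have h4 := (uniqueDiffOn_of_ordConnected hJ hJ' t ht).eq_deriv J h2 h3
  rw [real_inner_comm (fderiv ℝ (b t) q v)] at h4
  rw [← h4]

/-- The velocity of the support vectors. -/
noncomputable def supportVelocity (J : Set ℝ) (p : ℝ → Fin 2 → E3) (t : ℝ) (μ : Fin 2) : E3 :=
  derivWithin (fun s => p s μ) J t

/-- Regularity in t is assumed of b and not of p. The support vectors inherit it, being differences
of values of b at lattice points. -/
theorem IsMode.support_eq (hb : IsMode a c P x J p b) (ha : 0 < a) (hc : 0 < c) {t : ℝ}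
    (ht : t ∈ J) : p t 0 = a⁻¹ • (b t (lattice a c (1, 0)) - b t 0) ∧
      p t 1 = c⁻¹ • (b t (lattice a c (0, 1)) - b t 0) := by
  have h0 := (hb.2 t ht).1.add_lattice (1, 0) 0
  have h1 := (hb.2 t ht).1.add_lattice (0, 1) 0
  simp only [zero_add] at h0 h1
  rw [h0, h1]
  simp [lattice, smul_smul, ha.ne', hc.ne']

theorem IsMode.hasDerivWithinAt_support (hb : IsMode a c P x J p b) (ha : 0 < a) (hc : 0 < c)
    (hJ : J.OrdConnected) {t : ℝ} (ht : t ∈ J) (μ : Fin 2) :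
    HasDerivWithinAt (fun s => p s μ) (supportVelocity J p t μ) J t := by
  have hv := fun q => hb.hasDerivWithinAt hJ ht q
  suffices DifferentiableWithinAt ℝ (fun s => p s μ) J t from this.hasDerivWithinAt
  fin_cases μ
  · exact ((((hv _).sub (hv _)).const_smul a⁻¹).congr_of_mem
      (fun s hs => (hb.support_eq ha hc hs).1) ht).differentiableWithinAt
  · exact ((((hv _).sub (hv _)).const_smul c⁻¹).congr_of_mem
      (fun s hs => (hb.support_eq ha hc hs).2) ht).differentiableWithinAt

theorem IsMode.continuousOn_supportVelocity (hb : IsMode a c P x J p b) (ha : 0 < a) (hc : 0 < c)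
    (hJ : J.OrdConnected) (hJ' : J.Nontrivial) (μ : Fin 2) :
    ContinuousOn (fun t => supportVelocity J p t μ) J := by
  have hv := fun t ht q => hb.hasDerivWithinAt hJ (t := t) ht q
  have hvc := hb.continuousOn_velocity hJ hJ'
  have hu := uniqueDiffOn_of_ordConnected hJ hJ'
  fin_cases μ
  · refine (((hvc (lattice a c (1, 0))).sub (hvc 0)).const_smul a⁻¹).congr fun t ht => ?_
    exact ((((hv t ht _).sub (hv t ht _)).const_smul a⁻¹).congr_of_mem
      (fun s hs => (hb.support_eq ha hc hs).1) ht).derivWithin (hu t ht)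
  · refine (((hvc (lattice a c (0, 1))).sub (hvc 0)).const_smul c⁻¹).congr fun t ht => ?_
    exact ((((hv t ht _).sub (hv t ht _)).const_smul c⁻¹).congr_of_mem
      (fun s hs => (hb.support_eq ha hc hs).2) ht).derivWithin (hu t ht)

theorem IsMode.velocity_add_lattice (hb : IsMode a c P x J p b) (ha : 0 < a) (hc : 0 < c)
    (hJ : J.OrdConnected) (hJ' : J.Nontrivial) {t : ℝ} (ht : t ∈ J) (n : ℤ × ℤ) (q : Par) :
    velocity J b t (q + lattice a c n)
      = velocity J b t q + ofPair (supportVelocity J p t) (lattice a c n) := by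
  have h1 := hb.hasDerivWithinAt hJ ht (q + lattice a c n)
  have hp := hb.hasDerivWithinAt_support ha hc hJ ht
  have h2 : HasDerivWithinAt (fun s => b s q + ((lattice a c n).1 • p s 0 + (lattice a c n).2 • p s 1))
      (velocity J b t q + ((lattice a c n).1 • supportVelocity J p t 0
        + (lattice a c n).2 • supportVelocity J p t 1)) J t :=
    (hb.hasDerivWithinAt hJ ht q).add (((hp 0).fun_const_smul _).fun_add ((hp 1).fun_const_smul _))
  have h3 := h2.congr_of_mem (f₁ := fun s => b s (q + lattice a c n))
    (fun s hs => by rw [(hb.2 s hs).1.add_lattice, ofPair_apply]) ht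
  rw [(uniqueDiffOn_of_ordConnected hJ hJ' t ht).eq_deriv J h1 h3, ofPair_apply]

theorem IsMode.hasDerivWithinAt_effMetric (hb : IsMode a c P x J p b) (ha : 0 < a) (hc : 0 < c)
    (hJ : J.OrdConnected) {t : ℝ} (ht : t ∈ J) (μ ν : Fin 2) :
    HasDerivWithinAt (effMetric p μ ν)
      (inner ℝ (p t μ) (supportVelocity J p t ν) + inner ℝ (p t ν) (supportVelocity J p t μ)) J t := by
  have hp := hb.hasDerivWithinAt_support ha hc hJ ht
  have := (hp μ).inner ℝ (hp ν)
  rw [real_inner_comm (p t ν)] at this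
  exact this

theorem IsMode.effStrain_eq (hb : IsMode a c P x J p b) (ha : 0 < a) (hc : 0 < c)
    (hJ : J.OrdConnected) (hJ' : J.Nontrivial) {t : ℝ} (ht : t ∈ J) (μ ν : Fin 2) :
    effStrain J p μ ν t = (inner ℝ (p t μ) (supportVelocity J p t ν)
      + inner ℝ (p t ν) (supportVelocity J p t μ)) / 2 := by
  unfold effStrain
  rw [(hb.hasDerivWithinAt_effMetric ha hc hJ ht μ ν).derivWithin
    (uniqueDiffOn_of_ordConnected hJ hJ' t ht)]

theorem IsMode.continuousOn_effStrain (hb : IsMode a c P x J p b) (ha : 0 < a) (hc : 0 < c)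
    (hJ : J.OrdConnected) (hJ' : J.Nontrivial) (μ ν : Fin 2) :
    ContinuousOn (effStrain J p μ ν) J := by
  have hp : ∀ μ, ContinuousOn (fun t => p t μ) J := fun μ t ht =>
    (hb.hasDerivWithinAt_support ha hc hJ ht μ).continuousWithinAt
  have hp' := hb.continuousOn_supportVelocity ha hc hJ hJ'
  exact ((((hp μ).inner (hp' ν)).add ((hp ν).inner (hp' μ))).div_const 2).congr
    fun t ht => hb.effStrain_eq ha hc hJ hJ' ht μ ν

end Mode


/-! ### Recurrence of the fast variable modulo the lattice -/

/-- Positive multiples of a vector of irrational slope come back, modulo the lattice, to any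
neighbourhood of any point of the plane. -/
theorem exists_recurrence {a c : ℝ} (ha : 0 < a) (hc : 0 < c) {U : Par} (hU : U.1 ≠ 0)
    (hirr : Irrational (a * U.2 / (c * U.1))) (u : Par) {δ : ℝ} (hδ : 0 < δ) (M : ℝ) :
    ∃ τ : ℝ, M ≤ τ ∧ ∃ n : ℤ × ℤ, dist (τ • U - lattice a c n) u < δ := by
  obtain ⟨σ, hσ⟩ : ∃ σ : ℤ, 0 < (σ : ℝ) / U.1 ∧ (σ = 1 ∨ σ = -1) := by
    rcases lt_or_gt_of_ne hU with h | h
    · exact ⟨-1, by simpa using div_pos_of_neg_of_neg (by norm_num : (-1 : ℝ) < 0) h, by simp⟩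
    · exact ⟨1, by simpa using h, by simp⟩
  have : Fact (0 < c) := ⟨hc⟩
  -- With τ = u.1 / U.1 + m a σ / U.1, the first coordinate of τ U equals u.1 exactly modulo a, and
  -- the second one is close to u.2 modulo c when m r is close to w modulo c. Density of the
  -- multiples of r in ℝ/cℤ provides such m, arbitrarily large; the sign σ makes τ → +∞ with m.
  set r : ℝ := σ * a * U.2 / U.1 with hr
  set w : ℝ := u.2 - u.1 * U.2 / U.1 with hw
  have hirr' : Irrational (r / c) := by
    have e : a * U.2 / (c * U.1) = (σ : ℝ) * (r / c) := by
      rcases hσ.2 with h | h <;> rw [hr, h] <;> push_cast <;> field_simp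
    rw [e] at hirr
    rcases hσ.2 with h | h <;> simpa [h] using hirr
  have hd : DenseRange (· • (r : AddCircle c) : ℤ → AddCircle c) :=
    AddCircle.denseRange_zsmul_coe_iff.2 hirr'
  have hcl : MapClusterPt (w : AddCircle c) atTop (· • (r : AddCircle c) : ℕ → AddCircle c) := by
    rw [mapClusterPt_atTop_nsmul_iff_mem_topologicalClosure_zmultiples,
      ← SetLike.mem_coe, AddSubgroup.topologicalClosure_coe, AddSubgroup.coe_zmultiples]
    exact hd _
  have hfr := mapClusterPt_iff_frequently.1 hcl _ (Metric.ball_mem_nhds _ hδ)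
  have htop : Tendsto (fun m : ℕ => u.1 / U.1 + m * (a * (σ / U.1))) atTop atTop :=
    tendsto_atTop_add_const_left _ _
      (tendsto_natCast_atTop_atTop.atTop_mul_const (mul_pos ha hσ.1))
  obtain ⟨m, hm, hmM⟩ := (hfr.and_eventually (htop.eventually_ge_atTop M)).exists
  refine ⟨_, hmM, (σ * m, round (c⁻¹ * (m * r - w))), ?_⟩
  rw [Metric.mem_ball, dist_eq_norm, ← AddCircle.coe_nsmul, ← AddCircle.coe_sub, nsmul_eq_mul,
    AddCircle.norm_eq] at hm
  rw [Prod.dist_eq, max_lt_iff, Real.dist_eq, Real.dist_eq]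
  constructor
  · have : (u.1 / U.1 + m * (a * (σ / U.1))) * U.1 - (σ * m) * a - u.1 = 0 := by
      field_simp; ring
    simpa [lattice, this] using hδ
  · have : (u.1 / U.1 + m * (a * (σ / U.1))) * U.2 - u.2 = m * r - w := by
      rw [hr, hw]; field_simp; ring
    simp only [lattice, Prod.snd_sub, Prod.smul_snd, smul_eq_mul]
    rwa [sub_right_comm, this]

/-! ### The two-scale ansatz and its derivative -/

section Mode

variable {a c : ℝ} {P : CreasePattern univ} {x : Par → E3} {J : Set ℝ} {p : ℝ → Fin 2 → E3}
  {b : ℝ → Par → E3}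

theorem IsMode.hasFDerivAt_comp_right (hb : IsMode a c P x J p b) (hJ : J.OrdConnected)
    {θ : Par → ℝ} {Dθ : Par →L[ℝ] ℝ} {U : Par} (hθ : HasFDerivAt θ Dθ U)
    (hθJ : ∀ᶠ q' in 𝓝 U, θ q' ∈ J) (q : Par) :
    HasFDerivAt (fun q' => b (θ q') q) (Dθ.smulRight (velocity J b (θ U) q)) U := by
  have h1 := (hb.hasDerivWithinAt hJ hθJ.self_of_nhds q).hasFDerivWithinAt.comp_hasFDerivAt U hθ hθJ
  refine HasFDerivAt.congr_fderiv h1 (ContinuousLinearMap.ext fun v => ?_)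
  simp

/-- The chain rule for the composition of a mode with a slow parameter and a fast argument. -/
theorem IsMode.hasFDerivAt_comp (hb : IsMode a c P x J p b) (hJ : J.OrdConnected)
    (hJ' : J.Nontrivial)
    {θ : Par → ℝ} {Dθ : Par →L[ℝ] ℝ} {U : Par} (hθ : HasFDerivAt θ Dθ U)
    (hθJ : ∀ᶠ q' in 𝓝 U, θ q' ∈ J) {l : Par → Par} {L : Par →L[ℝ] Par} (hl : HasFDerivAt l L U)
    {i : P.ι} (hq : l U ∈ P.piece i) :
    HasFDerivAt (fun q' => b (θ q') (l q'))
      (Dθ.smulRight (velocity J b (θ U) (l U)) + (fderiv ℝ (b (θ U)) (l U)).comp L) U := by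
  have ht := hθJ.self_of_nhds
  obtain ⟨h₀, _, _, hc₀, _, _, hd⟩ := hb.1.exists_velocities i
  have hd₀ := fun t ht q hq => (hd t ht q hq).1
  have h1 : HasFDerivAt (fun q' => b (θ U) (l q')) ((fderiv ℝ (b (θ U)) (l U)).comp L) U :=
    HasFDerivAt.comp U ((hb.contDiffAt ht hq).differentiableAt (by simp)).hasFDerivAt hl
  have h2 : HasFDerivAt (fun q' => (θ q' - θ U) • h₀ (θ U, l U)) (Dθ.smulRight (h₀ (θ U, l U))) U :=
    (hθ.sub_const _).smul_const _
  -- The change of parameter happens at the moving point l q'. Differentiability in t being uniform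
  -- near l U, its error is o(θ q' - θ U), hence o(q' - U).
  have h3 : HasFDerivAt (fun q' => b (θ q') (l q') - b (θ U) (l q')
      - (θ q' - θ U) • h₀ (θ U, l U)) (0 : Par →L[ℝ] E3) U := by
    rw [hasFDerivAt_iff_isLittleO]
    have hO : (fun q' => θ q' - θ U) =O[𝓝 U] fun q' => q' - U := hθ.isBigO_sub
    refine Asymptotics.IsLittleO.trans_isBigO ?_ hO
    rw [Asymptotics.isLittleO_iff]
    intro ε hε
    obtain ⟨δ, hδ, hest⟩ := eventually_norm_sub_le hJ hc₀ hd₀ ht (subset_closure hq) hε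
    filter_upwards [hθJ, hθ.continuousAt.eventually (Metric.ball_mem_nhds _ hδ),
      hl.continuousAt.eventually (Metric.ball_mem_nhds _ hδ),
      hl.continuousAt.eventually ((P.isOpen_piece i).mem_nhds hq)] with q' k1 k2 k3 k4
    simpa using hest (l q') k4 k3 (θ q') k1 k2
  have h4 := (h3.add h2).add h1
  have hh : h₀ (θ U, l U) = velocity J b (θ U) (l U) :=
    (hb.velocity_eq hJ hJ' hc₀ hd₀ ht (subset_closure hq)).symm
  rw [zero_add, hh] at h4
  refine h4.congr_of_eventuallyEq (Eventually.of_forall fun q' => ?_)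
  simp

end Mode

/-- A two-scale ansatz, of mode `b`, over an open set `V` on which its slow fields are
differentiable. -/
structure IsAnsatzOn (a c : ℝ) (P : CreasePattern univ) (x : Par → E3) (J : Set ℝ)
    (b : ℝ → Par → E3) (Y : Par → E3) (z₁ z₂ : Par → Par → E3) (θ : Par → ℝ)
    (R : Par → E3 →L[ℝ] E3) (T : Par → E3) (V : Set Par) : Prop where
  isOpen : IsOpen V
  contDiffOn : ContDiffOn ℝ ∞ Y V
  θ_mem : ∀ U ∈ V, θ U ∈ J
  differentiableAt_θ : ∀ U ∈ V, DifferentiableAt ℝ θ U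
  differentiableAt_R : ∀ U ∈ V, DifferentiableAt ℝ R U
  differentiableAt_T : ∀ U ∈ V, DifferentiableAt ℝ T U
  R_mem : ∀ U ∈ V, R U ∈ unitary (E3 →L[ℝ] E3)
  periodic_z₁ : ∀ U ∈ V, IsCellPeriodic a c (z₁ U)
  periodic_z₂ : ∀ U ∈ V, IsCellPeriodic a c (z₂ U)
  continuousOn_z₂ : ContinuousOn (Function.uncurry z₂) (V ×ˢ univ)
  smoothUpTo_z₂ : ∀ i, SmoothUpTo (Function.uncurry z₂) (V ×ˢ P.piece i)
  z₁_eq : ∀ U ∈ V, ∀ q : Par,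
    z₁ U q = R U (b (θ U) q) - q.1 • pd 0 Y U - q.2 • pd 1 Y U + T U
  metric_le : ∃ C : ℝ, ∀ᶠ ε in 𝓝[>] (0 : ℝ), ∀ q ∈ V, ContDiffAt ℝ ∞ (refine x ε) q →
    ∀ μ ν, |metric (refine x ε) μ ν q - metric (ansatz Y z₁ z₂ ε) μ ν q| ≤ C * ε ^ 2

/-- The derivative of the ansatz in the slow variable, to the first order. -/
noncomputable def slowDeriv (J : Set ℝ) (b : ℝ → Par → E3) (Y : Par → E3) (θ : Par → ℝ)
    (R : Par → E3 →L[ℝ] E3) (T : Par → E3) (U q : Par) : Par →L[ℝ] E3 :=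
  (fderiv ℝ R U).flip (b (θ U) q) + (fderiv ℝ θ U).smulRight (R U (velocity J b (θ U) q))
    - (fderiv ℝ (fderiv ℝ Y) U).flip q + fderiv ℝ T U

theorem slowDeriv_apply (J : Set ℝ) (b : ℝ → Par → E3) (Y : Par → E3) (θ : Par → ℝ)
    (R : Par → E3 →L[ℝ] E3) (T : Par → E3) (U q v : Par) :
    slowDeriv J b Y θ R T U q v = fderiv ℝ R U v (b (θ U) q)
      + fderiv ℝ θ U v • R U (velocity J b (θ U) q) - fderiv ℝ (fderiv ℝ Y) U v q
      + fderiv ℝ T U v := by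
  simp [slowDeriv]

namespace IsAnsatzOn

variable {a c : ℝ} {P : CreasePattern univ} {x : Par → E3} {J : Set ℝ} {p : ℝ → Fin 2 → E3}
  {b : ℝ → Par → E3} {Y : Par → E3} {z₁ z₂ : Par → Par → E3} {θ : Par → ℝ}
  {R : Par → E3 →L[ℝ] E3} {T : Par → E3} {V : Set Par} {U : Par}

theorem eventually_mem (h : IsAnsatzOn a c P x J b Y z₁ z₂ θ R T V) (hU : U ∈ V) :
    ∀ᶠ q' in 𝓝 U, q' ∈ V := h.isOpen.mem_nhds hU

theorem eventually_θ_mem (h : IsAnsatzOn a c P x J b Y z₁ z₂ θ R T V) (hU : U ∈ V) :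
    ∀ᶠ q' in 𝓝 U, θ q' ∈ J := (h.eventually_mem hU).mono h.θ_mem

theorem contDiffAt (h : IsAnsatzOn a c P x J b Y z₁ z₂ θ R T V) (hU : U ∈ V) :
    ContDiffAt ℝ ∞ Y U := h.contDiffOn.contDiffAt (h.isOpen.mem_nhds hU)

theorem hasFDerivAt_fderiv (h : IsAnsatzOn a c P x J b Y z₁ z₂ θ R T V) (hU : U ∈ V) :
    HasFDerivAt (fderiv ℝ Y) (fderiv ℝ (fderiv ℝ Y) U) U :=
  (IsBendingSystem.differentiableAt_fderiv ((h.contDiffAt hU).of_le two_le_infty)).hasFDerivAt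

theorem z₁_eq' (h : IsAnsatzOn a c P x J b Y z₁ z₂ θ R T V) (hU : U ∈ V) (q : Par) :
    z₁ U q = R U (b (θ U) q) - fderiv ℝ Y U q + T U := by
  rw [h.z₁_eq U hU, map_par (fderiv ℝ Y U) q, sub_sub]
  rfl

/-- The slow derivatives are the images of the support vectors. -/
theorem fderiv_eq (h : IsAnsatzOn a c P x J b Y z₁ z₂ θ R T V) (hb : IsMode a c P x J p b)
    (ha : 0 < a) (hc : 0 < c) (hU : U ∈ V) (v : Par) :
    fderiv ℝ Y U v = R U (ofPair (p (θ U)) v) := by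
  have key : ∀ n, fderiv ℝ Y U (lattice a c n) = R U (ofPair (p (θ U)) (lattice a c n)) := by
    intro n
    have h1 := (h.periodic_z₁ U hU).add_lattice n 0
    rw [h.z₁_eq' hU, h.z₁_eq' hU, (hb.2 _ (h.θ_mem U hU)).1.add_lattice] at h1
    simp only [map_add, map_zero] at h1
    have h2 : R U (b (θ U) 0) + R U (ofPair (p (θ U)) (lattice a c n)) - (0 + fderiv ℝ Y U (lattice a c n))
      + T U - (R U (b (θ U) 0) - 0 + T U) = 0 := sub_eq_zero.2 h1
    rw [← sub_eq_zero, ← neg_eq_zero, ← h2]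
    abel
  have e0 : e₀ = a⁻¹ • lattice a c (1, 0) := by ext <;> simp [lattice, ha.ne']
  have e1 : e₁ = c⁻¹ • lattice a c (0, 1) := by ext <;> simp [lattice, hc.ne']
  have k0 : fderiv ℝ Y U e₀ = R U (ofPair (p (θ U)) e₀) := by
    rw [e0]; simp only [map_smul, key]
  have k1 : fderiv ℝ Y U e₁ = R U (ofPair (p (θ U)) e₁) := by
    rw [e1]; simp only [map_smul, key]
  rw [map_par (fderiv ℝ Y U) v, map_par (ofPair (p (θ U))) v, k0, k1]
  simp only [map_add, map_smul]

theorem hasFDerivAt_z₁ (h : IsAnsatzOn a c P x J b Y z₁ z₂ θ R T V) (hb : IsMode a c P x J p b)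
    (hJ : J.OrdConnected) (hU : U ∈ V) (q : Par) :
    HasFDerivAt (fun q' => z₁ q' q) (slowDeriv J b Y θ R T U q) U := by
  have h1 := hb.hasFDerivAt_comp_right hJ (h.differentiableAt_θ U hU).hasFDerivAt
    (h.eventually_θ_mem hU) q
  have h2 := (((h.differentiableAt_R U hU).hasFDerivAt.clm_apply h1).sub
    ((h.hasFDerivAt_fderiv hU).clm_apply (hasFDerivAt_const q U))).add
    (h.differentiableAt_T U hU).hasFDerivAt
  refine (h2.congr_of_eventuallyEq ?_).congr_fderiv ?_
  · filter_upwards [h.eventually_mem hU] with q' hq' using h.z₁_eq' hq' q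
  · apply ContinuousLinearMap.ext
    intro v
    rw [slowDeriv_apply]
    simp
    abel

/-- The separate terms grow with q; their sum is periodic as the slow derivative of the periodic z¹.
-/
theorem slowDeriv_add_lattice (h : IsAnsatzOn a c P x J b Y z₁ z₂ θ R T V)
    (hb : IsMode a c P x J p b) (hJ : J.OrdConnected) (hU : U ∈ V) (n : ℤ × ℤ) (q : Par) :
    slowDeriv J b Y θ R T U (q + lattice a c n) = slowDeriv J b Y θ R T U q := by
  refine (h.hasFDerivAt_z₁ hb hJ hU _).unique ((h.hasFDerivAt_z₁ hb hJ hU q).congr_of_eventuallyEq ?_)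
  filter_upwards [h.eventually_mem hU] with q' hq' using (h.periodic_z₁ q' hq').add_lattice n q

theorem contDiffAt_z₂ (h : IsAnsatzOn a c P x J b Y z₁ z₂ θ R T V) (hU : U ∈ V)
    {i : P.ι} {q : Par} (hq : q ∈ P.piece i) : ContDiffAt ℝ ∞ (Function.uncurry z₂) (U, q) :=
  (h.smoothUpTo_z₂ i).1.contDiffAt
    ((h.isOpen.prod (P.isOpen_piece i)).mem_nhds ⟨hU, hq⟩)

/-- The derivative of the ansatz, at a point whose fast coordinate is `q` modulo the lattice. -/
theorem hasFDerivAt_ansatz (h : IsAnsatzOn a c P x J b Y z₁ z₂ θ R T V)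
    (hb : IsMode a c P x J p b) (hJ : J.OrdConnected) (hJ' : J.Nontrivial) (hU : U ∈ V)
    {i : P.ι} {ε : ℝ} (hε : ε ≠ 0)
    {n : ℤ × ℤ} {q : Par} (hqn : q = ε⁻¹ • U - lattice a c n) (hq : q ∈ P.piece i) :
    HasFDerivAt (ansatz Y z₁ z₂ ε) ((R U).comp (fderiv ℝ (b (θ U)) q)
      + ε • (slowDeriv J b Y θ R T U q
        + (fderiv ℝ (Function.uncurry z₂) (U, q)).comp (ContinuousLinearMap.inr ℝ Par Par))
      + ε ^ 2 • (fderiv ℝ (Function.uncurry z₂) (U, q)).comp (ContinuousLinearMap.inl ℝ Par Par))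
      U := by
  -- By periodicity, z¹ and z² may be evaluated at a translate of q'/ε that stays near a chosen fast
  -- point while ε varies.
  let l : Par → Par := fun q' => ε⁻¹ • q' - lattice a c n
  have hlU : l U = q := hqn.symm
  have hl : HasFDerivAt l (ε⁻¹ • ContinuousLinearMap.id ℝ Par) U :=
    ((hasFDerivAt_id U).const_smul ε⁻¹).sub_const _
  have h1 := hb.hasFDerivAt_comp hJ hJ' (h.differentiableAt_θ U hU).hasFDerivAt
    (h.eventually_θ_mem hU) hl (i := i) (by rwa [hlU])
  have h2 := (((h.differentiableAt_R U hU).hasFDerivAt.clm_apply h1).sub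
    ((h.hasFDerivAt_fderiv hU).clm_apply hl)).add (h.differentiableAt_T U hU).hasFDerivAt
  have h3 : HasFDerivAt (fun q' => Function.uncurry z₂ (q', l q')) _ U :=
    HasFDerivAt.comp U (g := Function.uncurry z₂) (f := fun q' => (q', l q'))
      (((h.contDiffAt_z₂ hU (by rwa [hlU])).differentiableAt (by simp)).hasFDerivAt)
      ((hasFDerivAt_id U).prodMk hl)
  have hY := ((h.contDiffAt hU).differentiableAt (by simp)).hasFDerivAt
  -- The fast derivative of -DY(l) inside ε z¹ has order 1 and cancels the derivative of Y, which
  -- leaves R db at the leading order.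
  have h4 := (hY.add (h2.const_smul ε)).add (h3.const_smul (ε ^ 2))
  refine (h4.congr_of_eventuallyEq ?_).congr_fderiv ?_
  · filter_upwards [h.eventually_mem hU] with q' hq'
    have e : ε⁻¹ • q' = l q' + lattice a c n := by simp [l]
    simp only [ansatz, e, (h.periodic_z₁ q' hq').add_lattice, (h.periodic_z₂ q' hq').add_lattice,
      h.z₁_eq' hq']
    rfl
  · rw [hlU]
    apply ContinuousLinearMap.ext
    intro v
    have hz : fderiv ℝ (Function.uncurry z₂) (U, q) (v, ε⁻¹ • v)
        = fderiv ℝ (Function.uncurry z₂) (U, q) (v, 0)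
          + ε⁻¹ • fderiv ℝ (Function.uncurry z₂) (U, q) (0, v) := by
      rw [← map_smul, ← map_add]; simp
    simp [slowDeriv_apply, hz, smul_add, smul_sub, smul_smul, hε, pow_two]
    abel

end IsAnsatzOn


/-! ### The order ε of the metric -/

/-- The first-order term of a metric which is constant up to the second order vanishes. -/
theorem inner_add_inner_eq_zero_of_le {α : Type*} {l : Filter α} [l.NeBot] {ε : α → ℝ}
    (hε : Tendsto ε l (𝓝[>] 0)) {f f' g g' : α → E3} {F F' G G' : E3} (hf : Tendsto f l (𝓝 F))
    (hf' : Tendsto f' l (𝓝 F')) (hg : Tendsto g l (𝓝 G)) (hg' : Tendsto g' l (𝓝 G')) {C : ℝ}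
    (h : ∀ᶠ k in l, |inner ℝ (f k) (f' k) - inner ℝ (f k + ε k • g k) (f' k + ε k • g' k)|
      ≤ C * ε k ^ 2) : inner ℝ F G' + inner ℝ F' G = (0 : ℝ) := by
  have hε0 : Tendsto ε l (𝓝 0) := hε.mono_right nhdsWithin_le_nhds
  have l1 : Tendsto (fun k => |inner ℝ (f k) (g' k) + inner ℝ (f' k) (g k)
      + ε k * inner ℝ (g k) (g' k)|) l (𝓝 |inner ℝ F G' + inner ℝ F' G + 0 * inner ℝ G G'|) :=
    (((hf.inner hg').add (hf'.inner hg)).add (hε0.mul (hg.inner hg'))).abs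
  have l2 : Tendsto (fun k => C * ε k) l (𝓝 (C * 0)) := hε0.const_mul C
  have l3 := le_of_tendsto_of_tendsto l1 l2 (by
    filter_upwards [h, hε.eventually self_mem_nhdsWithin] with k hk hpos
    have hpos : 0 < ε k := hpos
    have e : (inner ℝ (f k) (f' k) - inner ℝ (f k + ε k • g k) (f' k + ε k • g' k) : ℝ)
        = - (ε k * (inner ℝ (f k) (g' k) + inner ℝ (f' k) (g k) + ε k * inner ℝ (g k) (g' k))) := by
      simp only [inner_add_left, inner_add_right, inner_smul_left, inner_smul_right,
        RCLike.conj_to_real]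
      rw [real_inner_comm (f' k) (g k)]
      ring
    rw [e, abs_neg, abs_mul, abs_of_pos hpos, pow_two, ← mul_assoc, mul_comm] at hk
    exact le_of_mul_le_mul_right hk hpos)
  rw [mul_zero, zero_mul, add_zero] at l3
  exact abs_eq_zero.1 (le_antisymm l3 (abs_nonneg _))

/-- The derivative of a refined periodic surface. -/
theorem fderiv_refine_eq {x : Par → E3} {l w : Par} {s : E3} {ε : ℝ} (hε : ε ≠ 0)
    (hx : ∀ q, x (q + l) = x q + s) {q : Par} (hq : q = ε⁻¹ • w - l)
    (hcd : ContDiffAt ℝ ∞ x q) :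
    ContDiffAt ℝ ∞ (refine x ε) w ∧ fderiv ℝ (refine x ε) w = fderiv ℝ x q := by
  let g : Par → Par := fun w => ε⁻¹ • w - l
  have hg : g w = q := hq.symm
  have e : refine x ε = fun w => ε • (x (g w) + s) := by
    ext1 w
    rw [← hx]
    simp [refine, g]
  have hgd : HasFDerivAt g (ε⁻¹ • ContinuousLinearMap.id ℝ Par) w :=
    ((hasFDerivAt_id w).const_smul ε⁻¹).sub_const _
  have hgc : ContDiffAt ℝ ∞ g w := by fun_prop
  rw [e]
  refine ⟨((ContDiffAt.comp w (by rwa [hg]) hgc).add contDiffAt_const).const_smul ε, ?_⟩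
  have h1 : HasFDerivAt x (fderiv ℝ x q) (g w) := by
    rw [hg]; exact (hcd.differentiableAt (by simp)).hasFDerivAt
  have h2 : HasFDerivAt (fun w => ε • (x (g w) + s)) _ w :=
    ((h1.comp w hgd).add_const s).const_smul ε
  rw [h2.fderiv]
  apply ContinuousLinearMap.ext
  intro v
  simp [smul_smul, hε]

theorem IsMode.continuous_velocity {a c : ℝ} {P : CreasePattern univ} {x : Par → E3} {J : Set ℝ}
    {p : ℝ → Fin 2 → E3} {b : ℝ → Par → E3} (hb : IsMode a c P x J p b) (hJ : J.OrdConnected)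
    (hJ' : J.Nontrivial) {t : ℝ} (ht : t ∈ J) : Continuous (velocity J b t) := by
  obtain ⟨B', hB', -⟩ := hb.exists_pwC1_velocity hJ hJ' ht
  exact hB'.continuous

namespace IsAnsatzOn

variable {a c : ℝ} {P : CreasePattern univ} {x : Par → E3} {J : Set ℝ} {p : ℝ → Fin 2 → E3}
  {p₀ : Fin 2 → E3}
  {b : ℝ → Par → E3} {Y : Par → E3} {z₁ z₂ : Par → Par → E3} {θ : Par → ℝ}
  {R : Par → E3 →L[ℝ] E3} {T : Par → E3} {V : Set Par} {U : Par}

/-- The terms of order `ε` in the metric of the ansatz vanish. -/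
theorem isometry_slow (h : IsAnsatzOn a c P x J b Y z₁ z₂ θ R T V) (hb : IsMode a c P x J p b)
    (hx : IsPeriodicSurface a c P p₀ x) (ha : 0 < a) (hc : 0 < c)
    (hJ : J.OrdConnected) (hJ' : J.Nontrivial) (hU : U ∈ V) (hU1 : U.1 ≠ 0)
    (hirr : Irrational (a * U.2 / (c * U.1))) {i : P.ι} {q : Par} (hq : q ∈ P.piece i) (u v : Par) :
    inner ℝ (R U (fderiv ℝ (b (θ U)) q u)) (slowDeriv J b Y θ R T U q v
        + fderiv ℝ (Function.uncurry z₂) (U, q) (0, v))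
      + inner ℝ (R U (fderiv ℝ (b (θ U)) q v)) (slowDeriv J b Y θ R T U q u
        + fderiv ℝ (Function.uncurry z₂) (U, q) (0, u)) = (0 : ℝ) := by
  have ht := h.θ_mem U hU
  set t := θ U with ht_def
  let A : Par → Par →L[ℝ] E3 := fun q => (R U).comp (fderiv ℝ (b t) q)
  let X : Par → Par →L[ℝ] E3 := fun q => slowDeriv J b Y θ R T U q
    + (fderiv ℝ (Function.uncurry z₂) (U, q)).comp (ContinuousLinearMap.inr ℝ Par Par)
  let W : Par → Par →L[ℝ] E3 := fun q =>
    (fderiv ℝ (Function.uncurry z₂) (U, q)).comp (ContinuousLinearMap.inl ℝ Par Par)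
  have cA : ContinuousAt A q := by
    have h1 : ContinuousAt (fderiv ℝ (b t)) q :=
      ((hb.contDiffAt ht hq).fderiv_right (m := 1)
        (by rw [one_add_one_eq_two]; exact two_le_infty)).continuousAt
    exact continuousAt_const.clm_comp h1
  have cz : ContinuousAt (fun q => fderiv ℝ (Function.uncurry z₂) (U, q)) q := by
    have h1 : ContinuousAt (fderiv ℝ (Function.uncurry z₂)) (U, q) :=
      ((h.contDiffAt_z₂ hU hq).fderiv_right (m := 1)
        (by rw [one_add_one_eq_two]; exact two_le_infty)).continuousAt
    exact ContinuousAt.comp (f := fun q : Par => (U, q)) h1 (by fun_prop)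
  have cs : Continuous (slowDeriv J b Y θ R T U) := by
    have c1 := hb.continuous ht
    have c2 := hb.continuous_velocity hJ hJ' ht
    have c3 : Continuous fun q => (fderiv ℝ θ U).smulRight (R U (velocity J b t q)) :=
      ((ContinuousLinearMap.smulRightL ℝ Par E3 (fderiv ℝ θ U)).continuous).comp
        ((R U).continuous.comp c2)
    exact ((((fderiv ℝ R U).flip.continuous.comp c1).add c3).sub
      (fderiv ℝ (fderiv ℝ Y) U).flip.continuous).add continuous_const
  have cX : ContinuousAt X q := cs.continuousAt.add (cz.clm_comp continuousAt_const)
  have cW : ContinuousAt W q := cz.clm_comp continuousAt_const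
  obtain ⟨C, hC⟩ := h.metric_le
  -- The sequence ε = 1/τ k tends to 0 while U/ε, reduced modulo the lattice, tends to the
  -- prescribed fast point q; the slow point U stays fixed.
  choose τ hτ n hn using fun k : ℕ => exists_recurrence ha hc hU1 hirr q
    (δ := 1 / ((k : ℝ) + 1)) (by positivity) ((k : ℝ) + 1)
  have hτpos : ∀ k, 0 < τ k := fun k => lt_of_lt_of_le (by positivity) (hτ k)
  have hτ0 : Tendsto (fun k => (τ k)⁻¹) atTop (𝓝[>] 0) := by
    refine tendsto_inv_atTop_nhdsGT_zero.comp (tendsto_atTop_mono hτ ?_)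
    exact tendsto_atTop_add_const_right _ _ tendsto_natCast_atTop_atTop
  have hqk : Tendsto (fun k => τ k • U - lattice a c (n k)) atTop (𝓝 q) := by
    rw [tendsto_iff_dist_tendsto_zero]
    exact squeeze_zero (fun _ => dist_nonneg) (fun k => (hn k).le)
      tendsto_one_div_add_atTop_nhds_zero_nat
  have hτ0' : Tendsto (fun k => (τ k)⁻¹) atTop (𝓝 0) := hτ0.mono_right nhdsWithin_le_nhds
  have happ : ∀ {L : Par → Par →L[ℝ] E3}, ContinuousAt L q → ∀ μ,
      Tendsto (fun k => L (τ k • U - lattice a c (n k)) (dir μ)) atTop (𝓝 (L q (dir μ))) :=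
    fun hL μ => ((ContinuousLinearMap.apply ℝ E3 (dir μ)).continuous.tendsto _).comp
      (hL.tendsto.comp hqk)
  have tN : ∀ μ, Tendsto (fun k => (X (τ k • U - lattice a c (n k))
      + (τ k)⁻¹ • W (τ k • U - lattice a c (n k))) (dir μ)) atTop (𝓝 (X q (dir μ))) := fun μ => by
    have h1 := (happ cX μ).add (hτ0'.smul (happ cW μ))
    rw [zero_smul, add_zero] at h1
    exact h1
  have key : ∀ μ ν, inner ℝ (A q (dir μ)) (X q (dir ν)) + inner ℝ (A q (dir ν)) (X q (dir μ))
      = (0 : ℝ) := by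
    intro μ ν
    refine inner_add_inner_eq_zero_of_le hτ0 (happ cA μ) (happ cA ν) (tN μ) (tN ν) (C := C) ?_
    filter_upwards [hτ0.eventually hC, hqk.eventually ((P.isOpen_piece i).mem_nhds hq)]
      with k hk hki
    have hε : (τ k)⁻¹ ≠ 0 := inv_ne_zero (hτpos k).ne'
    have hcx : ContDiffAt ℝ ∞ x (τ k • U - lattice a c (n k)) :=
      (hx.1.1.2 i).1.contDiffAt ((P.isOpen_piece i).mem_nhds hki)
    obtain ⟨r1, r2⟩ := fderiv_refine_eq (w := U) hε (hx.add_lattice (n k))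
      (by rw [inv_inv]) hcx
    have hk' := hk U hU r1 μ ν
    have hans := h.hasFDerivAt_ansatz hb hJ hJ' hU hε (n := n k)
      (q := τ k • U - lattice a c (n k)) (by rw [inv_inv]) hki
    unfold metric pd at hk'
    -- The metric of x is that of b (θ U), also after the orthogonal map R U; the terms of order 0
    -- in the two metrics are then identical.
    rw [r2, ← hb.inner_fderiv_eq hcx ht, hans.fderiv,
      ← ContinuousLinearMap.inner_map_map_of_mem_unitary (h.R_mem U hU)] at hk'
    have hsplit : ∀ w : Par, ((R U).comp (fderiv ℝ (b t) (τ k • U - lattice a c (n k)))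
        + (τ k)⁻¹ • X (τ k • U - lattice a c (n k))
        + (τ k)⁻¹ ^ 2 • W (τ k • U - lattice a c (n k))) w
        = A (τ k • U - lattice a c (n k)) w + (τ k)⁻¹ • (X (τ k • U - lattice a c (n k))
          + (τ k)⁻¹ • W (τ k • U - lattice a c (n k))) w := by
      intro w
      simp only [add_apply, smul_apply, A, smul_add, smul_smul, pow_two, add_assoc]
    rw [← hsplit, ← hsplit]
    exact hk'
  have k00 := key 0 0
  have k01 := key 0 1
  have k11 := key 1 1
  simp only [show dir 0 = e₀ from rfl, show dir 1 = e₁ from rfl] at k00 k01 k11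
  have hXw : ∀ w, X q w = slowDeriv J b Y θ R T U q w
      + fderiv ℝ (Function.uncurry z₂) (U, q) (0, w) := fun w => by simp [X]
  rw [← hXw, ← hXw]
  change inner ℝ (A q u) (X q v) + inner ℝ (A q v) (X q u) = (0 : ℝ)
  rw [map_par (A q) u, map_par (A q) v, map_par (X q) u, map_par (X q) v]
  simp only [inner_add_left, inner_add_right, inner_smul_left, inner_smul_right,
    RCLike.conj_to_real]
  linear_combination u.1 * v.1 * k00 + (u.1 * v.2 + u.2 * v.1) * k01 + u.2 * v.2 * k11

/-! ### The bending system of the ansatz and the bending equation -/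

/-- The differential of the orthogonal field `R` is an infinitesimal rotation. -/
theorem exists_rotation (h : IsAnsatzOn a c P x J b Y z₁ z₂ θ R T V) (hU : U ∈ V) :
    ∃ w : Par →L[ℝ] E3, ∀ v y, (star (R U)) (fderiv ℝ R U v y) = cross (w v) y := by
  have hR := (h.differentiableAt_R U hU).hasFDerivAt
  have hskew : ∀ v y y', inner ℝ (fderiv ℝ R U v y) (R U y') + inner ℝ (R U y) (fderiv ℝ R U v y')
      = (0 : ℝ) := by
    intro v y y'
    have h1 : ∀ y, HasFDerivAt (fun q => R q y) ((fderiv ℝ R U).flip y) U := fun y => by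
      simpa using hR.clm_apply (hasFDerivAt_const y U)
    have h2 := ((h1 y).inner ℝ (h1 y')).unique
      ((hasFDerivAt_const (inner ℝ y y' : ℝ) U).congr_of_eventuallyEq (by
        filter_upwards [h.eventually_mem hU] with q hq using
          ContinuousLinearMap.inner_map_map_of_mem_unitary (h.R_mem q hq) y y'))
    have h3 := congrArg (fun L => L v) h2
    simp at h3
    linarith
  have hex : ∀ v, ∃ w, ∀ y, ((star (R U)).comp (fderiv ℝ R U v)) y = cross w y := by
    intro v
    refine exists_cross_of_skew _ fun y y' => ?_
    have := hskew v y y'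
    simp only [ContinuousLinearMap.comp_apply, ContinuousLinearMap.star_eq_adjoint,
      ContinuousLinearMap.adjoint_inner_left, ContinuousLinearMap.adjoint_inner_right]
    exact this
  obtain ⟨w₀, hw₀⟩ := hex e₀
  obtain ⟨w₁, hw₁⟩ := hex e₁
  refine ⟨ofPair ![w₀, w₁], fun v y => ?_⟩
  rw [map_par (fderiv ℝ R U) v]
  simp only [ContinuousLinearMap.comp_apply] at hw₀ hw₁
  simp [hw₀, hw₁]

/-- Removing the rotation R turns dR into an angular velocity. This is where `slowForm` comes from:
k is R* dT, and m is R* D²Y, symmetric because Y is smooth. -/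
theorem star_comp_slowDeriv (h : IsAnsatzOn a c P x J b Y z₁ z₂ θ R T V) (hU : U ∈ V)
    {w : Par →L[ℝ] E3} (hw : ∀ v y, (star (R U)) (fderiv ℝ R U v y) = cross (w v) y) (q : Par) :
    slowForm (b (θ U)) (velocity J b (θ U)) w (fderiv ℝ θ U) ((star (R U)).comp (fderiv ℝ T U))
        ((ContinuousLinearMap.compL ℝ Par E3 E3 (star (R U))).comp (fderiv ℝ (fderiv ℝ Y) U)) q
      = (star (R U)).comp (slowDeriv J b Y θ R T U q) := by
  apply ContinuousLinearMap.ext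
  intro v
  have hs : ∀ y, (star (R U)) (R U y) = y := fun y => by
    rw [← mul_apply_eq_comp, Unitary.star_mul_self_of_mem (h.R_mem U hU),
      one_apply_eq_self]
  have hsym : fderiv ℝ (fderiv ℝ Y) U q v = fderiv ℝ (fderiv ℝ Y) U v q :=
    ((h.contDiffAt hU).isSymmSndFDerivAt (by simpa using two_le_infty)) q v
  rw [ContinuousLinearMap.comp_apply, slowDeriv_apply]
  simp only [map_add, map_sub, map_smul, hw, hs, slowForm_apply]
  simp [hsym]
  abel

/-- The closed form of the ansatz is that of a bending system of the mode. -/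
theorem exists_isBendingSystem (h : IsAnsatzOn a c P x J b Y z₁ z₂ θ R T V)
    (hb : IsMode a c P x J p b) (hx : IsPeriodicSurface a c P p₀ x) (ha : 0 < a) (hc : 0 < c)
    (hJ : J.OrdConnected) (hJ' : J.Nontrivial) (hU : U ∈ V) (hU1 : U.1 ≠ 0)
    (hirr : Irrational (a * U.2 / (c * U.1)))
    {w : Par →L[ℝ] E3} (hw : ∀ v y, (star (R U)) (fderiv ℝ R U v y) = cross (w v) y) :
    ∃ B B' Z, IsBendingSystem P (b (θ U)) (velocity J b (θ U)) (fun q => (star (R U)) (z₂ U q))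
      B B' Z w (fderiv ℝ θ U) ((star (R U)).comp (fderiv ℝ T U))
      ((ContinuousLinearMap.compL ℝ Par E3 E3 (star (R U))).comp (fderiv ℝ (fderiv ℝ Y) U)) := by
  have ht := h.θ_mem U hU
  obtain ⟨B, hB, hBne⟩ := (hb.2 _ ht).1.1.exists_pwC1
  obtain ⟨B', hB', hcd', hd'⟩ := hb.exists_pwC1_velocity hJ hJ' ht
  choose g hgc hge using fun i => (h.smoothUpTo_z₂ i).2 1
  let curry := (continuousMultilinearCurryFin1 ℝ (Par × Par) E3)
  -- The fast part of the derivative of z², extended to the closed piece and rotated by R*.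
  let Z : P.ι → Par → Par →L[ℝ] E3 := fun i q =>
    (star (R U)).comp ((curry (g i (U, q))).comp (ContinuousLinearMap.inr ℝ Par Par))
  have hcurry : ∀ i, ∀ q ∈ P.piece i,
      curry (g i (U, q)) = fderiv ℝ (Function.uncurry z₂) (U, q) := by
    intro i q hq
    rw [hge i ⟨hU, hq⟩]
    apply ContinuousLinearMap.ext
    intro v
    simp [curry, iteratedFDeriv_one_apply]
  have hZ : ∀ i, ∀ q ∈ P.piece i, HasFDerivAt (fun q => (star (R U)) (z₂ U q)) (Z i q) q := by
    intro i q hq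
    have h1 : HasFDerivAt (fun q => Function.uncurry z₂ (U, q)) _ q :=
      HasFDerivAt.comp q (g := Function.uncurry z₂) (f := fun q => (U, q))
        (((h.contDiffAt_z₂ hU hq).differentiableAt (by simp)).hasFDerivAt)
        (hasFDerivAt_prodMk_right U q)
    have h2 := (star (R U)).hasFDerivAt.comp q h1
    refine h2.congr_fderiv ?_
    simp only [Z, hcurry i q hq]
  refine ⟨B, B', Z, hB, hB', ⟨?_, hZ, fun i => ?_⟩, fun i q hq => ?_, hcd', fun i q hq => ?_, hBne,
    fun u v => ?_, fun i q hq u v => ?_, fun i q hq u v => ?_⟩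
  · refine (star (R U)).continuous.comp ?_
    have : ContinuousOn (fun q => Function.uncurry z₂ (U, q)) univ :=
      h.continuousOn_z₂.comp (by fun_prop) fun q _ => ⟨hU, mem_univ _⟩
    rwa [continuousOn_univ] at this
  · have h1 : ContinuousOn (fun q => curry (g i (U, q))) (closure (P.piece i)) := by
      refine curry.continuous.comp_continuousOn ((hgc i).comp (by fun_prop) fun q hq => ?_)
      rw [closure_prod_eq]
      exact ⟨subset_closure hU, hq⟩
    exact continuousOn_const.clm_comp (h1.clm_comp continuousOn_const)
  · exact (hb.contDiffAt ht hq).of_le two_le_infty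
  · have h1 : ContDiffAt ℝ 2 (fun q => Function.uncurry z₂ (U, q)) q :=
      ContDiffAt.comp q (g := Function.uncurry z₂) (f := fun q => (U, q))
        ((h.contDiffAt_z₂ hU hq).of_le two_le_infty) (by fun_prop)
    exact (star (R U)).contDiff.contDiffAt.comp q h1
  · have hsym : fderiv ℝ (fderiv ℝ Y) U u v = fderiv ℝ (fderiv ℝ Y) U v u :=
      ((h.contDiffAt hU).isSymmSndFDerivAt (by simpa using two_le_infty)) u v
    simp [hsym]
  · have hcx : ContDiffAt ℝ ∞ x q := (hx.1.1.2 i).1.contDiffAt ((P.isOpen_piece i).mem_nhds hq)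
    rw [← (hB.hasFDerivAt i q hq).fderiv]
    exact hb.isometry_velocity hJ hJ' ht hcx (hd' i q hq) u v
  · have key := h.isometry_slow hb hx ha hc hJ hJ' hU hU1 hirr hq u v
    rw [h.star_comp_slowDeriv hU hw, ← (hB.hasFDerivAt i q hq).fderiv]
    have e : ∀ v, ((star (R U)).comp (slowDeriv J b Y θ R T U q)) v + Z i q v
        = (star (R U)) (slowDeriv J b Y θ R T U q v
          + fderiv ℝ (Function.uncurry z₂) (U, q) (0, v)) := fun v => by
      simp [Z, hcurry i q hq]
    rw [e, e]
    simp only [ContinuousLinearMap.star_eq_adjoint, ContinuousLinearMap.adjoint_inner_right]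
    exact key

/-- The equation of bending, at the points of irrational slope. -/
theorem bending_eq (h : IsAnsatzOn a c P x J b Y z₁ z₂ θ R T V)
    (hb : IsMode a c P x J p b) (hx : IsPeriodicSurface a c P p₀ x) (ha : 0 < a) (hc : 0 < c)
    (hJ : J.OrdConnected) (hJ' : J.Nontrivial) (hU : U ∈ V) (hU1 : U.1 ≠ 0)
    (hirr : Irrational (a * U.2 / (c * U.1))) :
    effStrain J p 1 1 (θ U) • pd 0 (pd 0 Y) U + effStrain J p 0 0 (θ U) • pd 1 (pd 1 Y) U
      - (2 * effStrain J p 0 1 (θ U)) • pd 1 (pd 0 Y) U = 0 := by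
  have ht := h.θ_mem U hU
  obtain ⟨w, hw⟩ := h.exists_rotation hU
  obtain ⟨B, B', Z, hsys⟩ := h.exists_isBendingSystem hb hx ha hc hJ hJ' hU hU1 hirr hw
  have hrec := hsys.reciprocity ha hc
    (fun n q => fderiv_add_lattice (fun q => (hb.2 _ ht).1.add_lattice n q) q)
    (fun n q => fderiv_add_lattice (fun q => hb.velocity_add_lattice ha hc hJ hJ' ht n q) q)
    (fun n q => fderiv_add_lattice (v := 0) (fun q => by
      simp only [(h.periodic_z₂ U hU).add_lattice, add_zero]) q)
    (fun n q => by
      rw [h.star_comp_slowDeriv hU hw, h.star_comp_slowDeriv hU hw,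
        h.slowDeriv_add_lattice hb hJ hU])
    (ofPair (supportVelocity J p (θ U)))
    (fun n q => by rw [hb.velocity_add_lattice ha hc hJ hJ' ht, map_add]; abel)
  have hs : ∀ y, (star (R U)) (R U y) = y := fun y => by
    rw [← mul_apply_eq_comp, Unitary.star_mul_self_of_mem (h.R_mem U hU),
      one_apply_eq_self]
  have hs' : ∀ y, (R U) (star (R U) y) = y := fun y => by
    rw [← mul_apply_eq_comp, Unitary.mul_star_self_of_mem (h.R_mem U hU),
      one_apply_eq_self]
  -- Differentiate Y_μ = R p_μ(θ), valid on the whole piece, and remove the rotation.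
  have hD : ∀ u μ, (star (R U)) (fderiv ℝ (fderiv ℝ Y) U u (dir μ))
      = cross (w u) (p (θ U) μ) + fderiv ℝ θ U u • supportVelocity J p (θ U) μ := by
    intro u μ
    have hp : HasFDerivAt (fun q => p (θ q) μ) _ U :=
      (hb.hasDerivWithinAt_support ha hc hJ ht μ).hasFDerivWithinAt.comp_hasFDerivAt U
        (h.differentiableAt_θ U hU).hasFDerivAt (h.eventually_θ_mem hU)
    have h1 := (h.differentiableAt_R U hU).hasFDerivAt.clm_apply hp
    have h2 := ((h.hasFDerivAt_fderiv hU).clm_apply (hasFDerivAt_const (dir μ) U)).unique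
      (h1.congr_of_eventuallyEq (by
        filter_upwards [h.eventually_mem hU] with q hq
        rw [h.fderiv_eq hb ha hc hq]
        fin_cases μ <;> simp [dir]))
    have h3 := congrArg (fun L => (star (R U)) (L u)) h2
    simp [hw, hs] at h3
    rw [h3, add_comm]
  have hsym : fderiv ℝ (fderiv ℝ Y) U e₁ e₀ = fderiv ℝ (fderiv ℝ Y) U e₀ e₁ :=
    ((h.contDiffAt hU).isSymmSndFDerivAt (by simpa using two_le_infty)) e₁ e₀
  have hpd : ∀ μ ν, pd μ (pd ν Y) U = fderiv ℝ (fderiv ℝ Y) U (dir μ) (dir ν) := by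
    intro μ ν
    have := (h.hasFDerivAt_fderiv hU).clm_apply (hasFDerivAt_const (dir ν) U)
    have h1 : fderiv ℝ (pd ν Y) U = _ := this.fderiv
    rw [pd, h1]
    simp
  have hne : cross (p (θ U) 0) (p (θ U) 1) ≠ 0 := by
    apply cross_ne_zero
    convert (hb.2 _ ht).1.2.1 using 1
    ext μ
    fin_cases μ <;> rfl
  have D00 := hD e₀ 0
  have D01 := hD e₀ 1
  have D10 := hD e₁ 0
  have D11 := hD e₁ 1
  -- The symmetry of D²Y; with the reciprocity `hrec`, it feeds the pointwise identity.
  have hcompat : cross (w e₁) (p (θ U) 0) + fderiv ℝ θ U e₁ • supportVelocity J p (θ U) 0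
      = cross (w e₀) (p (θ U) 1) + fderiv ℝ θ U e₀ • supportVelocity J p (θ U) 1 := by
    rw [← D10, ← D01]
    exact congrArg _ hsym
  have hid := strain_curvature_identity _ _ _ _ _ _ _ _ hne hcompat (by simpa using hrec)
  rw [← D00, ← D11, ← hcompat, ← D10] at hid
  rw [hpd, hpd, hpd, hb.effStrain_eq ha hc hJ hJ' ht, hb.effStrain_eq ha hc hJ hJ' ht,
    hb.effStrain_eq ha hc hJ hJ' ht]
  have h4 := congrArg (R U) hid
  simp only [map_add, map_sub, map_smul, hs', map_zero] at h4
  rw [← h4]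
  simp only [show dir 0 = e₀ from rfl, show dir 1 = e₁ from rfl]
  congr 3 <;> ring

end IsAnsatzOn


/-! ### Extension by density and conclusion -/

theorem dense_irrational_slope {a c : ℝ} (ha : 0 < a) (hc : 0 < c) :
    Dense {U : Par | U.1 ≠ 0 ∧ Irrational (a * U.2 / (c * U.1))} := by
  rw [dense_iff_inter_open]
  intro O hO hne
  obtain ⟨U, hUO, hU⟩ :=
    ((dense_compl_singleton (0 : ℝ)).preimage isOpenMap_fst).inter_open_nonempty O hO hne
  have hU1 : U.1 ≠ 0 := hU
  have hk : a / (c * U.1) ≠ 0 := div_ne_zero ha.ne' (mul_ne_zero hc.ne' hU1)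
  obtain ⟨s, hs, hirr⟩ := (dense_irrational.preimage
    (Homeomorph.mulLeft₀ _ hk).isOpenMap).inter_open_nonempty {s | (U.1, s) ∈ O}
      (hO.preimage (by fun_prop)) ⟨U.2, hUO⟩
  refine ⟨(U.1, s), hs, hU1, ?_⟩
  have : Irrational (a / (c * U.1) * s) := hirr
  rwa [div_mul_eq_mul_div] at this

theorem contDiffAt_pd {f : Par → E3} {U : Par} (h : ContDiffAt ℝ ∞ f U) (μ : Fin 2) :
    ContDiffAt ℝ ∞ (pd μ f) U :=
  (h.fderiv_right (m := ∞) (by simp)).clm_apply contDiffAt_const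

theorem IsPiecewiseDifferentiable.differentiableAt {Ω : Set Par} {Q : CreasePattern Ω}
    {W : Type*} [NormedAddCommGroup W] [NormedSpace ℝ W] {f : Par → W}
    (h : IsPiecewiseDifferentiable Q f) {j : Q.ι} {U : Par} (hU : U ∈ Q.piece j) :
    DifferentiableAt ℝ f U := by
  obtain ⟨g, hg, hfg⟩ := h j
  have hn := (Q.isOpen_piece j).mem_nhds hU
  exact ((hg.mono subset_closure).differentiableAt hn).congr_of_eventuallyEq
    (hfg.eventuallyEq_of_mem hn)

end CreasedSurface

open CreasedSurface
theorem theorem2 (a c : ℝ) (ha : 0 < a) (hc : 0 < c)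
    (P : CreasePattern univ) (p₀ : Fin 2 → E3) (x : Par → E3)
    (hx : IsPeriodicSurface a c P p₀ x)
    (J : Set ℝ) (hJ : J.OrdConnected) (hJ' : J.Nontrivial)
    (p : ℝ → Fin 2 → E3) (b : ℝ → Par → E3) (hb : IsMode a c P x J p b)
    (Ω : Set Par) (hΩ : IsOpen Ω) (hΩ' : IsConnected Ω)
    (Y : Par → E3) (hY : IsUnimodalEffectiveIsometry a c P Ω x J b Y) :
    (∀ μ ν, DifferentiableOn ℝ (effMetric p μ ν) J) ∧
    ∃ θ : Par → ℝ,
      (∀ U ∈ closure Ω, θ U ∈ J) ∧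
      (∃ Q : CreasePattern Ω, IsPiecewiseDifferentiable Q θ) ∧
      ∀ U ∈ Ω, ContDiffAt ℝ ∞ Y U → ContinuousAt θ U →
        (∀ μ ν, inner ℝ (pd μ Y U) (pd ν Y U) = effMetric p μ ν (θ U)) ∧
        effStrain J p 1 1 (θ U) • pd 0 (pd 0 Y) U
          + effStrain J p 0 0 (θ U) • pd 1 (pd 1 Y) U
          - (2 * effStrain J p 0 1 (θ U)) • pd 1 (pd 0 Y) U = 0 := by
  have hdiff : ∀ μ ν, DifferentiableOn ℝ (effMetric p μ ν) J := fun μ ν t ht =>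
    (hb.hasDerivWithinAt_effMetric ha hc hJ ht μ ν).differentiableWithinAt
  refine ⟨hdiff, ?_⟩
  obtain ⟨Q, z₁, z₂, θ, R, T, ⟨-, -, ⟨C, hC⟩, -⟩, hYs, hθ, hθJ, hR, hRu, hT, hper, -, hz₂c, hz₂,
    hz₁⟩ := hY
  refine ⟨θ, hθJ, ⟨Q, hθ⟩, fun U hU hYU hθU => ?_⟩
  -- U may lie on a crease of Q. It is still in the closure of some piece, and the equations are
  -- reached as limits from within that piece.
  obtain ⟨j, hj⟩ := mem_iUnion.1 (Q.cover (subset_closure hU))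
  have hsub : Q.piece j ⊆ closure Ω := (Q.piece_subset j).trans subset_closure
  have h : IsAnsatzOn a c P x J b Y z₁ z₂ θ R T (Q.piece j) :=
    { isOpen := Q.isOpen_piece j
      contDiffOn := (hYs.1.2 j).1
      θ_mem := fun U hU => hθJ U (hsub hU)
      differentiableAt_θ := fun _ => hθ.differentiableAt
      differentiableAt_R := fun _ => hR.differentiableAt
      differentiableAt_T := fun _ => hT.differentiableAt
      R_mem := fun U hU => hRu U (hsub hU)
      periodic_z₁ := fun U hU => (hper U (hsub hU)).1
      periodic_z₂ := fun U hU => (hper U (hsub hU)).2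
      continuousOn_z₂ := hz₂c.mono (prod_mono hsub subset_rfl)
      smoothUpTo_z₂ := hz₂ j
      z₁_eq := hz₁ j
      metric_le := ⟨C, hC.mono fun ε hε q hq => hε q (Q.piece_subset j hq)⟩ }
  -- D is dense and the piece is open, so U is a limit of points of the piece of irrational slope.
  -- Smoothness of Y and continuity of θ at U, with continuity of the effective strain and metric on
  -- J, let every term converge.
  set D := {U : Par | U.1 ≠ 0 ∧ Irrational (a * U.2 / (c * U.1))}
  have hUD : U ∈ closure (Q.piece j ∩ D) :=
    closure_minimal ((dense_irrational_slope ha hc).open_subset_closure_inter (Q.isOpen_piece j))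
      isClosed_closure hj
  have : (𝓝[Q.piece j ∩ D] U).NeBot := mem_closure_iff_nhdsWithin_neBot.1 hUD
  have hθt : Tendsto θ (𝓝[Q.piece j ∩ D] U) (𝓝[J] (θ U)) :=
    tendsto_nhdsWithin_iff.2 ⟨hθU.tendsto.mono_left nhdsWithin_le_nhds,
      eventually_mem_nhdsWithin.mono fun q hq => h.θ_mem q hq.1⟩
  have hpd : ∀ μ, Tendsto (pd μ Y) (𝓝[Q.piece j ∩ D] U) (𝓝 (pd μ Y U)) := fun μ =>
    (contDiffAt_pd hYU μ).continuousAt.tendsto.mono_left nhdsWithin_le_nhds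
  have hpd2 : ∀ μ ν, Tendsto (pd μ (pd ν Y)) (𝓝[Q.piece j ∩ D] U) (𝓝 (pd μ (pd ν Y) U)) :=
    fun μ ν => (contDiffAt_pd (contDiffAt_pd hYU ν) μ).continuousAt.tendsto.mono_left
      nhdsWithin_le_nhds
  have hθmem : θ U ∈ J := hθJ U (subset_closure hU)
  have hE : ∀ μ ν, Tendsto (fun q => effStrain J p μ ν (θ q)) (𝓝[Q.piece j ∩ D] U)
      (𝓝 (effStrain J p μ ν (θ U))) := fun μ ν =>
    ((hb.continuousOn_effStrain ha hc hJ hJ' μ ν) (θ U) hθmem).tendsto.comp hθt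
  constructor
  · intro μ ν
    have l1 : Tendsto (fun q => (inner ℝ (pd μ Y q) (pd ν Y q) : ℝ)) (𝓝[Q.piece j ∩ D] U)
        (𝓝 (inner ℝ (pd μ Y U) (pd ν Y U))) := (hpd μ).inner (hpd ν)
    have l2 : Tendsto (fun q => effMetric p μ ν (θ q)) (𝓝[Q.piece j ∩ D] U)
        (𝓝 (effMetric p μ ν (θ U))) :=
      ((hdiff μ ν).continuousOn (θ U) hθmem).tendsto.comp hθt
    refine tendsto_nhds_unique (l1.congr' ?_) l2
    filter_upwards [self_mem_nhdsWithin] with q hq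
    have e : ∀ μ, pd μ Y q = R q (p (θ q) μ) := fun μ => by
      rw [pd, h.fderiv_eq hb ha hc hq.1]
      fin_cases μ <;> simp [dir]
    rw [e, e, ContinuousLinearMap.inner_map_map_of_mem_unitary (h.R_mem q hq.1)]
    rfl
  · have l1 := (((hE 1 1).smul (hpd2 0 0)).add ((hE 0 0).smul (hpd2 1 1))).sub
      (((hE 0 1).const_mul 2).smul (hpd2 1 0))
    refine tendsto_nhds_unique (l1.congr' ?_) tendsto_const_nhds
    filter_upwards [self_mem_nhdsWithin] with q hq
    exact h.bending_eq hb hx ha hc hJ hJ' hq.1 hq.2.1 hq.2.2
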